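/- Let $T=\pi$, $\mathbb T=\mathbb R/\pi\mathbb Z$, $a=\mathbf 1_{[0,\pi/4]}$, let $k\in\mathbb N$ be odd, and set $\sigma_k=4k^2$. Let $H^2(\mathbb T)=\{u\in H^2([0,\pi]):u(0)=u(\pi),\,u'(0)=u'(\pi)\}$ with the inner product $(u,v)_{H^2}=\int_0^\pi (uv+u'v'+u''v'')\,dt$, and let $$\mathfrak F:\mathbb R\times H^2(\mathbb T)\to L^2(\mathbb T),\qquad \mathfrak F(\lambda,u)=u''+\lambda u+a(t)u^3,$$ so that the zeros of $\mathfrak F$ are the solutions of $-u''=\lambda u+a(t)u^3$ in $(0,\pi)$, $u(0)=u(\pi)$, $u'(0)=u'(\pi)$. Put $\varphi_k(t)=\sqrt{2/\pi}\cos(2kt)$, $\phi_k(t)=\sqrt{2/\pi}\sin(2kt)$. Let $N_k=\operatorname{span}\{\varphi_k,\phi_k\}$ be the nullspace of $u\mapsto u''+\sigma_k u$ on $H^2(\mathbb T)$, $N_k^\perp$ its orthogonal complement and $P_k$ the orthogonal projection onto it in $H^2(\mathbb T)$. Let $Q_kv=(v,\varphi_k)_{L^2}\varphi_k+(v,\phi_k)_{L^2}\phi_k$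 on $L^2(\mathbb T)$, and $L(x_1,x_2)=x_1\varphi_k+x_2\phi_k$. A Lyapunov–Schmidt reduction at $(\sigma_k,0)$ consists of open neighbourhoods $I_k\ni\sigma_k$ in $\mathbb R$, $\mathcal N_k\ni 0$ in $N_k$, $\mathcal O_k\ni(\sigma_k,0)$ in $\mathbb R\times H^2(\mathbb T)$ and a $\mathcal C^\infty$ map $\psi:I_k\times\mathcal N_k\to N_k^\perp$ with $\psi(\sigma_k,0)=0$ such that: for all $(\lambda,x)\in I_k\times\mathcal N_k$, $(I-Q_k)\mathfrak F(\lambda,x+\psi(\lambda,x))=0$ and $(\lambda,x+\psi(\lambda,x))\in\mathcal O_k$; and whenever $x\in N_k$, $y\in N_k^\perp$ and $(\lambda,x+y)\in\mathcal O_k$, then $(\lambda,x)\in I_k\times\mathcal N_k$, and $(I-Q_k)\mathfrak F(\lambda,x+y)=0$ implies $y=\psi(\lambda,x)$. For $(\lambda,x_1,x_2)\in I_k\times L^{-1}(\mathcal N_k)$ put $$\Psi_k(\lambda,x_1,x_2)=(\lambda,\,L(x_1,x_2)+\psi(\lambda,L(x_1,x_2))),$$ $$\mathfrak H(\lambda,x_1,x_2)=\big((Q_k\mathfrak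 F(\Psi_k(\lambda,x_1,x_2)),\varphi_k)_{L^2},\,(Q_k\mathfrak F(\Psi_k(\lambda,x_1,x_2)),\phi_k)_{L^2}\big).$$ Then such a reduction exists, and for every such reduction $\Psi_k:\mathfrak H^{-1}(0)\to\mathfrak F^{-1}(0)\cap\mathcal O_k$ is a homeomorphism with inverse $(\lambda,u)\mapsto(\lambda,L^{-1}P_ku)$. Moreover, exactly four branches of nontrivial solutions with exactly $2k$ zeros in $[0,\pi)$ emanate from $(4k^2,0)$, all for $\lambda<4k^2$, and near $(4k^2,0)$ there are only trivial solutions for $\lambda\ge 4k^2$. Precisely, there are $\varepsilon>0$, $\mathcal C^1$ functions $z_{i,k},w_{i,k}:(4k^2-\varepsilon,4k^2]\to\mathbb R$, $i\in\{1,2,3,4\}$, with $$(z_{1,k},w_{1,k})(4k^2)=\Big(\tfrac{2\sqrt k\,\pi}{\sqrt{3k\pi+8}},\tfrac{2\sqrt k\,\pi}{\sqrt{3k\pi+8}}\Big),\qquad (z_{2,k},w_{2,k})(4k^2)=\Big(\tfrac{-2\sqrt k\,\pi}{\sqrt{3k\pi+8}},\tfrac{-2\sqrt k\,\pi}{\sqrt{3k\pi+8}}\Big),$$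 $$(z_{3,k},w_{3,k})(4k^2)=\Big(\tfrac{2\sqrt k\,\pi}{\sqrt{3k\pi-8}},\tfrac{-2\sqrt k\,\pi}{\sqrt{3k\pi-8}}\Big),\qquad (z_{4,k},w_{4,k})(4k^2)=\Big(\tfrac{-2\sqrt k\,\pi}{\sqrt{3k\pi-8}},\tfrac{2\sqrt k\,\pi}{\sqrt{3k\pi-8}}\Big),$$ and an open neighbourhood $V$ of $(4k^2,0)$ in $\mathbb R\times H^2(\mathbb T)$ such that: 1. for each $i$ and $\lambda\in(4k^2-\varepsilon,4k^2]$ the point $\big(\lambda,\sqrt{4k^2-\lambda}\,z_{i,k}(\lambda),\sqrt{4k^2-\lambda}\,w_{i,k}(\lambda)\big)$ lies in $\mathfrak H^{-1}(0)$, and $$(\lambda,u_{i,k}(\lambda))=\Psi_k\big(\lambda,\sqrt{4k^2-\lambda}\,z_{i,k}(\lambda),\sqrt{4k^2-\lambda}\,w_{i,k}(\lambda)\big)$$ depends continuously on $\lambda\in(4k^2-\varepsilon,4k^2]$ and equals $(4k^2,0)$ at $\lambda=4k^2$; 2. for $\lambda\in(4k^2-\varepsilon,4k^2)$ the four functions $u_{1,k}(\lambda),\dots,u_{4,k}(\lambda)$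 are pairwise distinct, and each is a nontrivial solution with exactly $2k$ zeros in $[0,\pi)$; 3. if $(\lambda,u)\in V$ and $\mathfrak F(\lambda,u)=0$, then $u=0$ if $\lambda\ge 4k^2$; and if $\lambda<4k^2$ and $u\ne0$, then $\lambda>4k^2-\varepsilon$ and $u=u_{i,k}(\lambda)$ for some $i$. -/

import Mathlib

open MeasureTheory Set
open scoped ContDiff

noncomputable section

namespace PeriodicBif

/-- Lebesgue measure on the period interval `[0, π]`. -/
abbrev mu : Measure ℝ := volume.restrict (Icc 0 Real.pi)

/-- The real Hilbert space `L²(𝕋) = L²([0, π])`. -/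
abbrev L2 : Type := Lp ℝ 2 mu

/-- `v` is the weak derivative of `u` on `(0, π)`. -/
def HasWeakDeriv (u v : L2) : Prop :=
  ∀ g : ℝ → ℝ, ContDiff ℝ ∞ g → HasCompactSupport g → tsupport g ⊆ Ioo 0 Real.pi →
    ∫ t, u t * deriv g t ∂mu = - ∫ t, v t * g t ∂mu

/-- `f` is a representative of `u` that is continuous on `[0, π]` (its values on `[0, π]` are then
uniquely determined by `u`). -/
def IsContRep (u : L2) (f : ℝ → ℝ) : Prop :=
  ContinuousOn f (Icc 0 Real.pi) ∧ u =ᵐ[mu] f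

/-- The continuous representative of `u` takes the same value at `0` and at `π`. -/
def PeriodicBC (u : L2) : Prop :=
  ∃ f : ℝ → ℝ, IsContRep u f ∧ f 0 = f Real.pi

theorem integrable_mul_test (u : L2) {g : ℝ → ℝ} (hg : Continuous g) (hc : HasCompactSupport g) :
    Integrable (fun t => u t * g t) mu :=
  MemLp.integrable_mul (p := 2) (q := 2) (Lp.memLp u) (hg.memLp_of_hasCompactSupport hc)

theorem HasWeakDeriv.add {u v u' v' : L2} (h : HasWeakDeriv u v) (h' : HasWeakDeriv u' v') :
    HasWeakDeriv (u + u') (v + v') := by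
  intro g hg hc hs
  have hd : Continuous (deriv g) := hg.continuous_deriv (by simp)
  have e1 : ∫ t, (u + u') t * deriv g t ∂mu = ∫ t, (u t * deriv g t + u' t * deriv g t) ∂mu := by
    refine integral_congr_ae ?_
    filter_upwards [Lp.coeFn_add u u'] with t ht
    rw [ht, Pi.add_apply, add_mul]
  have e2 : ∫ t, (v + v') t * g t ∂mu = ∫ t, (v t * g t + v' t * g t) ∂mu := by
    refine integral_congr_ae ?_
    filter_upwards [Lp.coeFn_add v v'] with t ht
    rw [ht, Pi.add_apply, add_mul]
  rw [e1, e2, integral_add (integrable_mul_test u hd hc.deriv) (integrable_mul_test u' hd hc.deriv),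
    integral_add (integrable_mul_test v hg.continuous hc) (integrable_mul_test v' hg.continuous hc),
    h g hg hc hs, h' g hg hc hs]
  ring

theorem HasWeakDeriv.smul {u v : L2} (c : ℝ) (h : HasWeakDeriv u v) :
    HasWeakDeriv (c • u) (c • v) := by
  intro g hg hc hs
  have e1 : ∫ t, (c • u) t * deriv g t ∂mu = ∫ t, c * (u t * deriv g t) ∂mu := by
    refine integral_congr_ae ?_
    filter_upwards [Lp.coeFn_smul c u] with t ht
    rw [ht, Pi.smul_apply, smul_eq_mul, mul_assoc]
  have e2 : ∫ t, (c • v) t * g t ∂mu = ∫ t, c * (v t * g t) ∂mu := by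
    refine integral_congr_ae ?_
    filter_upwards [Lp.coeFn_smul c v] with t ht
    rw [ht, Pi.smul_apply, smul_eq_mul, mul_assoc]
  rw [e1, e2, integral_const_mul, integral_const_mul, h g hg hc hs]
  ring

theorem PeriodicBC.add {u v : L2} (hu : PeriodicBC u) (hv : PeriodicBC v) :
    PeriodicBC (u + v) := by
  obtain ⟨f, ⟨hf, huf⟩, hf0⟩ := hu
  obtain ⟨g, ⟨hg, hvg⟩, hg0⟩ := hv
  refine ⟨fun t => f t + g t, ⟨hf.add hg, ?_⟩, by simp only [hf0, hg0]⟩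
  filter_upwards [Lp.coeFn_add u v, huf, hvg] with t h1 h2 h3
  rw [h1, Pi.add_apply, h2, h3]

theorem PeriodicBC.smul {u : L2} (c : ℝ) (hu : PeriodicBC u) : PeriodicBC (c • u) := by
  obtain ⟨f, ⟨hf, huf⟩, hf0⟩ := hu
  refine ⟨fun t => c * f t, ⟨continuousOn_const.mul hf, ?_⟩, by simp only [hf0]⟩
  filter_upwards [Lp.coeFn_smul c u, huf] with t h1 h2
  rw [h1, Pi.smul_apply, h2, smul_eq_mul]

/-- `H²(𝕋)`: the functions `u ∈ H²([0, π])` with `u(0) = u(π)` and `u'(0) = u'(π)`. An element is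
stored as the triple `(u, u', u'')` in `L² × L² × L²`, so that the inherited inner product is
`(u, v) = ∫ u v + ∫ u' v' + ∫ u'' v''`. -/
def H2T : Submodule ℝ (PiLp 2 (fun _ : Fin 3 => L2)) where
  carrier := {U | HasWeakDeriv (U 0) (U 1) ∧ HasWeakDeriv (U 1) (U 2) ∧
    PeriodicBC (U 0) ∧ PeriodicBC (U 1)}
  add_mem' := by
    rintro U V ⟨h1, h2, h3, h4⟩ ⟨k1, k2, k3, k4⟩
    exact ⟨h1.add k1, h2.add k2, h3.add k3, h4.add k4⟩
  zero_mem' := by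
    have hw : HasWeakDeriv 0 0 := by
      intro g _ _ _
      have e : ∀ q : ℝ → ℝ, ∫ t, (0 : L2) t * q t ∂mu = 0 := by
        intro q
        rw [← integral_zero ℝ ℝ (μ := mu)]
        refine integral_congr_ae ?_
        filter_upwards [Lp.coeFn_zero ℝ 2 mu] with t ht
        rw [ht, Pi.zero_apply, zero_mul]
      rw [e, e, neg_zero]
    have hp : PeriodicBC 0 :=
      ⟨fun _ => 0, ⟨continuousOn_const, Lp.coeFn_zero ℝ 2 mu⟩, rfl⟩
    exact ⟨hw, hw, hp, hp⟩
  smul_mem' := by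
    rintro c U ⟨h1, h2, h3, h4⟩
    exact ⟨h1.smul c, h2.smul c, h3.smul c, h4.smul c⟩

/-- The Hilbert space `H²(𝕋)`. -/
abbrev H2 : Type := ↥H2T

/-- The derivative `u^(i) ∈ L²(𝕋)` of `u ∈ H²(𝕋)`, for `i = 0, 1, 2`. -/
def D (i : Fin 3) (u : H2) : L2 := (u : PiLp 2 (fun _ : Fin 3 => L2)) i

/-- The weight `a`, the indicator function of `[0, π/4]`. -/
def weight : ℝ → ℝ := indicator (Icc 0 (Real.pi / 4)) (fun _ => 1)

theorem memLp_cubic (u : H2) : MemLp (fun t => weight t * (D 0 u t) ^ 3) 2 mu := by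
  obtain ⟨f, ⟨hf, huf⟩, -⟩ := u.2.2.2.1
  obtain ⟨C, hC⟩ := isCompact_Icc.exists_bound_of_continuousOn hf
  have hw : Measurable weight := measurable_const.indicator measurableSet_Icc
  refine MemLp.of_bound (hw.aestronglyMeasurable.mul ((Lp.aestronglyMeasurable _).pow 3))
    (C ^ 3) ?_
  filter_upwards [huf, ae_restrict_mem measurableSet_Icc] with t h1 h2
  have h1' : D 0 u t = f t := h1
  have hwt : ‖weight t‖ ≤ 1 := by
    unfold weight
    by_cases h : t ∈ Icc 0 (Real.pi / 4) <;> simp [h]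
  rw [h1', norm_mul, norm_pow]
  calc ‖weight t‖ * ‖f t‖ ^ 3 ≤ 1 * C ^ 3 := by gcongr; exact hC t h2
    _ = C ^ 3 := one_mul _

/-- The nonlinear term `a u³ ∈ L²(𝕋)`. -/
def cubic (u : H2) : L2 := (memLp_cubic u).toLp _

/-- The operator `𝔉(λ, u) = u'' + λ u + a u³`. -/
def F (q : ℝ × H2) : L2 := D 2 q.2 + q.1 • D 0 q.2 + cubic q.2

/-- The linearization `𝔏(λ)[v] = v'' + λ v` of `𝔉(λ, ·)` at `0`. -/
def linPart (lam : ℝ) : H2 →ₗ[ℝ] L2 where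
  toFun v := D 2 v + lam • D 0 v
  map_add' v w := by
    change (D 2 v + D 2 w) + lam • (D 0 v + D 0 w) = _
    rw [smul_add]; abel
  map_smul' c v := by
    change c • D 2 v + lam • (c • D 0 v) = c • (D 2 v + lam • D 0 v)
    rw [smul_add, smul_comm lam c]

/-- The eigenvalue `σ_k = (2πk/T)² = 4k²`. -/
def sigma (k : ℕ) : ℝ := 4 * (k : ℝ) ^ 2

/-- The nullspace `N[𝔏(σ_k)]`. -/
def nullS (k : ℕ) : Submodule ℝ H2 := LinearMap.ker (linPart (sigma k))

theorem memLp_cont {f : ℝ → ℝ} (hf : Continuous f) : MemLp f 2 mu := by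
  obtain ⟨C, hC⟩ := isCompact_Icc.exists_bound_of_continuousOn (hf.continuousOn (s := Icc 0 Real.pi))
  refine MemLp.of_bound hf.aestronglyMeasurable C ?_
  filter_upwards [ae_restrict_mem measurableSet_Icc] with t ht using hC t ht

/-- The class in `L²(𝕋)` of a continuous function. -/
def toL2 (f : ℝ → ℝ) (hf : Continuous f) : L2 := (memLp_cont hf).toLp f

theorem hasWeakDeriv_toL2 {f f' : ℝ → ℝ} (hf : Continuous f) (hf' : Continuous f')
    (h : ∀ t, HasDerivAt f (f' t) t) : HasWeakDeriv (toL2 f hf) (toL2 f' hf') := by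
  intro g hg hc hs
  have hd : Continuous (deriv g) := hg.continuous_deriv (by simp)
  have e1 : ∫ t, (toL2 f hf) t * deriv g t ∂mu = ∫ t, f t * deriv g t ∂mu := by
    refine integral_congr_ae ?_
    filter_upwards [(memLp_cont hf).coeFn_toLp] with t ht
    rw [toL2, ht]
  have e2 : ∫ t, (toL2 f' hf') t * g t ∂mu = ∫ t, f' t * g t ∂mu := by
    refine integral_congr_ae ?_
    filter_upwards [(memLp_cont hf').coeFn_toLp] with t ht
    rw [toL2, ht]
  have g0 : g 0 = 0 := image_eq_zero_of_notMem_tsupport (fun h0 => (hs h0).1.false)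
  have g1 : g Real.pi = 0 := image_eq_zero_of_notMem_tsupport (fun h0 => (hs h0).2.false)
  rw [e1, e2, integral_Icc_eq_integral_Ioc, integral_Icc_eq_integral_Ioc,
    ← intervalIntegral.integral_of_le Real.pi_pos.le,
    ← intervalIntegral.integral_of_le Real.pi_pos.le,
    intervalIntegral.integral_mul_deriv_eq_deriv_mul (u := f) (u' := f') (v := g) (v' := deriv g)
      (fun t _ => h t)
      (fun t _ => (hg.differentiable (by simp) t).hasDerivAt)
      (hf'.intervalIntegrable _ _) (hd.intervalIntegrable _ _), g0, g1]
  simp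

theorem periodicBC_toL2 {f : ℝ → ℝ} (hf : Continuous f) (h : f 0 = f Real.pi) :
    PeriodicBC (toL2 f hf) :=
  ⟨f, ⟨hf.continuousOn, (memLp_cont hf).coeFn_toLp⟩, h⟩

/-- The element of `H²(𝕋)` given by a function of class `C²` that satisfies the periodic
boundary conditions. -/
def ofC2 (f f' f'' : ℝ → ℝ) (hf : Continuous f) (hf' : Continuous f') (hf'' : Continuous f'')
    (h : ∀ t, HasDerivAt f (f' t) t) (h' : ∀ t, HasDerivAt f' (f'' t) t)
    (h0 : f 0 = f Real.pi) (h1 : f' 0 = f' Real.pi) : H2 :=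
  ⟨WithLp.toLp 2 ![toL2 f hf, toL2 f' hf', toL2 f'' hf''],
    hasWeakDeriv_toL2 hf hf' h, hasWeakDeriv_toL2 hf' hf'' h',
    periodicBC_toL2 hf h0, periodicBC_toL2 hf' h1⟩

theorem cos_end (k : ℕ) : Real.cos (2 * k * Real.pi) = 1 := by
  rw [show 2 * (k : ℝ) * Real.pi = k * (2 * Real.pi) by ring, Real.cos_nat_mul_two_pi]

theorem sin_end (k : ℕ) : Real.sin (2 * k * Real.pi) = 0 := by
  have := Real.sin_nat_mul_pi (2 * k)
  push_cast at this
  exact this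

theorem hasDerivAt_cosMode (c : ℝ) (k : ℕ) (t : ℝ) :
    HasDerivAt (fun t => c * Real.cos (2 * k * t)) (-(c * (2 * k)) * Real.sin (2 * k * t)) t := by
  refine ((((hasDerivAt_id' t).const_mul (2 * (k : ℝ))).cos).const_mul c).congr_deriv ?_
  ring

theorem hasDerivAt_sinMode (c : ℝ) (k : ℕ) (t : ℝ) :
    HasDerivAt (fun t => c * Real.sin (2 * k * t)) ((c * (2 * k)) * Real.cos (2 * k * t)) t := by
  refine ((((hasDerivAt_id' t).const_mul (2 * (k : ℝ))).sin).const_mul c).congr_deriv ?_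
  ring

/-- The normalizing constant `√(2/T) = √(2/π)`. -/
def nrm : ℝ := Real.sqrt (2 / Real.pi)

/-- `φ_k(t) = √(2/π) cos(2kt)`, as an element of `H²(𝕋)`. -/
def cosMode (k : ℕ) : H2 :=
  ofC2 (fun t => nrm * Real.cos (2 * k * t))
    (fun t => -(nrm * (2 * k)) * Real.sin (2 * k * t))
    (fun t => -(nrm * (2 * k)) * (2 * k) * Real.cos (2 * k * t))
    (by fun_prop) (by fun_prop) (by fun_prop)
    (hasDerivAt_cosMode nrm k) (hasDerivAt_sinMode _ k)
    (by simp [cos_end]) (by simp [sin_end])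

/-- `ϕ_k(t) = √(2/π) sin(2kt)`, as an element of `H²(𝕋)`. -/
def sinMode (k : ℕ) : H2 :=
  ofC2 (fun t => nrm * Real.sin (2 * k * t))
    (fun t => (nrm * (2 * k)) * Real.cos (2 * k * t))
    (fun t => -((nrm * (2 * k)) * (2 * k)) * Real.sin (2 * k * t))
    (by fun_prop) (by fun_prop) (by fun_prop)
    (hasDerivAt_sinMode nrm k) (hasDerivAt_cosMode _ k)
    (by simp [sin_end]) (by simp [cos_end])

theorem toL2_lin {f g : ℝ → ℝ} (hf : Continuous f) (hg : Continuous g) (c : ℝ)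
    (h : ∀ t, f t + c * g t = 0) : toL2 f hf + c • toL2 g hg = 0 := by
  refine Lp.ext ?_
  filter_upwards [Lp.coeFn_add (toL2 f hf) (c • toL2 g hg), Lp.coeFn_smul c (toL2 g hg),
    (memLp_cont hf).coeFn_toLp, (memLp_cont hg).coeFn_toLp, Lp.coeFn_zero ℝ 2 mu]
    with t h1 h2 h3 h4 h5
  have h3' : (toL2 f hf) t = f t := h3
  have h4' : (toL2 g hg) t = g t := h4
  rw [h1, Pi.add_apply, h2, Pi.smul_apply, h3', h4', h5, Pi.zero_apply, smul_eq_mul, h t]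

theorem cosMode_mem (k : ℕ) : cosMode k ∈ nullS k := by
  refine LinearMap.mem_ker.2 (toL2_lin (by fun_prop) (by fun_prop) (sigma k) fun t => ?_)
  simp only [sigma]; ring

theorem sinMode_mem (k : ℕ) : sinMode k ∈ nullS k := by
  refine LinearMap.mem_ker.2 (toL2_lin (by fun_prop) (by fun_prop) (sigma k) fun t => ?_)
  simp only [sigma]; ring

/-- The linear map `L(x₁, x₂) = x₁ φ_k + x₂ ϕ_k` from `ℝ²` to `N[𝔏(σ_k)]`. -/
def Lmap (k : ℕ) (x : ℝ × ℝ) : nullS k :=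
  x.1 • (⟨cosMode k, cosMode_mem k⟩ : nullS k) + x.2 • (⟨sinMode k, sinMode_mem k⟩ : nullS k)

/-- The constant `(1 + 4k² + 16k⁴)^(-1/2)` that normalizes the two modes in `H²(𝕋)`. -/
def nrmH (k : ℕ) : ℝ := (Real.sqrt (1 + 4 * (k : ℝ) ^ 2 + 16 * (k : ℝ) ^ 4))⁻¹

/-- The projection `P_k` of `H²(𝕋)` onto `N[𝔏(σ_k)]`, orthogonal in `H²(𝕋)`. -/
def P (k : ℕ) (u : H2) : H2 :=
  inner ℝ u (nrmH k • cosMode k) • (nrmH k • cosMode k) +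
    inner ℝ u (nrmH k • sinMode k) • (nrmH k • sinMode k)

/-- The projection `Q_k` of `L²(𝕋)` onto the orthogonal complement of the range of `𝔏(σ_k)`. -/
def Q (k : ℕ) (v : L2) : L2 :=
  inner ℝ v (D 0 (cosMode k)) • D 0 (cosMode k) + inner ℝ v (D 0 (sinMode k)) • D 0 (sinMode k)

/-- The auxiliary map `𝒢_k(λ, x, y) = (I - Q_k) 𝔉(λ, x + y)`, for `x ∈ N[𝔏(σ_k)]` and
`y ∈ N[𝔏(σ_k)]^⊥` (orthogonal complement in `H²(𝕋)`). -/
def G (k : ℕ) (lam : ℝ) (x : nullS k) (y : (nullS k)ᗮ) : L2 :=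
  F (lam, (x : H2) + (y : H2)) - Q k (F (lam, (x : H2) + (y : H2)))

/-- The data of the Lyapunov–Schmidt reduction of `𝔉(λ, u) = 0` at `(σ_k, 0)`: open
neighbourhoods `I` of `σ_k`, `N` of `0` in the nullspace and `O` of `(σ_k, 0)`, and the implicit
function `ψ` that solves `𝒢_k = 0` for `y`, uniquely in `O`. -/
structure Reduction (k : ℕ) where
  I : Set ℝ
  N : Set (nullS k)
  O : Set (ℝ × H2)
  psi : ℝ × nullS k → (nullS k)ᗮ
  isOpen_I : IsOpen I
  isOpen_N : IsOpen N
  isOpen_O : IsOpen O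
  sigma_mem : sigma k ∈ I
  zero_mem : (0 : nullS k) ∈ N
  base_mem : (sigma k, (0 : H2)) ∈ O
  smooth : ContDiffOn ℝ ∞ psi (I ×ˢ N)
  psi_base : psi (sigma k, 0) = 0
  solves : ∀ lam ∈ I, ∀ x ∈ N, G k lam x (psi (lam, x)) = 0
  graph_mem : ∀ lam ∈ I, ∀ x ∈ N, (lam, (x : H2) + (psi (lam, x) : H2)) ∈ O
  proj_mem : ∀ (lam : ℝ) (x : nullS k) (y : (nullS k)ᗮ),
    (lam, (x : H2) + (y : H2)) ∈ O → lam ∈ I ∧ x ∈ N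
  unique : ∀ (lam : ℝ) (x : nullS k) (y : (nullS k)ᗮ),
    (lam, (x : H2) + (y : H2)) ∈ O → G k lam x y = 0 → y = psi (lam, x)

/-- `Ψ_k(λ, x₁, x₂) = (λ, L(x₁, x₂) + ψ(λ, L(x₁, x₂)))`. -/
def Reduction.Psi {k : ℕ} (R : Reduction k) (p : ℝ × ℝ × ℝ) : ℝ × H2 :=
  (p.1, (Lmap k p.2 : H2) + (R.psi (p.1, Lmap k p.2) : H2))

/-- The finite-dimensional map `ℌ = (h₁, h₂)`, where `h₁` and `h₂` are the components of
`Q_k 𝔉(Ψ_k(λ, x₁, x₂))` along `φ_k` and `ϕ_k`. -/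
def Reduction.H {k : ℕ} (R : Reduction k) (p : ℝ × ℝ × ℝ) : ℝ × ℝ :=
  (inner ℝ (Q k (F (R.Psi p))) (D 0 (cosMode k)), inner ℝ (Q k (F (R.Psi p))) (D 0 (sinMode k)))

/-- The zero set of `ℌ`, whose domain is `I × L⁻¹(N)`. -/
def Reduction.zeroH {k : ℕ} (R : Reduction k) : Set (ℝ × ℝ × ℝ) :=
  {p | p.1 ∈ R.I ∧ Lmap k p.2 ∈ R.N ∧ R.H p = 0}

/-- The zero set of `𝔉` in `O`. -/
def Reduction.zeroF {k : ℕ} (R : Reduction k) : Set (ℝ × H2) :=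
  {q | q ∈ R.O ∧ F q = 0}

/-- `u` has exactly `n` zeros in `[0, π)` (for its continuous representative). -/
def HasExactlyZeros (u : H2) (n : ℕ) : Prop :=
  ∃ f : ℝ → ℝ, IsContRep (D 0 u) f ∧ {t | t ∈ Ico 0 Real.pi ∧ f t = 0}.encard = n

/-- The point `(λ, √(4k² - λ) z(λ), √(4k² - λ) w(λ))`. -/
def scaled (k : ℕ) (z w : ℝ → ℝ) (lam : ℝ) : ℝ × ℝ × ℝ :=
  (lam, Real.sqrt (sigma k - lam) * z lam, Real.sqrt (sigma k - lam) * w lam)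

end PeriodicBif

end

noncomputable section

namespace PeriodicBif

/-- The primitive of `v` that vanishes at `0`. -/
def prim (v : ℝ → ℝ) (t : ℝ) : ℝ := ∫ s in (0 : ℝ)..t, v s

theorem integral_mu (f : ℝ → ℝ) : ∫ t, f t ∂mu = ∫ t in (0 : ℝ)..Real.pi, f t := by
  rw [integral_Icc_eq_integral_Ioc, ← intervalIntegral.integral_of_le Real.pi_pos.le]

theorem intervalIntegrable_of_mu {v : ℝ → ℝ} (hv : Integrable v mu) :
    IntervalIntegrable v volume 0 Real.pi := by
  rw [intervalIntegrable_iff_integrableOn_Icc_of_le Real.pi_pos.le]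
  exact hv

theorem L2.integrable (u : L2) : Integrable u mu :=
  (Lp.memLp u).integrable (by norm_num)

theorem continuousOn_prim {v : ℝ → ℝ} (hv : Integrable v mu) :
    ContinuousOn (prim v) (Icc 0 Real.pi) := by
  have := intervalIntegral.continuousOn_primitive_interval (a := 0) (b := Real.pi) (μ := volume)
    (f := v) (by rw [uIcc_of_le Real.pi_pos.le]; exact hv)
  rwa [uIcc_of_le Real.pi_pos.le] at this

theorem prim_zero (v : ℝ → ℝ) : prim v 0 = 0 := intervalIntegral.integral_same

theorem prim_pi (v : ℝ → ℝ) : prim v Real.pi = ∫ t, v t ∂mu := (integral_mu v).symm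

/-- Integration by parts for a primitive. -/
theorem integral_prim_mul_deriv {v m m' : ℝ → ℝ} (hv : Integrable v mu)
    (hm : ∀ t, HasDerivAt m (m' t) t) (hm' : Continuous m') :
    ∫ t, prim v t * m' t ∂mu = prim v Real.pi * m Real.pi - ∫ t, v t * m t ∂mu := by
  have hvi := intervalIntegrable_of_mu hv
  have hd : deriv m = m' := funext fun t => (hm t).deriv
  have hmc : ContDiff ℝ 1 m := by
    rw [contDiff_one_iff_deriv, hd]
    exact ⟨fun t => (hm t).differentiableAt, hm'⟩
  have h1 : AbsolutelyContinuousOnInterval (prim v) 0 Real.pi :=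
    hvi.absolutelyContinuousOnInterval_intervalIntegral (by simp)
  have h2 : AbsolutelyContinuousOnInterval m 0 Real.pi :=
    hmc.contDiffOn.absolutelyContinuousOnInterval
  have h3 := h1.integral_mul_deriv_eq_deriv_mul h2
  rw [hd, prim_zero, zero_mul, sub_zero] at h3
  rw [integral_mu, integral_mu, h3]
  congr 1
  refine intervalIntegral.integral_congr_ae ?_
  filter_upwards [hvi.ae_hasDerivAt_integral] with t ht ht'
  have := ht (uIoc_subset_uIcc ht') 0 (by simp)
  rw [show deriv (prim v) t = v t from this.deriv]

/-- `v` is the weak derivative of `u`, for functions. -/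
def WeakDeriv (u v : ℝ → ℝ) : Prop :=
  ∀ g : ℝ → ℝ, ContDiff ℝ ∞ g → HasCompactSupport g → tsupport g ⊆ Ioo 0 Real.pi →
    ∫ t, u t * deriv g t ∂mu = - ∫ t, v t * g t ∂mu

theorem WeakDeriv.congr {u v u' v' : ℝ → ℝ} (h : WeakDeriv u v) (hu : u =ᵐ[mu] u')
    (hv : v =ᵐ[mu] v') : WeakDeriv u' v' := by
  intro g hg hc hs
  have e1 : ∫ t, u t * deriv g t ∂mu = ∫ t, u' t * deriv g t ∂mu := by
    refine integral_congr_ae ?_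
    filter_upwards [hu] with t ht; rw [ht]
  have e2 : ∫ t, v t * g t ∂mu = ∫ t, v' t * g t ∂mu := by
    refine integral_congr_ae ?_
    filter_upwards [hv] with t ht; rw [ht]
  rw [← e1, ← e2]
  exact h g hg hc hs

theorem bounds_zero {g : ℝ → ℝ} (hs : tsupport g ⊆ Ioo 0 Real.pi) : g 0 = 0 ∧ g Real.pi = 0 :=
  ⟨image_eq_zero_of_notMem_tsupport (fun h0 => (hs h0).1.false),
    image_eq_zero_of_notMem_tsupport (fun h0 => (hs h0).2.false)⟩

theorem integrable_mul_cont {v m : ℝ → ℝ} (hv : Integrable v mu) (hm : Continuous m) :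
    Integrable (fun t => v t * m t) mu := by
  obtain ⟨C, hC⟩ := isCompact_Icc.exists_bound_of_continuousOn (hm.continuousOn (s := Icc 0 Real.pi))
  refine hv.mul_bdd (c := C) hm.aestronglyMeasurable ?_
  filter_upwards [ae_restrict_mem measurableSet_Icc] with t ht using hC t ht

theorem weakDeriv_prim {v : ℝ → ℝ} (hv : Integrable v mu) (c : ℝ) :
    WeakDeriv (fun t => c + prim v t) v := by
  intro g hg hc hs
  have hd : Continuous (deriv g) := hg.continuous_deriv (by simp)
  have hgd : ∀ t, HasDerivAt g (deriv g t) t :=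
    fun t => (hg.differentiable (by simp) t).hasDerivAt
  have e1 := integral_prim_mul_deriv hv hgd hd
  have e2 : ∫ t, c * deriv g t ∂mu = 0 := by
    rw [integral_const_mul, integral_mu,
      intervalIntegral.integral_eq_sub_of_hasDerivAt (fun t _ => hgd t) (hd.intervalIntegrable _ _),
      (bounds_zero hs).1, (bounds_zero hs).2]
    simp
  have i1 : Integrable (fun t => c * deriv g t) mu :=
    integrable_mul_cont (integrable_const c) hd
  have i2 : Integrable (fun t => prim v t * deriv g t) mu :=
    integrable_mul_cont (continuousOn_prim hv).integrableOn_Icc hd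
  simp only [add_mul]
  rw [integral_add i1 i2, e1, e2, (bounds_zero hs).2]
  ring

theorem WeakDeriv.smooth_mul {u v m : ℝ → ℝ} (hu : Integrable u mu) (hv : Integrable v mu)
    (h : WeakDeriv u v) (hm : ContDiff ℝ ∞ m) :
    WeakDeriv (fun t => u t * m t) (fun t => v t * m t + u t * deriv m t) := by
  intro g hg hc hs
  have hd : Continuous (deriv g) := hg.continuous_deriv (by simp)
  have hmd : Continuous (deriv m) := hm.continuous_deriv (by simp)
  have key := h (fun t => m t * g t) (hm.mul hg) (hc.mul_left)
    ((tsupport_mul_subset_right).trans hs)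
  have e : ∀ t, deriv (fun t => m t * g t) t = deriv m t * g t + m t * deriv g t := fun t =>
    deriv_fun_mul (hm.differentiable (by simp) t) (hg.differentiable (by simp) t)
  have hA : Integrable (fun t => u t * (deriv m t * g t)) mu :=
    integrable_mul_cont hu (hmd.mul hg.continuous)
  have hB : Integrable (fun t => u t * (m t * deriv g t)) mu :=
    integrable_mul_cont hu (hm.continuous.mul hd)
  have hC : Integrable (fun t => v t * (m t * g t)) mu :=
    integrable_mul_cont hv (hm.continuous.mul hg.continuous)
  simp only [e, mul_add] at key
  rw [integral_add hA hB] at key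
  have e2 : ∫ t, (v t * m t + u t * deriv m t) * g t ∂mu
      = ∫ t, v t * (m t * g t) ∂mu + ∫ t, u t * (deriv m t * g t) ∂mu := by
    rw [← integral_add hC hA]; congr 1; ext t; ring
  rw [e2]
  simp only [mul_assoc]
  linarith

theorem WeakDeriv.add {u v u' v' : ℝ → ℝ} (hu : Integrable u mu) (hv : Integrable v mu)
    (hu' : Integrable u' mu) (hv' : Integrable v' mu) (h : WeakDeriv u v) (h' : WeakDeriv u' v') :
    WeakDeriv (fun t => u t + u' t) (fun t => v t + v' t) := by
  intro g hg hc hs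
  have hd : Continuous (deriv g) := hg.continuous_deriv (by simp)
  simp only [add_mul]
  rw [integral_add (integrable_mul_cont hu hd) (integrable_mul_cont hu' hd),
    integral_add (integrable_mul_cont hv hg.continuous) (integrable_mul_cont hv' hg.continuous),
    h g hg hc hs, h' g hg hc hs]
  ring

theorem ae_zero_of_forall_test {w : ℝ → ℝ} (hw : Integrable w mu)
    (h : ∀ g : ℝ → ℝ, ContDiff ℝ ∞ g → HasCompactSupport g → tsupport g ⊆ Ioo 0 Real.pi →
      ∫ t, w t * g t ∂mu = 0) : w =ᵐ[mu] 0 := by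
  have hli : LocallyIntegrableOn w (Ioo 0 Real.pi) volume :=
    (IntegrableOn.mono_set (t := Icc 0 Real.pi) hw Ioo_subset_Icc_self).locallyIntegrableOn
  have := isOpen_Ioo.ae_eq_zero_of_integral_contDiff_smul_eq_zero hli (fun g hg hc hs => by
    have e := h g hg hc hs
    rw [← e, ← integral_indicator measurableSet_Icc]
    congr 1; ext t
    by_cases ht : t ∈ Icc 0 Real.pi
    · simp [ht, mul_comm]
    · have : g t = 0 := image_eq_zero_of_notMem_tsupport
        (fun h0 => ht (Ioo_subset_Icc_self (hs h0)))
      simp [this, indicator_of_notMem ht])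
  have h2 : ∀ᵐ t ∂(volume.restrict (Ioo 0 Real.pi)), w t = 0 :=
    (ae_restrict_iff' measurableSet_Ioo).2 this
  have h3 : mu = volume.restrict (Ioo 0 Real.pi) := 
    Measure.restrict_congr_set Ioo_ae_eq_Icc.symm
  rw [h3]; exact h2

/-- The lemma of du Bois-Reymond. -/
theorem WeakDeriv.ae_eq_const {w : ℝ → ℝ} (hw : Integrable w mu) (h : WeakDeriv w 0) :
    ∃ c, w =ᵐ[mu] fun _ => c := by
  let b : ContDiffBump (Real.pi / 2) := ⟨Real.pi / 8, Real.pi / 4, by positivity, by linarith [Real.pi_pos]⟩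
  have hbs : tsupport b ⊆ Ioo 0 Real.pi := by
    rw [b.tsupport_eq, Real.closedBall_eq_Icc]
    have := Real.pi_pos
    exact Icc_subset_Ioo (by change 0 < Real.pi / 2 - Real.pi / 4; linarith)
      (by change Real.pi / 2 + Real.pi / 4 < _; linarith)
  have hbc : ContDiff ℝ ∞ b := b.contDiff
  have hbp : 0 < ∫ t, b t := b.integral_pos
  have toMu : ∀ g : ℝ → ℝ, tsupport g ⊆ Ioo 0 Real.pi → ∫ t, g t ∂mu = ∫ t, g t := by
    intro g hg
    refine setIntegral_eq_integral_of_forall_compl_eq_zero fun t ht => ?_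
    exact image_eq_zero_of_notMem_tsupport (fun h0 => ht (Ioo_subset_Icc_self (hg h0)))
  set B : ℝ := ∫ t, b t with hB
  refine ⟨(∫ t, w t * b t ∂mu) / B, ?_⟩
  set c := (∫ t, w t * b t ∂mu) / B with hc
  have hz : (fun t => w t - c) =ᵐ[mu] 0 := by
    refine ae_zero_of_forall_test (hw.sub (integrable_const c)) fun g hg hgc hgs => ?_
    set q : ℝ := (∫ t, g t) / B with hq
    let m : ℝ → ℝ := fun t => g t - q * b t
    have hm : ContDiff ℝ ∞ m := hg.sub (contDiff_const.mul hbc)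
    have hms : tsupport m ⊆ Ioo 0 Real.pi := by
      refine (tsupport_sub g _).trans (union_subset hgs ?_)
      exact (tsupport_mul_subset_right (f := fun _ => q)).trans hbs
    have hmi : ∫ t, m t = 0 := by
      have i1 : Integrable g := hg.continuous.integrable_of_hasCompactSupport hgc
      have i2 : Integrable (fun t => q * b t) := b.integrable.const_mul q
      change ∫ t, (g t - q * b t) = 0
      rw [integral_sub i1 i2, integral_const_mul, ← hB, hq]
      field_simp
      ring
    have hmt : ∀ t, t ∉ Ioo 0 Real.pi → m t = 0 := fun t ht =>
      image_eq_zero_of_notMem_tsupport (fun h0 => ht (hms h0))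
    have hpd : ∀ t, HasDerivAt (prim m) (m t) t := fun t =>
      intervalIntegral.integral_hasDerivAt_right (hm.continuous.intervalIntegrable _ _)
        (hm.continuous.stronglyMeasurableAtFilter _ _) hm.continuous.continuousAt
    have hdp : deriv (prim m) = m := funext fun t => (hpd t).deriv
    have hps : ContDiff ℝ ∞ (prim m) := by
      rw [contDiff_infty_iff_deriv, hdp]
      exact ⟨fun t => (hpd t).differentiableAt, hm⟩
    have hmcomp : IsCompact (tsupport m) :=
      isCompact_Icc.of_isClosed_subset (isClosed_tsupport m) (hms.trans Ioo_subset_Icc_self)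
    obtain ⟨α, β, hαβ, hsub, hα, hβ⟩ : ∃ α β : ℝ, α ≤ β ∧ tsupport m ⊆ Icc α β ∧ 0 < α ∧ β < Real.pi := by
      by_cases hne : (tsupport m).Nonempty
      · obtain ⟨α, hα, hα'⟩ := hmcomp.exists_isLeast hne
        obtain ⟨β, hβ, hβ'⟩ := hmcomp.exists_isGreatest hne
        exact ⟨α, β, hα' hβ, fun t ht => ⟨hα' ht, hβ' ht⟩, (hms hα).1, (hms hβ).2⟩
      · rw [not_nonempty_iff_eq_empty] at hne
        exact ⟨Real.pi / 2, Real.pi / 2, le_rfl, by simp [hne], by positivity,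
          by linarith [Real.pi_pos]⟩
    have hm0 : ∀ t, t ∉ Icc α β → m t = 0 := fun t ht =>
      image_eq_zero_of_notMem_tsupport (fun h0 => ht (hsub h0))
    have hptot : ∀ t, β < t → prim m t = 0 := by
      intro t ht
      rw [← hmi, prim, intervalIntegral.integral_of_le (by linarith)]
      refine setIntegral_eq_integral_of_forall_compl_eq_zero fun s hs => hm0 s fun hs' => hs ?_
      exact ⟨by linarith [hs'.1], by linarith [hs'.2]⟩
    have hpl : ∀ t, t < α → prim m t = 0 := by
      intro t ht
      have : ∫ s in (0:ℝ)..t, m s = ∫ s in (0:ℝ)..t, (0 : ℝ) := by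
        refine intervalIntegral.integral_congr fun s hs => hm0 s fun hs' => ?_
        have := hs.2
        have h3 := hs'.1
        rcases le_total 0 t with h | h
        · rw [sup_eq_right.2 h] at this; linarith
        · rw [sup_eq_left.2 h] at this; linarith
      rw [prim, this, intervalIntegral.integral_zero]
    have hpsub : tsupport (prim m) ⊆ Icc α β := by
      refine closure_minimal (fun t ht => ?_) isClosed_Icc
      by_contra hcon
      rw [mem_Icc, not_and_or, not_le, not_le] at hcon
      rcases hcon with h | h
      · exact ht (hpl t h)
      · exact ht (hptot t h)
    have key := h (prim m) hps (isCompact_Icc.of_isClosed_subset (isClosed_tsupport _) hpsub)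
      (hpsub.trans (Icc_subset_Ioo hα hβ))
    rw [hdp] at key
    simp only [Pi.zero_apply, zero_mul, integral_zero, neg_zero] at key
    have ig := integrable_mul_cont hw hg.continuous
    have ib : Integrable (fun t => w t * (q * b t)) mu :=
      integrable_mul_cont hw (continuous_const.mul hbc.continuous)
    have key2 : ∫ t, w t * g t ∂mu = q * ∫ t, w t * b t ∂mu := by
      have : ∫ t, (w t * g t - w t * (q * b t)) ∂mu = 0 := by
        rw [← key]; congr 1; ext t; simp only [m]; ring
      rw [integral_sub ig ib] at this
      rw [← integral_const_mul]
      rw [sub_eq_zero.1 this]; congr 1; ext t; ring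
    have ic : Integrable (fun t => c * g t) mu := integrable_mul_cont (integrable_const c) hg.continuous
    simp only [sub_mul]
    rw [integral_sub ig ic, integral_const_mul, toMu g hgs, key2, hq, hc]
    field_simp
    ring
  filter_upwards [hz] with t ht
  have : w t - c = 0 := ht
  linarith

theorem WeakDeriv.exists_prim {u v : ℝ → ℝ} (hu : Integrable u mu) (hv : Integrable v mu)
    (h : WeakDeriv u v) : ∃ c, u =ᵐ[mu] fun t => c + prim v t := by
  have hp : Integrable (prim v) mu := (continuousOn_prim hv).integrableOn_Icc
  have h1 : WeakDeriv (fun t => u t + (-1 * prim v t)) 0 := by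
    intro g hg hc hs
    have hd : Continuous (deriv g) := hg.continuous_deriv (by simp)
    have e := weakDeriv_prim hv 0 g hg hc hs
    simp only [zero_add] at e
    have i1 := integrable_mul_cont hu hd
    have i2 := integrable_mul_cont hp hd
    have : ∫ t, (u t + (-1 * prim v t)) * deriv g t ∂mu
        = ∫ t, u t * deriv g t ∂mu - ∫ t, prim v t * deriv g t ∂mu := by
      rw [← integral_sub i1 i2]; congr 1; ext t; ring
    rw [this, e, h g hg hc hs]
    simp
  obtain ⟨c, hc⟩ := h1.ae_eq_const (hu.add (hp.const_mul (-1)))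
  refine ⟨c, ?_⟩
  filter_upwards [hc] with t ht
  have : u t + (-1 * prim v t) = c := ht
  linarith

theorem IsContRep.eqOn {u : L2} {f g : ℝ → ℝ} (hf : IsContRep u f) (hg : IsContRep u g) :
    EqOn f g (Icc 0 Real.pi) :=
  Measure.eqOn_Icc_of_ae_eq volume Real.pi_pos.ne (hf.2.symm.trans hg.2) hf.1 hg.1

theorem HasWeakDeriv.exists_rep {u v : L2} (h : HasWeakDeriv u v) :
    ∃ c, IsContRep u (fun t => c + prim v t) := by
  obtain ⟨c, hc⟩ := WeakDeriv.exists_prim u.integrable v.integrable h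
  exact ⟨c, continuousOn_const.add (continuousOn_prim v.integrable), hc⟩

theorem HasWeakDeriv.periodic_iff {u v : L2} (h : HasWeakDeriv u v) :
    PeriodicBC u ↔ ∫ t, v t ∂mu = 0 := by
  obtain ⟨c, hc⟩ := h.exists_rep
  constructor
  · rintro ⟨f, hf, h0⟩
    rw [hf.eqOn hc (left_mem_Icc.2 Real.pi_pos.le), hf.eqOn hc (right_mem_Icc.2 Real.pi_pos.le)]
      at h0
    simp only [prim_zero, prim_pi] at h0
    linarith
  · intro h0
    exact ⟨_, hc, by simp only [prim_zero, prim_pi, h0]⟩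

/-- Integration by parts for a periodic function with weak derivative in `L²`. -/
theorem HasWeakDeriv.integral_by_parts {u v : L2} (h : HasWeakDeriv u v) (hp : PeriodicBC u)
    {m m' : ℝ → ℝ} (hm : ∀ t, HasDerivAt m (m' t) t) (hm' : Continuous m')
    (h0 : m 0 = m Real.pi) : ∫ t, u t * m' t ∂mu = - ∫ t, v t * m t ∂mu := by
  have hv0 := h.periodic_iff.1 hp
  obtain ⟨c, hc⟩ := h.exists_rep
  have hpi : Integrable (prim v) mu := (continuousOn_prim v.integrable).integrableOn_Icc
  have e1 : ∫ t, u t * m' t ∂mu = ∫ t, (c * m' t + prim v t * m' t) ∂mu := by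
    refine integral_congr_ae ?_
    filter_upwards [hc.2] with t ht
    rw [ht, add_mul]
  rw [e1, integral_add (integrable_mul_cont (integrable_const c) hm') (integrable_mul_cont hpi hm'),
    integral_prim_mul_deriv v.integrable hm hm', integral_const_mul, integral_mu m',
    intervalIntegral.integral_eq_sub_of_hasDerivAt (fun t _ => hm t) (hm'.intervalIntegrable _ _),
    prim_pi, hv0, h0]
  ring

theorem HasWeakDeriv.unique {u v v' : L2} (h : HasWeakDeriv u v) (h' : HasWeakDeriv u v') :
    v = v' := by
  refine Lp.ext ?_
  have := ae_zero_of_forall_test (w := fun t => v t - v' t) (v.integrable.sub v'.integrable)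
    (fun g hg hc hs => by
      have e := (h g hg hc hs).symm.trans (h' g hg hc hs)
      simp only [sub_mul]
      rw [integral_sub (integrable_mul_cont v.integrable hg.continuous)
        (integrable_mul_cont v'.integrable hg.continuous)]
      linarith)
  filter_upwards [this] with t ht
  have : v t - v' t = 0 := ht
  linarith

theorem toL2_coe {f : ℝ → ℝ} (hf : Continuous f) : toL2 f hf =ᵐ[mu] f :=
  (memLp_cont hf).coeFn_toLp

theorem inner_toL2 (u : L2) {g : ℝ → ℝ} (hg : Continuous g) :
    inner ℝ u (toL2 g hg) = ∫ t, u t * g t ∂mu := by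
  rw [L2.inner_def]
  refine integral_congr_ae ?_
  filter_upwards [toL2_coe hg] with t ht
  rw [ht]; simp [mul_comm]

theorem inner_toL2_toL2 {f g : ℝ → ℝ} (hf : Continuous f) (hg : Continuous g) :
    inner ℝ (toL2 f hf) (toL2 g hg) = ∫ t, f t * g t ∂mu := by
  rw [inner_toL2]
  refine integral_congr_ae ?_
  filter_upwards [toL2_coe hf] with t ht
  rw [ht]

theorem integral_eq_inner_one (u : L2) :
    ∫ t, u t ∂mu = inner ℝ u (toL2 (fun _ => 1) continuous_const) := by
  rw [inner_toL2]; simp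

theorem mem_H2T_iff (U : PiLp 2 (fun _ : Fin 3 => L2)) : U ∈ H2T ↔
    (HasWeakDeriv (U 0) (U 1) ∧ HasWeakDeriv (U 1) (U 2)) ∧
      ∫ t, U 1 t ∂mu = 0 ∧ ∫ t, U 2 t ∂mu = 0 := by
  constructor
  · rintro ⟨h1, h2, h3, h4⟩
    exact ⟨⟨h1, h2⟩, h1.periodic_iff.1 h3, h2.periodic_iff.1 h4⟩
  · rintro ⟨⟨h1, h2⟩, h3, h4⟩
    exact ⟨h1, h2, h1.periodic_iff.2 h3, h2.periodic_iff.2 h4⟩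

theorem isClosed_hasWeakDeriv {X : Type*} [TopologicalSpace X] {a b : X → L2} (ha : Continuous a)
    (hb : Continuous b) : IsClosed {x | HasWeakDeriv (a x) (b x)} := by
  simp only [HasWeakDeriv, ofPred_forall]
  refine isClosed_iInter fun g => isClosed_iInter fun hg => isClosed_iInter fun hc =>
    isClosed_iInter fun hs => ?_
  have hd : Continuous (deriv g) := hg.continuous_deriv (by simp)
  simp only [← inner_toL2 _ hd, ← inner_toL2 _ hg.continuous]
  exact isClosed_eq (ha.inner continuous_const) (hb.inner continuous_const).neg

theorem isClosed_H2T : IsClosed (H2T : Set (PiLp 2 (fun _ : Fin 3 => L2))) := by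
  have c : ∀ i : Fin 3, Continuous fun U : PiLp 2 (fun _ : Fin 3 => L2) => U i :=
    fun i => (PiLp.proj 2 (fun _ : Fin 3 => L2) i (𝕜 := ℝ)).continuous
  have : (H2T : Set (PiLp 2 (fun _ : Fin 3 => L2))) =
      ({U | HasWeakDeriv (U 0) (U 1)} ∩ {U | HasWeakDeriv (U 1) (U 2)}) ∩
        ({U | ∫ t, U 1 t ∂mu = 0} ∩ {U | ∫ t, U 2 t ∂mu = 0}) := by
    ext U; exact mem_H2T_iff U
  rw [this]
  simp only [integral_eq_inner_one]
  exact ((isClosed_hasWeakDeriv (c 0) (c 1)).inter (isClosed_hasWeakDeriv (c 1) (c 2))).inter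
    ((isClosed_eq ((c 1).inner continuous_const) continuous_const).inter
      (isClosed_eq ((c 2).inner continuous_const) continuous_const))

instance instCompleteSpaceH2 : CompleteSpace H2 := isClosed_H2T.completeSpace_coe

/-- The derivative `u^(i)` as a continuous linear map of `u`. -/
def DL (i : Fin 3) : H2 →L[ℝ] L2 :=
  (PiLp.proj 2 (fun _ : Fin 3 => L2) i (𝕜 := ℝ)).comp H2T.subtypeL

theorem DL_apply (i : Fin 3) (u : H2) : DL i u = D i u := rfl

theorem D_add (i : Fin 3) (u v : H2) : D i (u + v) = D i u + D i v := rfl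
theorem D_sub (i : Fin 3) (u v : H2) : D i (u - v) = D i u - D i v := rfl
theorem D_smul (i : Fin 3) (c : ℝ) (u : H2) : D i (c • u) = c • D i u := rfl

theorem norm_D_le (i : Fin 3) (u : H2) : ‖D i u‖ ≤ ‖u‖ := PiLp.norm_apply_le _ i

theorem D_weak0 (u : H2) : HasWeakDeriv (D 0 u) (D 1 u) := u.2.1
theorem D_weak1 (u : H2) : HasWeakDeriv (D 1 u) (D 2 u) := u.2.2.1
theorem D_per0 (u : H2) : PeriodicBC (D 0 u) := u.2.2.2.1
theorem D_per1 (u : H2) : PeriodicBC (D 1 u) := u.2.2.2.2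

theorem H2_ext {u v : H2} (h : D 0 u = D 0 v) : u = v := by
  have h1 : D 1 u = D 1 v := (h ▸ D_weak0 u).unique (D_weak0 v)
  have h2 : D 2 u = D 2 v := (h1 ▸ D_weak1 u).unique (D_weak1 v)
  refine Subtype.ext (PiLp.ext fun i => ?_)
  fin_cases i
  exacts [h, h1, h2]

theorem inner_H2 (u v : H2) : inner ℝ u v =
    inner ℝ (D 0 u) (D 0 v) + inner ℝ (D 1 u) (D 1 v) + inner ℝ (D 2 u) (D 2 v) := by
  rw [Submodule.coe_inner, PiLp.inner_apply, Fin.sum_univ_three]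
  rfl

/-- A bound for the `L¹` norm by the `L²` norm. -/
theorem integral_abs_le (v : L2) :
    ∫ t, |v t| ∂mu ≤ ‖toL2 (fun _ => 1) continuous_const‖ * ‖v‖ := by
  have h1 : ∫ t, |v t| ∂mu = inner ℝ (|v|) (toL2 (fun _ => 1) continuous_const) := by
    rw [inner_toL2]
    refine integral_congr_ae ?_
    filter_upwards [Lp.coeFn_abs v] with t ht
    rw [ht, mul_one]
  rw [h1, mul_comm, ← norm_abs_eq_norm v]
  exact real_inner_le_norm _ _

theorem abs_prim_le (v : L2) {t : ℝ} (ht : t ∈ Icc 0 Real.pi) :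
    |prim v t| ≤ ∫ t, |v t| ∂mu := by
  have h := v.integrable
  rw [integral_mu, prim]
  refine (intervalIntegral.abs_integral_le_integral_abs ht.1).trans ?_
  refine intervalIntegral.integral_mono_interval le_rfl ht.1 ht.2
    (Filter.Eventually.of_forall fun _ => abs_nonneg _) (intervalIntegrable_of_mu h.abs)

/-- The Sobolev embedding `H¹ ⊆ C⁰` on `[0, π]`. -/
theorem exists_sup_bound : ∃ K : ℝ, 0 < K ∧ ∀ u v : L2, HasWeakDeriv u v → ∀ f, IsContRep u f →
    ∀ t ∈ Icc 0 Real.pi, |f t| ≤ K * (‖u‖ + ‖v‖) := by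
  set M := ‖toL2 (fun _ => 1) continuous_const‖ with hM
  have hpi := Real.pi_pos
  refine ⟨(Real.pi⁻¹ + 2) * M + 1, by positivity, fun u v h f hf t ht => ?_⟩
  obtain ⟨c, hc⟩ := h.exists_rep
  have hv := integral_abs_le v
  have hu := integral_abs_le u
  rw [← hM] at hv hu
  rw [hf.eqOn hc ht]
  have hp : ∀ s ∈ Icc 0 Real.pi, |prim v s| ≤ M * ‖v‖ := fun s hs => (abs_prim_le v hs).trans hv
  have hc1 : Real.pi * |c| ≤ M * ‖u‖ + Real.pi * (M * ‖v‖) := by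
    have hmu : mu.real univ = Real.pi := by
      simp [mu, Measure.real, Real.pi_pos.le]
    have e1 : Real.pi * |c| = ∫ _, |c| ∂mu := by rw [integral_const, hmu, smul_eq_mul]
    have e2 : Real.pi * (M * ‖v‖) = ∫ _, M * ‖v‖ ∂mu := by
      rw [integral_const, hmu, smul_eq_mul]
    rw [e1, e2]
    refine le_trans ?_ (add_le_add_left hu _)
    rw [← integral_add u.integrable.abs (integrable_const _)]
    refine integral_mono_ae (integrable_const _) (u.integrable.abs.add (integrable_const _)) ?_
    filter_upwards [hc.2, ae_restrict_mem measurableSet_Icc] with s hs hs'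
    have h3 := hp s hs'
    have h4 : c = u s - prim v s := by rw [hs]; ring
    calc |c| = |u s - prim v s| := by rw [← h4]
      _ ≤ |u s| + |prim v s| := abs_sub _ _
      _ ≤ _ := by linarith
  have hc2 : |c| ≤ Real.pi⁻¹ * M * ‖u‖ + M * ‖v‖ := by
    have : |c| = Real.pi⁻¹ * (Real.pi * |c|) := by field_simp
    rw [this]
    calc _ ≤ Real.pi⁻¹ * (M * ‖u‖ + Real.pi * (M * ‖v‖)) := by gcongr
      _ = _ := by field_simp
  have h5 := hp t ht
  have hM0 : 0 ≤ M := norm_nonneg _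
  have := norm_nonneg u
  have := norm_nonneg v
  calc |c + prim v t| ≤ |c| + |prim v t| := abs_add_le _ _
    _ ≤ (Real.pi⁻¹ * M * ‖u‖ + M * ‖v‖) + M * ‖v‖ := add_le_add hc2 h5
    _ ≤ ((Real.pi⁻¹ + 2) * M + 1) * (‖u‖ + ‖v‖) := by
      have a1 : 0 ≤ Real.pi⁻¹ * M * ‖v‖ := by positivity
      have a2 : 0 ≤ M * ‖u‖ := by positivity
      nlinarith

theorem inner_weakDeriv {u v : L2} (h : HasWeakDeriv u v) (hp : PeriodicBC u)
    {m m' : ℝ → ℝ} (hmc : Continuous m) (hm' : Continuous m') (hm : ∀ t, HasDerivAt m (m' t) t)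
    (h0 : m 0 = m Real.pi) :
    inner ℝ v (toL2 m hmc) = - inner ℝ u (toL2 m' hm') := by
  rw [inner_toL2, inner_toL2, h.integral_by_parts hp hm hm' h0, neg_neg]

section Modes

variable {k : ℕ}

theorem D2_cosMode (k : ℕ) : D 2 (cosMode k) = -sigma k • D 0 (cosMode k) := by
  have : D 2 (cosMode k) + sigma k • D 0 (cosMode k) = 0 := cosMode_mem k
  rw [neg_smul]; exact eq_neg_of_add_eq_zero_left this

theorem D2_sinMode (k : ℕ) : D 2 (sinMode k) = -sigma k • D 0 (sinMode k) := by
  have : D 2 (sinMode k) + sigma k • D 0 (sinMode k) = 0 := sinMode_mem k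
  rw [neg_smul]; exact eq_neg_of_add_eq_zero_left this

theorem inner_D1_cosMode (u : H2) :
    inner ℝ (D 1 u) (D 1 (cosMode k)) = sigma k * inner ℝ (D 0 u) (D 0 (cosMode k)) := by
  have h := inner_weakDeriv (D_weak0 u) (D_per0 u)
    (m := fun t => -(nrm * (2 * k)) * Real.sin (2 * k * t))
    (m' := fun t => -(nrm * (2 * k)) * (2 * k) * Real.cos (2 * k * t))
    (by fun_prop) (by fun_prop) (hasDerivAt_sinMode _ k) (by simp [sin_end])
  have h2 : inner ℝ (D 0 u) (D 2 (cosMode k)) = -sigma k * inner ℝ (D 0 u) (D 0 (cosMode k)) := by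
    rw [D2_cosMode, inner_smul_right]
  have h1 : inner ℝ (D 1 u) (D 1 (cosMode k)) = -inner ℝ (D 0 u) (D 2 (cosMode k)) := h
  rw [h1, h2]; ring

theorem inner_D1_sinMode (u : H2) :
    inner ℝ (D 1 u) (D 1 (sinMode k)) = sigma k * inner ℝ (D 0 u) (D 0 (sinMode k)) := by
  have h := inner_weakDeriv (D_weak0 u) (D_per0 u)
    (m := fun t => (nrm * (2 * k)) * Real.cos (2 * k * t))
    (m' := fun t => -((nrm * (2 * k)) * (2 * k)) * Real.sin (2 * k * t))
    (by fun_prop) (by fun_prop) (hasDerivAt_cosMode _ k) (by simp [cos_end])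
  have h2 : inner ℝ (D 0 u) (D 2 (sinMode k)) = -sigma k * inner ℝ (D 0 u) (D 0 (sinMode k)) := by
    rw [D2_sinMode, inner_smul_right]
  have h1 : inner ℝ (D 1 u) (D 1 (sinMode k)) = -inner ℝ (D 0 u) (D 2 (sinMode k)) := h
  rw [h1, h2]; ring

theorem inner_D2_cosMode (u : H2) :
    inner ℝ (D 2 u) (D 0 (cosMode k)) = -sigma k * inner ℝ (D 0 u) (D 0 (cosMode k)) := by
  have h : inner ℝ (D 2 u) (D 0 (cosMode k)) = -inner ℝ (D 1 u) (D 1 (cosMode k)) :=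
    inner_weakDeriv (D_weak1 u) (D_per1 u) (m := fun t => nrm * Real.cos (2 * k * t))
      (m' := fun t => -(nrm * (2 * k)) * Real.sin (2 * k * t))
      (by fun_prop) (by fun_prop) (hasDerivAt_cosMode _ k) (by simp [cos_end])
  rw [h, inner_D1_cosMode]; ring

theorem inner_D2_sinMode (u : H2) :
    inner ℝ (D 2 u) (D 0 (sinMode k)) = -sigma k * inner ℝ (D 0 u) (D 0 (sinMode k)) := by
  have h : inner ℝ (D 2 u) (D 0 (sinMode k)) = -inner ℝ (D 1 u) (D 1 (sinMode k)) :=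
    inner_weakDeriv (D_weak1 u) (D_per1 u) (m := fun t => nrm * Real.sin (2 * k * t))
      (m' := fun t => (nrm * (2 * k)) * Real.cos (2 * k * t))
      (by fun_prop) (by fun_prop) (hasDerivAt_sinMode _ k) (by simp [sin_end])
  rw [h, inner_D1_sinMode]; ring

/-- The square of the `H²` norm of the two modes. -/
def modeSq (k : ℕ) : ℝ := 1 + 4 * (k : ℝ) ^ 2 + 16 * (k : ℝ) ^ 4

theorem modeSq_pos (k : ℕ) : 0 < modeSq k := by unfold modeSq; positivity

theorem inner_cosMode (u : H2) :
    inner ℝ u (cosMode k) = modeSq k * inner ℝ (D 0 u) (D 0 (cosMode k)) := by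
  rw [inner_H2, inner_D1_cosMode, D2_cosMode, inner_smul_right, inner_D2_cosMode, modeSq, sigma]
  ring

theorem inner_sinMode (u : H2) :
    inner ℝ u (sinMode k) = modeSq k * inner ℝ (D 0 u) (D 0 (sinMode k)) := by
  rw [inner_H2, inner_D1_sinMode, D2_sinMode, inner_smul_right, inner_D2_sinMode, modeSq, sigma]
  ring

theorem nrm_sq : nrm * nrm = 2 / Real.pi := Real.mul_self_sqrt (by positivity)

theorem inner_modes (hk : 0 < k) :
    inner ℝ (D 0 (cosMode k)) (D 0 (cosMode k)) = 1 ∧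
      inner ℝ (D 0 (sinMode k)) (D 0 (sinMode k)) = 1 ∧
      inner ℝ (D 0 (cosMode k)) (D 0 (sinMode k)) = 0 := by
  have hk' : (k : ℝ) ≠ 0 := by positivity
  have hs : ∀ t, HasDerivAt (fun t => Real.sin (2 * k * t)) (2 * k * Real.cos (2 * k * t)) t := by
    intro t; simpa using hasDerivAt_sinMode 1 k t
  have hc : ∀ t, HasDerivAt (fun t => Real.cos (2 * k * t)) (-(2 * k) * Real.sin (2 * k * t)) t := by
    intro t; simpa using hasDerivAt_cosMode 1 k t
  have hcc : ∫ t in (0:ℝ)..Real.pi, Real.cos (2 * k * t) * Real.cos (2 * k * t) = Real.pi / 2 := by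
    rw [intervalIntegral.integral_eq_sub_of_hasDerivAt
      (f := fun t => t / 2 + Real.sin (2 * k * t) * Real.cos (2 * k * t) / (4 * k))]
    · simp [sin_end]
    · intro t _
      refine (((hasDerivAt_id t).div_const 2).add (((hs t).mul (hc t)).div_const (4 * k))).congr_deriv ?_
      have := Real.sin_sq_add_cos_sq (2 * k * t)
      field_simp
      linear_combination (-4) * this
    · exact Continuous.intervalIntegrable (by fun_prop) _ _
  have hss : ∫ t in (0:ℝ)..Real.pi, Real.sin (2 * k * t) * Real.sin (2 * k * t) = Real.pi / 2 := by
    rw [intervalIntegral.integral_eq_sub_of_hasDerivAt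
      (f := fun t => t / 2 - Real.sin (2 * k * t) * Real.cos (2 * k * t) / (4 * k))]
    · simp [sin_end]
    · intro t _
      refine (((hasDerivAt_id t).div_const 2).sub (((hs t).mul (hc t)).div_const (4 * k))).congr_deriv ?_
      have := Real.sin_sq_add_cos_sq (2 * k * t)
      field_simp
      linear_combination (-4) * this
    · exact Continuous.intervalIntegrable (by fun_prop) _ _
  have hcs : ∫ t in (0:ℝ)..Real.pi, Real.cos (2 * k * t) * Real.sin (2 * k * t) = 0 := by
    rw [intervalIntegral.integral_eq_sub_of_hasDerivAt
      (f := fun t => Real.sin (2 * k * t) * Real.sin (2 * k * t) / (4 * k))]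
    · simp [sin_end]
    · intro t _
      refine (((hs t).mul (hs t)).div_const (4 * k)).congr_deriv ?_
      field_simp
      ring
    · exact Continuous.intervalIntegrable (by fun_prop) _ _
  have hpi := Real.pi_ne_zero
  have cont1 : Continuous fun t : ℝ => nrm * Real.cos (2 * k * t) := by fun_prop
  have cont2 : Continuous fun t : ℝ => nrm * Real.sin (2 * k * t) := by fun_prop
  have e1 : D 0 (cosMode k) = toL2 _ cont1 := rfl
  have e2 : D 0 (sinMode k) = toL2 _ cont2 := rfl
  have fac : ∀ a b : ℝ → ℝ, ∫ t, (nrm * a t) * (nrm * b t) ∂mu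
      = 2 / Real.pi * ∫ t in (0:ℝ)..Real.pi, a t * b t := by
    intro a b
    rw [← nrm_sq, ← integral_mu, ← integral_const_mul]; congr 1; ext t; ring
  refine ⟨?_, ?_, ?_⟩
  · rw [e1, inner_toL2_toL2, fac, hcc]; field_simp
  · rw [e2, inner_toL2_toL2, fac, hss]; field_simp
  · rw [e1, e2, inner_toL2_toL2, fac, hcs, mul_zero]

end Modes

theorem memLp_continuousOn {f : ℝ → ℝ} (hf : ContinuousOn f (Icc 0 Real.pi)) : MemLp f 2 mu := by
  obtain ⟨C, hC⟩ := isCompact_Icc.exists_bound_of_continuousOn hf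
  refine MemLp.of_bound (hf.aestronglyMeasurable measurableSet_Icc) C ?_
  filter_upwards [ae_restrict_mem measurableSet_Icc] with t ht using hC t ht

local instance instSeminormedAddCommGroupL2 : SeminormedAddCommGroup L2 := inferInstance

local instance instSeminormedAddCommGroupH2 : SeminormedAddCommGroup H2 := inferInstance

/-- The orthogonal complement of the nullspace. -/
abbrev Yk (k : ℕ) : Type := ↥(nullS k)ᗮ

local instance instSeminormedAddCommGroupYk (k : ℕ) : SeminormedAddCommGroup (Yk k) := inferInstance

local instance instNormedAddCommGroupYk (k : ℕ) : NormedAddCommGroup (Yk k) := inferInstance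

local instance instNormedSpaceYk (k : ℕ) : NormedSpace ℝ (Yk k) := inferInstance

section Lin

variable {k : ℕ}

theorem hasDerivAt_cos' (k : ℕ) (t : ℝ) :
    HasDerivAt (fun t => Real.cos (2 * k * t)) (-(2 * k) * Real.sin (2 * k * t)) t := by
  simpa using hasDerivAt_cosMode 1 k t

theorem hasDerivAt_sin' (k : ℕ) (t : ℝ) :
    HasDerivAt (fun t => Real.sin (2 * k * t)) (2 * k * Real.cos (2 * k * t)) t := by
  simpa using hasDerivAt_sinMode 1 k t

theorem contDiff_cos' (k : ℕ) (c : ℝ) : ContDiff ℝ ∞ fun t : ℝ => c * Real.cos (2 * k * t) := by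
  fun_prop

theorem contDiff_sin' (k : ℕ) (c : ℝ) : ContDiff ℝ ∞ fun t : ℝ => c * Real.sin (2 * k * t) := by
  fun_prop

/-- The coefficients of the `L²`-projection onto the two modes. -/
def coef (k : ℕ) : L2 →L[ℝ] ℝ × ℝ :=
  (innerSL ℝ (D 0 (cosMode k))).prod (innerSL ℝ (D 0 (sinMode k)))

theorem coef_apply (v : L2) :
    coef k v = (inner ℝ v (D 0 (cosMode k)), inner ℝ v (D 0 (sinMode k))) := by
  rw [real_inner_comm, real_inner_comm (D 0 (sinMode k))]; rfl

/-- The combination `x₁ φ_k + x₂ ϕ_k` as a continuous linear map into `H²(𝕋)`. -/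
def LL (k : ℕ) : ℝ × ℝ →L[ℝ] H2 :=
  (ContinuousLinearMap.fst ℝ ℝ ℝ).smulRight (cosMode k) +
    (ContinuousLinearMap.snd ℝ ℝ ℝ).smulRight (sinMode k)

theorem LL_apply (x : ℝ × ℝ) : LL k x = x.1 • cosMode k + x.2 • sinMode k := rfl

theorem coe_Lmap (x : ℝ × ℝ) : (Lmap k x : H2) = LL k x := rfl

theorem LL_mem (x : ℝ × ℝ) : LL k x ∈ nullS k := (Lmap k x).2

theorem coef_LL (hk : 0 < k) (x : ℝ × ℝ) : coef k (D 0 (LL k x)) = x := by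
  obtain ⟨h1, h2, h3⟩ := inner_modes hk
  have h4 : inner ℝ (D 0 (sinMode k)) (D 0 (cosMode k)) = 0 := by rw [real_inner_comm, h3]
  rw [coef_apply, LL_apply, D_add, D_smul, D_smul]
  simp only [inner_add_left, inner_smul_left, h1, h2, h3, h4]
  ext <;> simp

theorem Q_eq (v : L2) : Q k v = D 0 (LL k (coef k v)) := by
  rw [coef_apply]; rfl

theorem P_eq (u : H2) : P k u = LL k (coef k (D 0 u)) := by
  have h : nrmH k * nrmH k * modeSq k = 1 := by
    have : nrmH k * nrmH k = (modeSq k)⁻¹ := by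
      rw [nrmH, ← mul_inv]
      exact congrArg _ (Real.mul_self_sqrt (modeSq_pos k).le)
    rw [this, inv_mul_cancel₀ (modeSq_pos k).ne']
  rw [coef_apply, LL_apply, P, inner_smul_right, inner_smul_right, inner_cosMode, inner_sinMode,
    smul_smul, smul_smul]
  congr 2
  · linear_combination (inner ℝ (D 0 u) (D 0 (cosMode k))) * h
  · linear_combination (inner ℝ (D 0 u) (D 0 (sinMode k))) * h

/-- Elements of the nullspace are combinations of the two modes. -/
theorem exists_of_mem_nullS (hk : 0 < k) {u : H2} (hu : u ∈ nullS k) : ∃ x, u = LL k x := by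
  have hk' : (k : ℝ) ≠ 0 := by positivity
  have hD2 : D 2 u = -sigma k • D 0 u := by
    have : D 2 u + sigma k • D 0 u = 0 := hu
    rw [neg_smul]; exact eq_neg_of_add_eq_zero_left this
  have hD2ae : D 2 u =ᵐ[mu] fun t => -sigma k * D 0 u t := by
    rw [hD2]; exact Lp.coeFn_smul _ _
  have hw0 : WeakDeriv (D 0 u) (D 1 u) := D_weak0 u
  have hw1 : WeakDeriv (D 1 u) (D 2 u) := D_weak1 u
  have i0 := (D 0 u).integrable
  have i1 := (D 1 u).integrable
  have i2 := (D 2 u).integrable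
  have cc := contDiff_cos' k
  have cs := contDiff_sin' k
  have dcos : ∀ c : ℝ, deriv (fun t : ℝ => c * Real.cos (2 * k * t)) =
      fun t => -(c * (2 * k)) * Real.sin (2 * k * t) :=
    fun c => funext fun t => (hasDerivAt_cosMode c k t).deriv
  have dsin : ∀ c : ℝ, deriv (fun t : ℝ => c * Real.sin (2 * k * t)) =
      fun t => c * (2 * k) * Real.cos (2 * k * t) :=
    fun c => funext fun t => (hasDerivAt_sinMode c k t).deriv
  have im : ∀ {v m : ℝ → ℝ}, Integrable v mu → ContDiff ℝ ∞ m → Integrable (fun t => v t * m t) mu :=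
    fun hv hm => integrable_mul_cont hv hm.continuous
  have idm : ∀ {u v m : ℝ → ℝ}, Integrable v mu → Integrable u mu → ContDiff ℝ ∞ m →
      Integrable (fun t => v t * m t + u t * deriv m t) mu :=
    fun hv hu hm => (im hv hm).add (integrable_mul_cont hu (hm.continuous_deriv (by simp)))
  obtain ⟨a, ha⟩ := WeakDeriv.ae_eq_const
    ((im i0 (cc 1)).add (im i1 (cs (-(2 * k : ℝ)⁻¹))))
    (((hw0.smooth_mul i0 i1 (cc 1)).add (im i0 (cc 1)) (idm i1 i0 (cc 1)) (im i1 (cs (-(2 * k : ℝ)⁻¹)))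
      (idm i2 i1 (cs _)) (hw1.smooth_mul i1 i2 (cs (-(2 * k : ℝ)⁻¹)))).congr
      Filter.EventuallyEq.rfl (by
        filter_upwards [hD2ae] with t ht
        rw [dcos, dsin, ht, sigma, Pi.zero_apply]
        field_simp
        ring))
  obtain ⟨b, hb⟩ := WeakDeriv.ae_eq_const
    ((im i0 (cs 1)).add (im i1 (cc (2 * k : ℝ)⁻¹)))
    (((hw0.smooth_mul i0 i1 (cs 1)).add (im i0 (cs 1)) (idm i1 i0 (cs 1)) (im i1 (cc (2 * k : ℝ)⁻¹))
      (idm i2 i1 (cc _)) (hw1.smooth_mul i1 i2 (cc (2 * k : ℝ)⁻¹))).congr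
      Filter.EventuallyEq.rfl (by
        filter_upwards [hD2ae] with t ht
        rw [dcos, dsin, ht, sigma, Pi.zero_apply]
        field_simp
        ring))
  have hn : nrm ≠ 0 := by
    have := nrm_sq
    intro h
    rw [h, mul_zero] at this
    exact (div_pos two_pos Real.pi_pos).ne this
  refine ⟨(a / nrm, b / nrm), H2_ext (Lp.ext ?_)⟩
  have e0 : D 0 (LL k (a / nrm, b / nrm)) =
    (a / nrm) • D 0 (cosMode k) + (b / nrm) • D 0 (sinMode k) := rfl
  have c1 : Continuous fun t : ℝ => nrm * Real.cos (2 * k * t) := by fun_prop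
  have c2 : Continuous fun t : ℝ => nrm * Real.sin (2 * k * t) := by fun_prop
  have e1 : D 0 (cosMode k) =ᵐ[mu] _ := toL2_coe c1
  have e2 : D 0 (sinMode k) =ᵐ[mu] _ := toL2_coe c2
  rw [e0]
  filter_upwards [ha, hb, e1, e2, Lp.coeFn_add ((a / nrm) • D 0 (cosMode k))
    ((b / nrm) • D 0 (sinMode k)), Lp.coeFn_smul (a / nrm) (D 0 (cosMode k)),
    Lp.coeFn_smul (b / nrm) (D 0 (sinMode k))] with t h1 h2 h3 h4 h5 h6 h7
  rw [h5, Pi.add_apply, h6, h7, Pi.smul_apply, Pi.smul_apply, h3, h4, smul_eq_mul, smul_eq_mul]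
  simp only [Pi.add_apply] at h1 h2
  rw [← h1, ← h2]
  have := Real.sin_sq_add_cos_sq (2 * k * t)
  field_simp
  linear_combination (-2 * k * D 0 u t) * this

theorem eq_Lmap (hk : 0 < k) (n : nullS k) : n = Lmap k (coef k (D 0 (n : H2))) := by
  obtain ⟨x, hx⟩ := exists_of_mem_nullS hk n.2
  refine Subtype.ext ?_
  rw [coe_Lmap, hx, coef_LL hk]

theorem mem_orthogonal_iff (hk : 0 < k) (u : H2) : u ∈ (nullS k)ᗮ ↔ coef k (D 0 u) = 0 := by
  have hm := (modeSq_pos k).ne'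
  rw [Submodule.mem_orthogonal']
  constructor
  · intro h
    have h1 := h _ (cosMode_mem k)
    have h2 := h _ (sinMode_mem k)
    rw [inner_cosMode] at h1
    rw [inner_sinMode] at h2
    rw [coef_apply, (mul_eq_zero.1 h1).resolve_left hm, (mul_eq_zero.1 h2).resolve_left hm]
    rfl
  · intro h n hn
    obtain ⟨x, rfl⟩ := exists_of_mem_nullS hk hn
    rw [coef_apply, Prod.mk_eq_zero] at h
    rw [LL_apply, inner_add_right, inner_smul_right, inner_smul_right, inner_cosMode,
      inner_sinMode, h.1, h.2]
    simp

/-- The linearization at `(σ_k, 0)` as a continuous linear map. -/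
def A (k : ℕ) : H2 →L[ℝ] L2 := DL 2 + sigma k • DL 0

theorem A_apply (u : H2) : A k u = D 2 u + sigma k • D 0 u := rfl

theorem A_LL (x : ℝ × ℝ) : A k (LL k x) = 0 := LL_mem x

theorem coef_A (u : H2) : coef k (A k u) = 0 := by
  rw [coef_apply, A_apply]
  simp only [inner_add_left, inner_smul_left, inner_D2_cosMode, inner_D2_sinMode]
  ext <;> simp

/-- Solvability of `u'' + σ_k u = w` for `w` orthogonal to the modes. -/
theorem exists_A_eq (hk : 0 < k) (w : L2) (hw : coef k w = 0) : ∃ u, A k u = w := by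
  have hk' : (k : ℝ) ≠ 0 := by positivity
  have hn : nrm ≠ 0 := by
    have := nrm_sq
    intro h
    rw [h, mul_zero] at this
    exact (div_pos two_pos Real.pi_pos).ne this
  have iw := w.integrable
  have cc := contDiff_cos' k
  have cs := contDiff_sin' k
  have c1 : Continuous fun t : ℝ => nrm * Real.cos (2 * k * t) := by fun_prop
  have c2 : Continuous fun t : ℝ => nrm * Real.sin (2 * k * t) := by fun_prop
  have hw1 : ∫ t, w t * (nrm * Real.cos (2 * k * t)) ∂mu = 0 := by
    rw [← inner_toL2 w c1]
    rw [coef_apply, Prod.mk_eq_zero] at hw; exact hw.1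
  have hw2 : ∫ t, w t * (nrm * Real.sin (2 * k * t)) ∂mu = 0 := by
    rw [← inner_toL2 w c2]
    rw [coef_apply, Prod.mk_eq_zero] at hw; exact hw.2
  set wc : ℝ → ℝ := fun t => w t * (nrm * Real.cos (2 * k * t)) with hwc
  set ws : ℝ → ℝ := fun t => w t * (nrm * Real.sin (2 * k * t)) with hws
  have iwc : Integrable wc mu := integrable_mul_cont iw c1
  have iws : Integrable ws mu := integrable_mul_cont iw c2
  have dC : WeakDeriv (prim wc) wc := by simpa using weakDeriv_prim iwc 0
  have dS : WeakDeriv (prim ws) ws := by simpa using weakDeriv_prim iws 0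
  have conC := continuousOn_prim iwc
  have conS := continuousOn_prim iws
  have iC : Integrable (prim wc) mu := conC.integrableOn_Icc
  have iS : Integrable (prim ws) mu := conS.integrableOn_Icc
  have dcos : ∀ c : ℝ, deriv (fun t : ℝ => c * Real.cos (2 * k * t)) =
      fun t => -(c * (2 * k)) * Real.sin (2 * k * t) :=
    fun c => funext fun t => (hasDerivAt_cosMode c k t).deriv
  have dsin : ∀ c : ℝ, deriv (fun t : ℝ => c * Real.sin (2 * k * t)) =
      fun t => c * (2 * k) * Real.cos (2 * k * t) :=
    fun c => funext fun t => (hasDerivAt_sinMode c k t).deriv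
  have im : ∀ {v m : ℝ → ℝ}, Integrable v mu → ContDiff ℝ ∞ m → Integrable (fun t => v t * m t) mu :=
    fun hv hm => integrable_mul_cont hv hm.continuous
  have idm : ∀ {u v m : ℝ → ℝ}, Integrable v mu → Integrable u mu → ContDiff ℝ ∞ m →
      Integrable (fun t => v t * m t + u t * deriv m t) mu :=
    fun hv hu hm => (im hv hm).add (integrable_mul_cont hu (hm.continuous_deriv (by simp)))
  let a : ℝ := (nrm * (2 * k))⁻¹
  let f : ℝ → ℝ := fun t => prim wc t * (a * Real.sin (2 * k * t)) +
    prim ws t * (-a * Real.cos (2 * k * t))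
  let g : ℝ → ℝ := fun t => prim wc t * (nrm⁻¹ * Real.cos (2 * k * t)) +
    prim ws t * (nrm⁻¹ * Real.sin (2 * k * t))
  have hf : WeakDeriv f g := ((dC.smooth_mul iC iwc (cs a)).add (im iC (cs a)) (idm iwc iC (cs a))
    (im iS (cc (-a))) (idm iws iS (cc (-a))) (dS.smooth_mul iS iws (cc (-a)))).congr
      Filter.EventuallyEq.rfl (Filter.Eventually.of_forall fun t => by
        simp only [dcos, dsin, hwc, hws, g, a]
        field_simp
        ring)
  have hg : WeakDeriv g (fun t => w t - sigma k * f t) :=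
    ((dC.smooth_mul iC iwc (cc nrm⁻¹)).add (im iC (cc nrm⁻¹)) (idm iwc iC (cc nrm⁻¹))
    (im iS (cs nrm⁻¹)) (idm iws iS (cs nrm⁻¹)) (dS.smooth_mul iS iws (cs nrm⁻¹))).congr
      Filter.EventuallyEq.rfl (Filter.Eventually.of_forall fun t => by
        simp only [dcos, dsin, hwc, hws, f, a, sigma]
        have := Real.sin_sq_add_cos_sq (2 * k * t)
        field_simp
        linear_combination (2 * w t * nrm) * this)
  have conf : ContinuousOn f (Icc 0 Real.pi) :=
    (conC.mul (cs a).continuous.continuousOn).add (conS.mul (cc (-a)).continuous.continuousOn)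
  have cong : ContinuousOn g (Icc 0 Real.pi) :=
    (conC.mul (cc nrm⁻¹).continuous.continuousOn).add (conS.mul (cs nrm⁻¹).continuous.continuousOn)
  let U : L2 := (memLp_continuousOn conf).toLp f
  let V : L2 := (memLp_continuousOn cong).toLp g
  have hU : U =ᵐ[mu] f := MemLp.coeFn_toLp _
  have hV : V =ᵐ[mu] g := MemLp.coeFn_toLp _
  have hC : prim wc Real.pi = 0 := by rw [prim_pi]; exact hw1
  have hS : prim ws Real.pi = 0 := by rw [prim_pi]; exact hw2
  have hW : (w - sigma k • U : L2) =ᵐ[mu] fun t => w t - sigma k * f t := by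
    filter_upwards [Lp.coeFn_sub w (sigma k • U), Lp.coeFn_smul (sigma k) U, hU] with t h1 h2 h3
    rw [h1, Pi.sub_apply, h2, Pi.smul_apply, h3, smul_eq_mul]
  let u : H2 := ⟨WithLp.toLp 2 ![U, V, w - sigma k • U],
    hf.congr hU.symm hV.symm, hg.congr hV.symm hW.symm,
    ⟨f, ⟨conf, hU⟩, by simp only [f, prim_zero, hC, hS]; ring⟩,
    ⟨g, ⟨cong, hV⟩, by simp only [g, prim_zero, hC, hS]; ring⟩⟩
  refine ⟨u, ?_⟩
  change (w - sigma k • U) + sigma k • U = w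
  abel


theorem sub_mem_orthogonal (hk : 0 < k) (u : H2) : u - LL k (coef k (D 0 u)) ∈ (nullS k)ᗮ := by
  rw [mem_orthogonal_iff hk, D_sub, map_sub, coef_LL hk, sub_self]

theorem coef_Y (hk : 0 < k) (y : Yk k) : coef k (D 0 (y : H2)) = 0 :=
  (mem_orthogonal_iff hk _).1 y.2

/-- `(y, c) ↦ 𝔏(σ_k) y + c₁ φ_k + c₂ ϕ_k`. -/
def T (k : ℕ) : Yk k × (ℝ × ℝ) →L[ℝ] L2 :=
  ((A k).comp ((nullS k)ᗮ).subtypeL).coprod ((DL 0).comp (LL k))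

theorem T_apply (p : Yk k × (ℝ × ℝ)) : T k p = A k p.1 + D 0 (LL k p.2) := rfl

theorem coef_T (hk : 0 < k) (p : Yk k × (ℝ × ℝ)) : coef k (T k p) = p.2 := by
  rw [T_apply, map_add, coef_A, coef_LL hk, zero_add]

theorem A_Y_eq_zero (y : Yk k) (h : A k (y : H2) = 0) : y = 0 := by
  have h1 : (y : H2) ∈ nullS k := h
  have := Submodule.inner_left_of_mem_orthogonal h1 y.2
  exact Subtype.ext (inner_self_eq_zero.1 this)

theorem T_injective (hk : 0 < k) : (T k).ker = ⊥ := by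
  rw [LinearMap.ker_eq_bot']
  intro p hp
  have h2 : p.2 = 0 := by
    rw [← coef_T hk p]
    have : T k p = 0 := hp
    rw [this, map_zero]
  have h1 : A k (p.1 : H2) = 0 := by
    have : A k p.1 + D 0 (LL k p.2) = 0 := hp
    rwa [h2, map_zero, ← DL_apply, map_zero, add_zero] at this
  exact Prod.ext (A_Y_eq_zero _ h1) h2

theorem T_surjective (hk : 0 < k) : (T k).range = ⊤ := by
  rw [LinearMap.range_eq_top]
  intro w
  obtain ⟨u, hu⟩ := exists_A_eq hk (w - D 0 (LL k (coef k w))) (by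
    rw [map_sub, coef_LL hk, sub_self])
  refine ⟨(⟨u - LL k (coef k (D 0 u)), sub_mem_orthogonal hk u⟩, coef k w), ?_⟩
  change A k (u - LL k (coef k (D 0 u))) + D 0 (LL k (coef k w)) = w
  rw [map_sub, A_LL, hu]
  abel

/-- `T` as an isomorphism. -/
def TE (hk : 0 < k) : (Yk k × (ℝ × ℝ)) ≃L[ℝ] L2 :=
  ContinuousLinearEquiv.ofBijective (T k) (T_injective hk) (T_surjective hk)

/-- The solution operator of the linear problem. -/
def S (hk : 0 < k) : L2 →L[ℝ] Yk k :=
  (ContinuousLinearMap.fst ℝ (Yk k) (ℝ × ℝ)).comp ((TE hk).symm : L2 →L[ℝ] Yk k × (ℝ × ℝ))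

theorem A_S (hk : 0 < k) (w : L2) : A k (S hk w : H2) = w - D 0 (LL k (coef k w)) := by
  have h1 : T k ((TE hk).symm w) = w := (TE hk).apply_symm_apply w
  have h2 : ((TE hk).symm w).2 = coef k w := by rw [← coef_T hk, h1]
  have h3 : A k (S hk w : H2) + D 0 (LL k ((TE hk).symm w).2) = w := h1
  rw [h2] at h3
  exact eq_sub_of_add_eq h3

theorem S_eq_of (hk : 0 < k) (y : Yk k) (c : ℝ × ℝ) : S hk (A k (y : H2) + D 0 (LL k c)) = y := by
  have : (TE hk).symm (TE hk (y, c)) = (y, c) := (TE hk).symm_apply_apply _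
  exact congrArg Prod.fst this

theorem S_A (hk : 0 < k) (y : Yk k) : S hk (A k (y : H2)) = y := by
  have := S_eq_of hk y 0
  rwa [map_zero, ← DL_apply, map_zero, add_zero] at this

theorem S_LL (hk : 0 < k) (c : ℝ × ℝ) : S hk (D 0 (LL k c)) = 0 := by
  have := S_eq_of hk 0 c
  rwa [Submodule.coe_zero, map_zero, zero_add] at this

theorem S_eq_zero_iff (hk : 0 < k) (w : L2) : S hk w = 0 ↔ w - Q k w = 0 := by
  rw [Q_eq, ← A_S hk]
  exact ⟨fun h => by rw [h, Submodule.coe_zero, map_zero], fun h => A_Y_eq_zero _ h⟩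

theorem eq_zero_iff (hk : 0 < k) (w : L2) : w = 0 ↔ S hk w = 0 ∧ coef k w = 0 := by
  refine ⟨fun h => by simp [h], fun ⟨h1, h2⟩ => ?_⟩
  have h3 := A_S hk w
  rw [h1, h2, Submodule.coe_zero, map_zero, map_zero, ← DL_apply, map_zero, sub_zero] at h3
  exact h3.symm

end Lin

theorem exists_D0_bound : ∃ K : ℝ, 0 < K ∧ ∀ u : H2, ∀ᵐ t ∂mu, ‖D 0 u t‖ ≤ K * ‖u‖ := by
  obtain ⟨K, hK, h⟩ := exists_sup_bound
  refine ⟨K * 2, by positivity, fun u => ?_⟩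
  obtain ⟨f, hf, -⟩ := D_per0 u
  filter_upwards [hf.2, ae_restrict_mem measurableSet_Icc] with t h1 h2
  rw [h1, Real.norm_eq_abs]
  refine (h _ _ (D_weak0 u) f hf t h2).trans ?_
  rw [mul_assoc]
  have := norm_D_le 0 u
  have := norm_D_le 1 u
  gcongr
  linarith

theorem memLp_top_D0 (u : H2) : MemLp (D 0 u) ⊤ mu := by
  obtain ⟨K, -, h⟩ := exists_D0_bound
  exact memLp_top_of_bound (Lp.aestronglyMeasurable _) _ (h u)

/-- The embedding of `H²(𝕋)` into `L^∞`. -/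
def iL : H2 →L[ℝ] Lp ℝ ⊤ mu :=
  LinearMap.mkContinuousOfExistsBound
    { toFun := fun u => (memLp_top_D0 u).toLp
      map_add' := fun u v => by
        rw [← MemLp.toLp_add]
        exact MemLp.toLp_congr _ _ (Lp.coeFn_add (D 0 u) (D 0 v))
      map_smul' := fun c u => by
        rw [RingHom.id_apply, ← MemLp.toLp_const_smul]
        exact MemLp.toLp_congr _ _ (Lp.coeFn_smul c (D 0 u)) }
    (by
      obtain ⟨K, hK, h⟩ := exists_D0_bound
      refine ⟨K, fun u => ?_⟩
      have := Lp.norm_le_of_ae_bound (f := (memLp_top_D0 u).toLp) (C := K * ‖u‖) (by positivity)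
        (by
          filter_upwards [h u, (memLp_top_D0 u).coeFn_toLp] with t h1 h2
          rw [h2]; exact h1)
      simpa using this)

theorem iL_coe (u : H2) : iL u =ᵐ[mu] D 0 u := (memLp_top_D0 u).coeFn_toLp

theorem measurable_weight : Measurable weight := measurable_const.indicator measurableSet_Icc

theorem memLp_weight : MemLp weight ⊤ mu := by
  refine memLp_top_of_bound measurable_weight.aestronglyMeasurable 1
    (Filter.Eventually.of_forall fun t => ?_)
  unfold weight
  by_cases h : t ∈ Icc 0 (Real.pi / 4) <;> simp [h]

/-- The pointwise product `L^∞ × L² → L²`. -/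
def mulL : Lp ℝ ⊤ mu →L[ℝ] L2 →L[ℝ] L2 :=
  (ContinuousLinearMap.mul ℝ ℝ).holderL mu ⊤ 2 2

theorem mulL_coe (f : Lp ℝ ⊤ mu) (g : L2) : mulL f g =ᵐ[mu] fun t => f t * g t :=
  ContinuousLinearMap.coeFn_holder _ f g

/-- Multiplication by a function in `H²(𝕋)`. -/
def mulH : H2 →L[ℝ] L2 →L[ℝ] L2 := mulL.comp iL

/-- Multiplication by the weight. -/
def mulW : L2 →L[ℝ] L2 := mulL (memLp_weight.toLp weight)

/-- The trilinear map `(u, v, w) ↦ a u v w`. -/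
def tri (u v w : H2) : L2 := mulW (mulH u (mulH v (DL 0 w)))

theorem tri_coe (u v w : H2) :
    tri u v w =ᵐ[mu] fun t => weight t * (D 0 u t * (D 0 v t * D 0 w t)) := by
  have h1 := mulL_coe (memLp_weight.toLp weight) (mulH u (mulH v (DL 0 w)))
  have h2 := mulL_coe (iL u) (mulH v (DL 0 w))
  have h3 := mulL_coe (iL v) (DL 0 w)
  filter_upwards [h1, h2, h3, iL_coe u, iL_coe v, memLp_weight.coeFn_toLp] with t h1 h2 h3 h4 h5 h6
  have h1' : tri u v w t = _ := h1
  have h2' : mulH u (mulH v (DL 0 w)) t = _ := h2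
  have h3' : mulH v (DL 0 w) t = _ := h3
  rw [h1', h2', h3', h4, h5, h6]
  rfl

theorem cubic_coe (u : H2) : cubic u =ᵐ[mu] fun t => weight t * (D 0 u t) ^ 3 :=
  (memLp_cubic u).coeFn_toLp

theorem cubic_eq_tri (u : H2) : cubic u = tri u u u := by
  refine Lp.ext ?_
  filter_upwards [cubic_coe u, tri_coe u u u] with t h1 h2
  rw [h1, h2]; ring

theorem cubic_smul (c : ℝ) (u : H2) : cubic (c • u) = c ^ 3 • cubic u := by
  have h1 : ∀ v, mulH (c • u) v = c • mulH u v := fun v => by rw [map_smul]; rfl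
  rw [cubic_eq_tri, cubic_eq_tri, tri, tri, h1, h1]
  simp only [map_smul, smul_smul]
  congr 1; ring

theorem cubic_zero : cubic 0 = 0 := by
  have := cubic_smul 0 0
  rwa [zero_smul, zero_pow (by norm_num), zero_smul] at this

theorem contDiff_cubic : ContDiff ℝ ω cubic := by
  have : cubic = fun u => mulW (mulH u (mulH u (DL 0 u))) := funext cubic_eq_tri
  rw [this]
  exact mulW.contDiff.comp (mulH.contDiff.clm_apply (mulH.contDiff.clm_apply (DL 0).contDiff))

/-- The derivative of the cubic term. -/
def dcubic (u : H2) : H2 →L[ℝ] L2 := (3 : ℝ) • (mulW.comp ((mulH u).comp ((mulH u).comp (DL 0))))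

theorem dcubic_apply (u h : H2) : dcubic u h = (3 : ℝ) • tri u u h := rfl

theorem hasFDerivAt_cubic (u : H2) : HasFDerivAt cubic (dcubic u) u := by
  have : cubic = fun u => mulW (mulH u (mulH u (DL 0 u))) := funext cubic_eq_tri
  rw [this]
  refine (mulW.hasFDerivAt.comp u ((mulH.hasFDerivAt (x := u)).clm_apply
    ((mulH.hasFDerivAt (x := u)).clm_apply ((DL 0).hasFDerivAt (x := u))))).congr_fderiv ?_
  ext1 h
  rw [dcubic_apply]
  change mulW (mulH u (mulH u (DL 0 h) + mulH h (DL 0 u)) + mulH h (mulH u (DL 0 u))) = _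
  rw [map_add, map_add, map_add]
  change tri u u h + tri u h u + tri h u u = _
  have e1 : tri u h u = tri u u h := by
    refine Lp.ext ?_
    filter_upwards [tri_coe u h u, tri_coe u u h] with t h1 h2
    rw [h1, h2]; ring
  have e2 : tri h u u = tri u u h := by
    refine Lp.ext ?_
    filter_upwards [tri_coe h u u, tri_coe u u h] with t h1 h2
    rw [h1, h2]; ring
  rw [e1, e2]
  module

theorem integral_weight_mul (f : ℝ → ℝ) :
    ∫ t, weight t * f t ∂mu = ∫ t in (0 : ℝ)..(Real.pi / 4), f t := by
  have h : (fun t => weight t * f t) = indicator (Icc 0 (Real.pi / 4)) f := by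
    ext t
    unfold weight
    by_cases h : t ∈ Icc 0 (Real.pi / 4) <;> simp [h]
  have hpi := Real.pi_pos
  rw [h, setIntegral_indicator measurableSet_Icc, inter_eq_right.2, integral_Icc_eq_integral_Ioc,
    ← intervalIntegral.integral_of_le (by positivity)]
  exact Icc_subset_Icc_right (by linarith)

section Integrals

variable {k : ℕ}

theorem cos_quarter (hk : Odd k) : Real.cos (2 * k * (Real.pi / 4)) = 0 := by
  obtain ⟨m, rfl⟩ := hk
  rw [Real.cos_eq_zero_iff]
  exact ⟨m, by push_cast; ring⟩

theorem sin_quarter_sq (hk : Odd k) : Real.sin (2 * k * (Real.pi / 4)) ^ 2 = 1 := by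
  have := Real.sin_sq_add_cos_sq (2 * k * (Real.pi / 4))
  rw [cos_quarter hk] at this
  simpa using this

theorem quartic_integral_cos (hk : Odd k) (z w h g : ℝ) :
    ∫ t in (0 : ℝ)..(Real.pi / 4), (z * Real.cos (2 * k * t) + w * Real.sin (2 * k * t)) ^ 2 *
      (h * Real.cos (2 * k * t) + g * Real.sin (2 * k * t)) * Real.cos (2 * k * t) =
    Real.pi / 32 * (3 * z ^ 2 * h + 2 * z * w * g + w ^ 2 * h) +
      1 / (8 * k) * (z ^ 2 * g + 2 * z * w * h + w ^ 2 * g) := by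
  have hk' : (k : ℝ) ≠ 0 := by exact_mod_cast hk.pos.ne'
  rw [intervalIntegral.integral_eq_sub_of_hasDerivAt
    (f := fun t =>
      (z ^ 2 * h) * ((3 / 8 : ℝ) * t + ((3 / 8 : ℝ) * (Real.sin (2 * k * t) * Real.cos (2 * k * t)) +
        (1 / 4 : ℝ) * (Real.sin (2 * k * t) * Real.cos (2 * k * t) ^ 3)) / (2 * k)) +
      (2 * z * w * g + w ^ 2 * h) * ((1 / 8 : ℝ) * t +
        ((1 / 8 : ℝ) * (Real.sin (2 * k * t) * Real.cos (2 * k * t)) -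
        (1 / 4 : ℝ) * (Real.sin (2 * k * t) * Real.cos (2 * k * t) ^ 3)) / (2 * k)) +
      (z ^ 2 * g + 2 * z * w * h) * (-(Real.cos (2 * k * t) ^ 4) / (8 * k)) +
      (w ^ 2 * g) * (Real.sin (2 * k * t) ^ 4 / (8 * k)))]
  · have h4 : Real.sin (2 * k * (Real.pi / 4)) ^ 4 = 1 := by
      rw [show (4 : ℕ) = 2 * 2 from rfl, pow_mul, sin_quarter_sq hk, one_pow]
    simp only [cos_quarter hk, h4, mul_zero, Real.sin_zero, Real.cos_zero]
    field_simp
    ring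
  · intro t _
    have hs := hasDerivAt_sin' k t
    have hc := hasDerivAt_cos' k t
    have hid := hasDerivAt_id' t
    refine ((((((hid.const_mul (3 / 8 : ℝ)).add ((((hs.mul hc).const_mul (3 / 8 : ℝ)).add
      ((hs.mul (hc.pow 3)).const_mul (1 / 4 : ℝ))).div_const (2 * k))).const_mul (z ^ 2 * h)).add
      (((hid.const_mul (1 / 8 : ℝ)).add ((((hs.mul hc).const_mul (1 / 8 : ℝ)).sub
      ((hs.mul (hc.pow 3)).const_mul (1 / 4 : ℝ))).div_const (2 * k))).const_mul
        (2 * z * w * g + w ^ 2 * h))).add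
      (((hc.pow 4).neg.div_const (8 * k)).const_mul (z ^ 2 * g + 2 * z * w * h))).add
      (((hs.pow 4).div_const (8 * k)).const_mul (w ^ 2 * g))).congr_deriv ?_
    have h1 := Real.sin_sq_add_cos_sq (2 * k * t)
    have h2 : Real.sin (2 * k * t) ^ 2 = 1 - Real.cos (2 * k * t) ^ 2 := by linarith
    have h3 : Real.sin (2 * k * t) ^ 3 = (1 - Real.cos (2 * k * t) ^ 2) * Real.sin (2 * k * t) := by
      rw [← h2]; ring
    simp only [Pi.pow_apply]
    generalize Real.sin (2 * k * t) = s at h2 h3 ⊢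
    generalize Real.cos (2 * k * t) = c at h2 h3 ⊢
    field_simp
    ring_nf
    simp only [h2, h3]
    ring
  · exact Continuous.intervalIntegrable (by fun_prop) _ _

theorem quartic_integral_sin (hk : Odd k) (z w h g : ℝ) :
    ∫ t in (0 : ℝ)..(Real.pi / 4), (z * Real.cos (2 * k * t) + w * Real.sin (2 * k * t)) ^ 2 *
      (h * Real.cos (2 * k * t) + g * Real.sin (2 * k * t)) * Real.sin (2 * k * t) =
    Real.pi / 32 * (z ^ 2 * g + 2 * z * w * h + 3 * w ^ 2 * g) +
      1 / (8 * k) * (z ^ 2 * h + 2 * z * w * g + w ^ 2 * h) := by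
  have hk' : (k : ℝ) ≠ 0 := by exact_mod_cast hk.pos.ne'
  rw [intervalIntegral.integral_eq_sub_of_hasDerivAt
    (f := fun t =>
      (w ^ 2 * g) * ((3 / 8 : ℝ) * t - ((3 / 8 : ℝ) * (Real.cos (2 * k * t) * Real.sin (2 * k * t)) +
        (1 / 4 : ℝ) * (Real.cos (2 * k * t) * Real.sin (2 * k * t) ^ 3)) / (2 * k)) +
      (2 * z * w * h + z ^ 2 * g) * ((1 / 8 : ℝ) * t -
        ((1 / 8 : ℝ) * (Real.cos (2 * k * t) * Real.sin (2 * k * t)) -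
        (1 / 4 : ℝ) * (Real.cos (2 * k * t) * Real.sin (2 * k * t) ^ 3)) / (2 * k)) +
      (z ^ 2 * h) * (-(Real.cos (2 * k * t) ^ 4) / (8 * k)) +
      (w ^ 2 * h + 2 * z * w * g) * (Real.sin (2 * k * t) ^ 4 / (8 * k)))]
  · have h4 : Real.sin (2 * k * (Real.pi / 4)) ^ 4 = 1 := by
      rw [show (4 : ℕ) = 2 * 2 from rfl, pow_mul, sin_quarter_sq hk, one_pow]
    simp only [cos_quarter hk, h4, mul_zero, Real.sin_zero, Real.cos_zero]
    field_simp
    ring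
  · intro t _
    have hs := hasDerivAt_sin' k t
    have hc := hasDerivAt_cos' k t
    have hid := hasDerivAt_id' t
    refine ((((((hid.const_mul (3 / 8 : ℝ)).sub ((((hc.mul hs).const_mul (3 / 8 : ℝ)).add
      ((hc.mul (hs.pow 3)).const_mul (1 / 4 : ℝ))).div_const (2 * k))).const_mul (w ^ 2 * g)).add
      (((hid.const_mul (1 / 8 : ℝ)).sub ((((hc.mul hs).const_mul (1 / 8 : ℝ)).sub
      ((hc.mul (hs.pow 3)).const_mul (1 / 4 : ℝ))).div_const (2 * k))).const_mul
        (2 * z * w * h + z ^ 2 * g))).add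
      (((hc.pow 4).neg.div_const (8 * k)).const_mul (z ^ 2 * h))).add
      (((hs.pow 4).div_const (8 * k)).const_mul (w ^ 2 * h + 2 * z * w * g))).congr_deriv ?_
    have h1 := Real.sin_sq_add_cos_sq (2 * k * t)
    have h2 : Real.cos (2 * k * t) ^ 2 = 1 - Real.sin (2 * k * t) ^ 2 := by linarith
    have h3 : Real.cos (2 * k * t) ^ 3 = (1 - Real.sin (2 * k * t) ^ 2) * Real.cos (2 * k * t) := by
      rw [← h2]; ring
    simp only [Pi.pow_apply]
    generalize Real.sin (2 * k * t) = s at h2 h3 ⊢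
    generalize Real.cos (2 * k * t) = c at h2 h3 ⊢
    field_simp
    ring_nf
    simp only [h2, h3]
    ring
  · exact Continuous.intervalIntegrable (by fun_prop) _ _

theorem D0_LL_coe (x : ℝ × ℝ) : D 0 (LL k x) =ᵐ[mu]
    fun t => nrm * (x.1 * Real.cos (2 * k * t) + x.2 * Real.sin (2 * k * t)) := by
  have c1 : Continuous fun t : ℝ => nrm * Real.cos (2 * k * t) := by fun_prop
  have c2 : Continuous fun t : ℝ => nrm * Real.sin (2 * k * t) := by fun_prop
  have e1 : D 0 (cosMode k) =ᵐ[mu] _ := toL2_coe c1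
  have e2 : D 0 (sinMode k) =ᵐ[mu] _ := toL2_coe c2
  have e0 : D 0 (LL k x) = x.1 • D 0 (cosMode k) + x.2 • D 0 (sinMode k) := rfl
  rw [e0]
  filter_upwards [e1, e2, Lp.coeFn_add (x.1 • D 0 (cosMode k)) (x.2 • D 0 (sinMode k)),
    Lp.coeFn_smul x.1 (D 0 (cosMode k)), Lp.coeFn_smul x.2 (D 0 (sinMode k))] with t h3 h4 h5 h6 h7
  rw [h5, Pi.add_apply, h6, h7, Pi.smul_apply, Pi.smul_apply, h3, h4, smul_eq_mul, smul_eq_mul]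
  ring

/-- The two components of the reduced trilinear form. -/
theorem coef_tri (hk : Odd k) (x y : ℝ × ℝ) : coef k (tri (LL k x) (LL k x) (LL k y)) =
    (4 / Real.pi ^ 2 * (Real.pi / 32 * (3 * x.1 ^ 2 * y.1 + 2 * x.1 * x.2 * y.2 + x.2 ^ 2 * y.1) +
      1 / (8 * k) * (x.1 ^ 2 * y.2 + 2 * x.1 * x.2 * y.1 + x.2 ^ 2 * y.2)),
    4 / Real.pi ^ 2 * (Real.pi / 32 * (x.1 ^ 2 * y.2 + 2 * x.1 * x.2 * y.1 + 3 * x.2 ^ 2 * y.2) +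
      1 / (8 * k) * (x.1 ^ 2 * y.1 + 2 * x.1 * x.2 * y.2 + x.2 ^ 2 * y.1))) := by
  have c1 : Continuous fun t : ℝ => nrm * Real.cos (2 * k * t) := by fun_prop
  have c2 : Continuous fun t : ℝ => nrm * Real.sin (2 * k * t) := by fun_prop
  have e1 : D 0 (cosMode k) = toL2 _ c1 := rfl
  have e2 : D 0 (sinMode k) = toL2 _ c2 := rfl
  have hn : nrm ^ 4 = 4 / Real.pi ^ 2 := by
    rw [show nrm ^ 4 = (nrm * nrm) * (nrm * nrm) by ring, nrm_sq]; field_simp; ring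
  have key : ∀ m : ℝ → ℝ, ∫ t, tri (LL k x) (LL k x) (LL k y) t * (nrm * m t) ∂mu =
      4 / Real.pi ^ 2 * ∫ t in (0 : ℝ)..(Real.pi / 4),
        (x.1 * Real.cos (2 * k * t) + x.2 * Real.sin (2 * k * t)) ^ 2 *
        (y.1 * Real.cos (2 * k * t) + y.2 * Real.sin (2 * k * t)) * m t := by
    intro m
    rw [← integral_weight_mul, ← hn, ← integral_const_mul]
    refine integral_congr_ae ?_
    filter_upwards [tri_coe (LL k x) (LL k x) (LL k y), D0_LL_coe (k := k) x,
      D0_LL_coe (k := k) y] with t h1 h2 h3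
    rw [h1, h2, h3]; ring
  rw [coef_apply, e1, e2, inner_toL2, inner_toL2, key, key, quartic_integral_cos hk,
    quartic_integral_sin hk]

end Integrals

open Filter Topology

/-- The analytic implicit function theorem, with regularity near the base point. -/
theorem exists_implicit {E F F' : Type*} [NormedAddCommGroup E] [NormedSpace ℝ E] [CompleteSpace E]
    [NormedAddCommGroup F] [NormedSpace ℝ F] [CompleteSpace F]
    [NormedAddCommGroup F'] [NormedSpace ℝ F'] [CompleteSpace F']
    {f : E × F → F'} (hf : ContDiff ℝ ω f) {a : E} {b : F} (h0 : f (a, b) = 0) (L : F ≃L[ℝ] F')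
    (hL : HasFDerivAt (fun y => f (a, y)) (L : F →L[ℝ] F') b) :
    ∃ φ : E → F, φ a = b ∧ (∀ᶠ p in 𝓝 a, ContDiffAt ℝ ω φ p) ∧
      (∀ᶠ p in 𝓝 a, f (p, φ p) = 0) ∧ ∀ᶠ q in 𝓝 (a, b), f q = 0 → q.2 = φ q.1 := by
  have cdf : ContDiffAt ℝ ω f (a, b) := hf.contDiffAt
  have hne : (ω : WithTop ℕ∞) ≠ 0 := by simp
  have hd : HasFDerivAt f (fderiv ℝ f (a, b)) (a, b) := (cdf.differentiableAt hne).hasFDerivAt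
  have e : fderiv ℝ f (a, b) ∘L .inr ℝ E F = (L : F →L[ℝ] F') :=
    (hd.comp b (hasFDerivAt_prodMk_right a b)).unique hL
  have if₂ : (fderiv ℝ f (a, b) ∘L .inr ℝ E F).IsInvertible := ⟨L, e.symm⟩
  refine ⟨cdf.implicitFunction hne if₂, cdf.implicitFunction_apply_self hne if₂,
    (cdf.contDiffAt_implicitFunction hne if₂).eventually (by simp), ?_, ?_⟩
  · simpa only [h0] using cdf.eventually_apply_implicitFunction hne if₂
  · filter_upwards [cdf.eventually_apply_eq_iff_implicitFunction hne if₂] with q hq hq0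
    rw [h0] at hq
    exact (hq.1 hq0).symm

section Red

variable {k : ℕ}

theorem F_eq (lam : ℝ) (u : H2) : F (lam, u) = A k u + (lam - sigma k) • D 0 u + cubic u := by
  rw [F, A_apply, sub_smul]; abel

theorem S_F (hk : 0 < k) (lam : ℝ) (x : ℝ × ℝ) (y : Yk k) :
    S hk (F (lam, LL k x + (y : H2))) =
      y + S hk ((lam - sigma k) • D 0 (y : H2) + cubic (LL k x + (y : H2))) := by
  rw [F_eq (k := k), map_add (A k), A_LL, zero_add, D_add, smul_add]
  simp only [map_add, map_smul, S_A, S_LL, smul_zero, zero_add, add_assoc]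

theorem coef_F (hk : 0 < k) (lam : ℝ) (x : ℝ × ℝ) (y : Yk k) :
    coef k (F (lam, LL k x + (y : H2))) =
      (lam - sigma k) • x + coef k (cubic (LL k x + (y : H2))) := by
  rw [F_eq (k := k), D_add]
  simp only [map_add, map_smul, coef_A, coef_LL hk, coef_Y hk, add_zero, zero_add]

theorem G_eq_zero_iff (hk : 0 < k) (lam : ℝ) (n : nullS k) (y : Yk k) :
    G k lam n y = 0 ↔ S hk (F (lam, (n : H2) + (y : H2))) = 0 :=
  (S_eq_zero_iff hk _).symm

theorem continuous_Lmap (k : ℕ) : Continuous (Lmap k) :=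
  Continuous.subtype_mk (LL k).continuous fun x => LL_mem x

theorem tri_zero (h : H2) : tri 0 0 h = 0 := by
  rw [tri, map_zero, zero_apply, map_zero]

theorem dcubic_zero : dcubic 0 = 0 := by
  ext1 h
  rw [dcubic_apply, tri_zero, smul_zero]; rfl

/-- The auxiliary equation solved for `y`. -/
def auxEq (hk : 0 < k) (q : (ℝ × nullS k) × Yk k) : Yk k :=
  q.2 + S hk ((q.1.1 - sigma k) • DL 0 (q.2 : H2) + cubic ((q.1.2 : H2) + (q.2 : H2)))

theorem auxEq_eq (hk : 0 < k) (lam : ℝ) (n : nullS k) (y : Yk k) :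
    auxEq hk ((lam, n), y) = S hk (F (lam, (n : H2) + (y : H2))) := by
  obtain ⟨x, hx⟩ := exists_of_mem_nullS hk n.2
  rw [hx, S_F, ← hx]; rfl

theorem contDiff_coe (W : Submodule ℝ H2) : ContDiff ℝ ω (fun y : W => (y : H2)) :=
  ContinuousLinearMap.contDiff (𝕜 := ℝ) (E := W) (F := H2) W.subtypeL

theorem contDiff_auxEq (hk : 0 < k) : ContDiff ℝ ω (auxEq hk) := by
  have h1 : ContDiff ℝ ω fun q : (ℝ × nullS k) × Yk k => (q.2 : H2) :=
    (contDiff_coe _).comp contDiff_snd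
  have h2 : ContDiff ℝ ω fun q : (ℝ × nullS k) × Yk k => (q.1.2 : H2) :=
    (contDiff_coe _).comp (contDiff_snd.comp contDiff_fst)
  have h3 : ContDiff ℝ ω fun q : (ℝ × nullS k) × Yk k => q.1.1 - sigma k :=
    (contDiff_fst.comp contDiff_fst).sub contDiff_const
  exact contDiff_snd.add ((S hk).contDiff.comp
    ((h3.smul ((DL 0).contDiff.comp h1)).add (contDiff_cubic.comp (h2.add h1))))

instance instCompleteSpaceNullS (k : ℕ) : CompleteSpace (nullS k) := by
  have : IsClosed (nullS k : Set H2) := (A k).isClosed_ker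
  exact this.completeSpace_coe

theorem hasFDerivAt_auxEq (hk : 0 < k) :
    HasFDerivAt (fun y => auxEq hk ((sigma k, 0), y))
      ((ContinuousLinearEquiv.refl ℝ (Yk k) : Yk k ≃L[ℝ] Yk k) : Yk k →L[ℝ] Yk k) 0 := by
  have e : (fun y => auxEq hk ((sigma k, 0), y)) = fun y : Yk k => y + S hk (cubic (y : H2)) := by
    ext1 y
    simp only [auxEq, sub_self, zero_smul, zero_add, Submodule.coe_zero]
  have h1 : HasFDerivAt (fun y : Yk k => cubic (y : H2)) (dcubic 0 ∘L ((nullS k)ᗮ).subtypeL) 0 :=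
    HasFDerivAt.comp (0 : Yk k) (f := fun y : Yk k => (y : H2)) (hasFDerivAt_cubic 0)
      ((nullS k)ᗮ).subtypeL.hasFDerivAt
  rw [e]
  refine ((hasFDerivAt_id 0).add ((S hk).hasFDerivAt.comp 0 h1)).congr_fderiv ?_
  rw [dcubic_zero]
  ext1 y
  simp

theorem exists_reduction (hk : 0 < k) : Nonempty (Reduction k) := by
  have h0 : auxEq hk ((sigma k, 0), 0) = 0 := by
    simp [auxEq, cubic_zero]
  obtain ⟨φ, hφ0, hφs, hφz, hφu⟩ := exists_implicit (contDiff_auxEq hk) h0 _ (hasFDerivAt_auxEq hk)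
  rw [nhds_prod_eq] at hφu
  obtain ⟨p1, hp1, p2, hp2, hpu⟩ := eventually_prod_iff.1 hφu
  obtain ⟨r, hr, hr2⟩ := Metric.eventually_nhds_iff.1 hp2
  have hcont : ContinuousAt φ (sigma k, 0) := hφs.self_of_nhds.continuousAt
  have hsmall : ∀ᶠ p in 𝓝 (sigma k, (0 : nullS k)), ‖φ p‖ < r := by
    have : Tendsto (fun p => ‖φ p‖) (𝓝 (sigma k, (0 : nullS k))) (𝓝 ‖φ (sigma k, 0)‖) :=
      hcont.norm
    rw [hφ0, norm_zero] at this
    exact this.eventually (gt_mem_nhds hr)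
  have hall := ((hφs.and hφz).and (hp1.and hsmall))
  obtain ⟨I, hI, hIs, N, hN, hNs, hIN⟩ :
      ∃ I : Set ℝ, IsOpen I ∧ sigma k ∈ I ∧ ∃ N : Set (nullS k), IsOpen N ∧ 0 ∈ N ∧
        ∀ p ∈ I ×ˢ N, (ContDiffAt ℝ ω φ p ∧ auxEq hk (p, φ p) = 0) ∧ p1 p ∧ ‖φ p‖ < r := by
    obtain ⟨I, N, hI, hIs, hN, hNs, h⟩ := mem_nhds_prod_iff'.1 hall
    exact ⟨I, hI, hIs, N, hN, hNs, fun p hp => h hp⟩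
  have hdec : ∀ (n : nullS k) (y : Yk k),
      Lmap k (coef k (D 0 ((n : H2) + (y : H2)))) = n := fun n y => by
    rw [D_add, map_add, coef_Y hk, add_zero, ← eq_Lmap hk]
  have hdec2 : ∀ (n : nullS k) (y : Yk k),
      (n : H2) + (y : H2) - LL k (coef k (D 0 ((n : H2) + (y : H2)))) = y := fun n y => by
    rw [← coe_Lmap, hdec]; abel
  have hcD : Continuous fun u : H2 => coef k (D 0 u) := ((coef k).comp (DL 0)).continuous
  refine ⟨{
    I := I
    N := N
    O := {q | (q.1 ∈ I ∧ Lmap k (coef k (D 0 q.2)) ∈ N) ∧ ‖q.2 - LL k (coef k (D 0 q.2))‖ < r}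
    psi := φ
    isOpen_I := hI
    isOpen_N := hN
    isOpen_O := ?_
    sigma_mem := hIs
    zero_mem := hNs
    base_mem := ?_
    smooth := ?_
    psi_base := hφ0
    solves := ?_
    graph_mem := ?_
    proj_mem := ?_
    unique := ?_ }⟩
  · refine (((hI.preimage continuous_fst).inter (hN.preimage
      ((continuous_Lmap k).comp (hcD.comp continuous_snd)))).inter ?_)
    exact isOpen_lt (continuous_snd.sub ((LL k).continuous.comp (hcD.comp continuous_snd))).norm
      continuous_const
  · have h1 := hdec 0 0
    have h2 := hdec2 0 0
    simp only [Submodule.coe_zero, add_zero] at h1 h2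
    refine ⟨⟨hIs, ?_⟩, ?_⟩
    · rw [h1]; exact hNs
    · rw [h2, norm_zero]; exact hr
  · exact fun p hp => ((hIN p hp).1.1.of_le (by simp)).contDiffWithinAt
  · intro lam hl n hn
    rw [G_eq_zero_iff hk, ← auxEq_eq]
    exact (hIN (lam, n) ⟨hl, hn⟩).1.2
  · intro lam hl n hn
    refine ⟨⟨hl, ?_⟩, ?_⟩
    · rw [hdec]; exact hn
    · rw [hdec2]; exact (hIN (lam, n) ⟨hl, hn⟩).2.2
  · rintro lam n y ⟨⟨h1, h2⟩, -⟩
    rw [hdec] at h2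
    exact ⟨h1, h2⟩
  · rintro lam n y ⟨⟨h1, h2⟩, h3⟩ hG
    rw [hdec] at h2
    rw [hdec2] at h3
    rw [G_eq_zero_iff hk, ← auxEq_eq] at hG
    exact hpu (hIN (lam, n) ⟨h1, h2⟩).2.1 (hr2 (by rw [dist_zero_right]; exact h3)) hG

theorem Reduction.H_eq (hk : 0 < k) (R : Reduction k) (p : ℝ × ℝ × ℝ) :
    R.H p = coef k (F (R.Psi p)) := by
  have : R.H p = coef k (Q k (F (R.Psi p))) := (coef_apply _).symm
  rw [this, Q_eq, coef_LL hk]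

theorem Reduction.F_Psi_eq_zero (hk : 0 < k) (R : Reduction k) {p : ℝ × ℝ × ℝ} (hp : p ∈ R.zeroH) :
    F (R.Psi p) = 0 := by
  obtain ⟨h1, h2, h3⟩ := hp
  rw [eq_zero_iff hk]
  refine ⟨?_, ?_⟩
  · exact (G_eq_zero_iff hk _ _ _).1 (R.solves _ h1 _ h2)
  · rw [← R.H_eq hk, h3]

theorem Reduction.continuousOn_Psi (R : Reduction k) :
    ContinuousOn R.Psi {p | p.1 ∈ R.I ∧ Lmap k p.2 ∈ R.N} := by
  have h1 : ContinuousOn (fun p : ℝ × ℝ × ℝ => R.psi (p.1, Lmap k p.2))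
      {p | p.1 ∈ R.I ∧ Lmap k p.2 ∈ R.N} :=
    R.smooth.continuousOn.comp
      (continuous_fst.prodMk ((continuous_Lmap k).comp continuous_snd)).continuousOn fun p hp => hp
  exact continuousOn_fst.prodMk (((LL k).continuous.comp continuous_snd).continuousOn.add
    (continuous_subtype_val.comp_continuousOn h1))

/-- In the neighbourhood of the reduction, solutions of the auxiliary equation lie on the graph. -/
theorem Reduction.eq_Psi (hk : 0 < k) (R : Reduction k) {lam : ℝ} {x : ℝ × ℝ} {y : Yk k}
    (hO : (lam, LL k x + (y : H2)) ∈ R.O) (hS : S hk (F (lam, LL k x + (y : H2))) = 0) :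
    lam ∈ R.I ∧ Lmap k x ∈ R.N ∧ R.Psi (lam, x) = (lam, LL k x + (y : H2)) := by
  obtain ⟨h1, h2⟩ := R.proj_mem lam (Lmap k x) y hO
  refine ⟨h1, h2, ?_⟩
  have := R.unique lam (Lmap k x) y hO ((G_eq_zero_iff hk _ _ _).2 hS)
  rw [Reduction.Psi, ← this]; rfl

theorem decomp (hk : 0 < k) (u : H2) : ∃ y : Yk k, u = LL k (coef k (D 0 u)) + (y : H2) :=
  ⟨⟨_, sub_mem_orthogonal hk u⟩, (add_sub_cancel _ _).symm⟩

theorem Reduction.exists_homeomorph (hk : 0 < k) (R : Reduction k) :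
    ∃ e : R.zeroH ≃ₜ R.zeroF, (∀ p : R.zeroH, (e p : ℝ × H2) = R.Psi p) ∧
      ∀ q : R.zeroF, ((e.symm q : ℝ × ℝ × ℝ).1 = (q : ℝ × H2).1) ∧
        (Lmap k (e.symm q : ℝ × ℝ × ℝ).2 : H2) = P k (q : ℝ × H2).2 := by
  have hinv : ∀ q ∈ R.zeroF, (q.1, coef k (D 0 q.2)) ∈ R.zeroH ∧
      R.Psi (q.1, coef k (D 0 q.2)) = q := by
    rintro ⟨lam, u⟩ ⟨hO, hF⟩
    obtain ⟨y, hy⟩ := decomp hk u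
    dsimp only
    rw [hy] at hO hF
    obtain ⟨h1, h2, h3⟩ := R.eq_Psi hk hO (by rw [hF, map_zero])
    rw [← hy] at h3
    refine ⟨⟨h1, h2, ?_⟩, h3⟩
    rw [R.H_eq hk, h3, hy, hF, map_zero]
  have hcoef : ∀ p : ℝ × ℝ × ℝ, coef k (D 0 (R.Psi p).2) = p.2 := fun p => by
    rw [Reduction.Psi, coe_Lmap, D_add, map_add, coef_LL hk, coef_Y hk, add_zero]
  refine ⟨{
    toFun := fun p => ⟨R.Psi p, R.graph_mem _ p.2.1 _ p.2.2.1, R.F_Psi_eq_zero hk p.2⟩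
    invFun := fun q => ⟨((q : ℝ × H2).1, coef k (D 0 (q : ℝ × H2).2)), (hinv q q.2).1⟩
    left_inv := fun p => Subtype.ext (Prod.ext rfl (hcoef p))
    right_inv := fun q => Subtype.ext (hinv q q.2).2
    continuous_toFun := ?_
    continuous_invFun := ?_ }, fun p => rfl, fun q => ⟨rfl, ?_⟩⟩
  · refine Continuous.subtype_mk ?_ _
    exact (R.continuousOn_Psi.mono (fun p hp => ⟨hp.1, hp.2.1⟩)).domRestrict
  · refine Continuous.subtype_mk ?_ _
    exact (continuous_fst.comp continuous_subtype_val).prodMk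
      (((coef k).comp (DL 0)).continuous.comp (continuous_snd.comp continuous_subtype_val))
  · rw [P_eq]; rfl

end Red

theorem reduced_eq_cases {κ t g z w : ℝ} (hκ : 0 < κ) (hg : 0 < g)
    (h1 : κ * (t * (3 * z ^ 2 * z + 2 * z * w * w + w ^ 2 * z) +
      g * (z ^ 2 * w + 2 * z * w * z + w ^ 2 * w)) = z)
    (h2 : κ * (t * (z ^ 2 * w + 2 * z * w * z + 3 * w ^ 2 * w) +
      g * (z ^ 2 * z + 2 * z * w * w + w ^ 2 * z)) = w) (h0 : (z, w) ≠ (0, 0)) :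
    (w = z ∧ κ * (6 * t + 4 * g) * z ^ 2 = 1) ∨ (w = -z ∧ κ * (6 * t - 4 * g) * z ^ 2 = 1) := by
  have h3 : κ * g * ((w ^ 2 + z ^ 2) * ((w - z) * (w + z))) = 0 := by
    linear_combination w * h1 - z * h2
  have hpos : w ^ 2 + z ^ 2 ≠ 0 := by
    intro h
    have hz : z = 0 := by nlinarith [sq_nonneg w, sq_nonneg z]
    have hw : w = 0 := by nlinarith [sq_nonneg w, sq_nonneg z]
    exact h0 (by rw [hz, hw])
  have hz0 : ∀ {s : ℝ}, w = s * z → z ≠ 0 := by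
    rintro s hs rfl
    exact h0 (by rw [hs, mul_zero])
  rcases mul_eq_zero.1 ((mul_eq_zero.1 ((mul_eq_zero.1 h3).resolve_left (by positivity))).resolve_left
    hpos) with h | h
  · left
    have hw : w = z := by linarith
    refine ⟨hw, ?_⟩
    have hz := hz0 (s := 1) (by linarith)
    rw [hw] at h1
    refine mul_right_cancel₀ hz ?_
    linear_combination h1
  · right
    have hw : w = -z := by linarith
    refine ⟨hw, ?_⟩
    have hz := hz0 (s := -1) (by linarith)
    rw [hw] at h1
    refine mul_right_cancel₀ hz ?_
    linear_combination h1

theorem reduced_nondegenerate_pos {κ t g z h j : ℝ} (hκ : 0 < κ) (hg : 0 < g) (hz : z ≠ 0)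
    (hr : κ * (6 * t + 4 * g) * z ^ 2 = 1)
    (h1 : h = 3 * (κ * (t * (3 * z ^ 2 * h + 2 * z * z * j + z ^ 2 * h) +
      g * (z ^ 2 * j + 2 * z * z * h + z ^ 2 * j))))
    (h2 : j = 3 * (κ * (t * (z ^ 2 * j + 2 * z * z * h + 3 * z ^ 2 * j) +
      g * (z ^ 2 * h + 2 * z * z * j + z ^ 2 * h)))) : h = 0 ∧ j = 0 := by
  have hs : h + j = 0 := by linear_combination (-1 / 2) * h1 + (-1 / 2) * h2 - (3 / 2) * (h + j) * hr
  have hd : κ * g * z ^ 2 * (h - j) = 0 := by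
    linear_combination (1 / 4) * h1 - (1 / 4) * h2 + (1 / 4) * (h - j) * hr
  have hd' := (mul_eq_zero.1 hd).resolve_left (by positivity)
  constructor <;> linarith

theorem reduced_nondegenerate_neg {κ t g z h j : ℝ} (hκ : 0 < κ) (hg : 0 < g) (hz : z ≠ 0)
    (hr : κ * (6 * t - 4 * g) * z ^ 2 = 1)
    (h1 : h = 3 * (κ * (t * (3 * z ^ 2 * h + 2 * z * (-z) * j + (-z) ^ 2 * h) +
      g * (z ^ 2 * j + 2 * z * (-z) * h + (-z) ^ 2 * j))))
    (h2 : j = 3 * (κ * (t * (z ^ 2 * j + 2 * z * (-z) * h + 3 * (-z) ^ 2 * j) +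
      g * (z ^ 2 * h + 2 * z * (-z) * j + (-z) ^ 2 * h)))) : h = 0 ∧ j = 0 := by
  have hs : h - j = 0 := by linear_combination (-1 / 2) * h1 - (-1 / 2) * h2 - (3 / 2) * (h - j) * hr
  have hd : κ * g * z ^ 2 * (h + j) = 0 := by
    linear_combination (-1 / 4) * h1 - (1 / 4) * h2 - (1 / 4) * (h + j) * hr
  have hd' := (mul_eq_zero.1 hd).resolve_left (by positivity)
  constructor <;> linarith

section Roots

/-- The reduced cubic map of the plane. -/
def redMap (k : ℕ) (x : ℝ × ℝ) : ℝ × ℝ := coef k (cubic (LL k x))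

/-- The amplitude of the branches on the diagonal. -/
def ampPos (k : ℕ) : ℝ := 2 * √(k : ℝ) * Real.pi / √(3 * k * Real.pi + 8)

/-- The amplitude of the branches on the antidiagonal. -/
def ampNeg (k : ℕ) : ℝ := 2 * √(k : ℝ) * Real.pi / √(3 * k * Real.pi - 8)

/-- The four nonzero fixed points of the reduced cubic map. -/
def root (k : ℕ) : Fin 4 → ℝ × ℝ :=
  ![(ampPos k, ampPos k), (-ampPos k, -ampPos k), (ampNeg k, -ampNeg k), (-ampNeg k, ampNeg k)]

variable {k : ℕ}

theorem denom_pos (hk : 0 < k) : 0 < 3 * (k : ℝ) * Real.pi - 8 := by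
  have : (1 : ℝ) ≤ k := by exact_mod_cast hk
  nlinarith [Real.pi_gt_three]

theorem ampPos_pos (hk : 0 < k) : 0 < ampPos k := by
  have := denom_pos hk
  have : (0 : ℝ) < k := by exact_mod_cast hk
  unfold ampPos; positivity

theorem ampNeg_pos (hk : 0 < k) : 0 < ampNeg k := by
  have := denom_pos hk
  have : (0 : ℝ) < k := by exact_mod_cast hk
  have := Real.pi_pos
  have := Real.sqrt_pos.2 (denom_pos hk)
  unfold ampNeg; positivity

theorem ampPos_eq (hk : 0 < k) :
    4 / Real.pi ^ 2 * (6 * (Real.pi / 32) + 4 * (1 / (8 * k))) * ampPos k ^ 2 = 1 := by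
  have hk' : (0 : ℝ) < k := by exact_mod_cast hk
  have h1 : √(3 * (k : ℝ) * Real.pi + 8) ^ 2 = 3 * k * Real.pi + 8 :=
    Real.sq_sqrt (by positivity)
  have h2 : √(k : ℝ) ^ 2 = k := Real.sq_sqrt hk'.le
  have h3 : 3 * (k : ℝ) * Real.pi + 8 ≠ 0 := by positivity
  have := Real.pi_ne_zero
  rw [ampPos, div_pow, h1, mul_pow, mul_pow, h2]
  field_simp
  ring

theorem ampNeg_eq (hk : 0 < k) :
    4 / Real.pi ^ 2 * (6 * (Real.pi / 32) - 4 * (1 / (8 * k))) * ampNeg k ^ 2 = 1 := by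
  have hk' : (0 : ℝ) < k := by exact_mod_cast hk
  have h1 : √(3 * (k : ℝ) * Real.pi - 8) ^ 2 = 3 * k * Real.pi - 8 :=
    Real.sq_sqrt (denom_pos hk).le
  have h2 : √(k : ℝ) ^ 2 = k := Real.sq_sqrt hk'.le
  have h3 : 3 * (k : ℝ) * Real.pi - 8 ≠ 0 := (denom_pos hk).ne'
  have := Real.pi_ne_zero
  have h4 : 4 / Real.pi ^ 2 * (6 * (Real.pi / 32) - 4 * (1 / (8 * k))) * (2 ^ 2 * k * Real.pi ^ 2) =
      3 * (k : ℝ) * Real.pi - 8 := by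
    field_simp
    ring
  rw [ampNeg, div_pow, h1, mul_pow, mul_pow, h2, ← mul_div_assoc, h4, div_self h3]

theorem redMap_eq (x : ℝ × ℝ) : redMap k x = coef k (tri (LL k x) (LL k x) (LL k x)) := by
  rw [redMap, cubic_eq_tri]

theorem redMap_root (hk : Odd k) (i : Fin 4) : redMap k (root k i) = root k i := by
  have h1 := ampPos_eq hk.pos
  have h2 := ampNeg_eq hk.pos
  rw [redMap_eq, coef_tri hk]
  fin_cases i <;> refine Prod.ext ?_ ?_ <;> simp only [root] <;> dsimp
  · linear_combination (ampPos k) * h1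
  · linear_combination (ampPos k) * h1
  · linear_combination (-ampPos k) * h1
  · linear_combination (-ampPos k) * h1
  · linear_combination (ampNeg k) * h2
  · linear_combination (-ampNeg k) * h2
  · linear_combination (-ampNeg k) * h2
  · linear_combination (ampNeg k) * h2

theorem eq_root_of_redMap (hk : Odd k) {x : ℝ × ℝ} (hx : x ≠ 0) (h : redMap k x = x) :
    ∃ i, x = root k i := by
  have hk' : (0 : ℝ) < k := by exact_mod_cast hk.pos
  obtain ⟨z, w⟩ := x
  rw [redMap_eq, coef_tri hk, Prod.mk.injEq] at h
  have hpi := Real.pi_pos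
  have sq : ∀ {c a b : ℝ}, c * a ^ 2 = 1 → c * b ^ 2 = 1 → a = b ∨ a = -b := by
    intro c a b ha hb
    have hc : c ≠ 0 := by rintro rfl; simp at ha
    exact sq_eq_sq_iff_eq_or_eq_neg.1 (mul_left_cancel₀ hc (ha.trans hb.symm))
  rcases reduced_eq_cases (z := z) (w := w) (by positivity) (by positivity) h.1 h.2 hx with ⟨rfl, h1⟩ | ⟨rfl, h1⟩
  · rcases sq h1 (ampPos_eq hk.pos) with h2 | h2
    · exact ⟨0, by rw [h2]; rfl⟩
    · exact ⟨1, by rw [h2]; rfl⟩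
  · rcases sq h1 (ampNeg_eq hk.pos) with h2 | h2
    · exact ⟨2, by rw [h2]; rfl⟩
    · exact ⟨3, by rw [h2, neg_neg]; rfl⟩

theorem root_nondegenerate (hk : Odd k) (i : Fin 4) {y : ℝ × ℝ}
    (h : y = coef k (dcubic (LL k (root k i)) (LL k y))) : y = 0 := by
  have hk' : (0 : ℝ) < k := by exact_mod_cast hk.pos
  have hpi := Real.pi_pos
  have a1 := (ampPos_pos hk.pos).ne'
  have a2 := (ampNeg_pos hk.pos).ne'
  have e1 := ampPos_eq hk.pos
  have e2 := ampNeg_eq hk.pos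
  have hκ : 0 < 4 / Real.pi ^ 2 := by positivity
  have hg : 0 < 1 / (8 * (k : ℝ)) := by positivity
  obtain ⟨h1, h2⟩ := Prod.ext_iff.1 h
  rw [dcubic_apply, map_smul, coef_tri hk] at h1 h2
  suffices y.1 = 0 ∧ y.2 = 0 from Prod.ext this.1 this.2
  fin_cases i
  · exact reduced_nondegenerate_pos hκ hg a1 e1 h1 h2
  · exact reduced_nondegenerate_pos hκ hg (neg_ne_zero.2 a1) (by rwa [neg_sq]) h1 h2
  · exact reduced_nondegenerate_neg hκ hg a2 e2 h1 h2
  · refine reduced_nondegenerate_neg (z := -ampNeg k) hκ hg (neg_ne_zero.2 a2) (by rwa [neg_sq]) ?_ ?_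
    · rw [neg_neg]; exact h1
    · rw [neg_neg]; exact h2

theorem root_ne_zero (hk : 0 < k) (i : Fin 4) : root k i ≠ 0 := by
  have a1 := (ampPos_pos hk).ne'
  have a2 := (ampNeg_pos hk).ne'
  fin_cases i <;> simp [root, a1, a2]

theorem root_injective (hk : 0 < k) : Function.Injective (root k) := by
  have a1 := ampPos_pos hk
  have a2 := ampNeg_pos hk
  intro i j h
  fin_cases i <;> fin_cases j <;> simp only [root] at h ⊢ <;> simp at h ⊢ <;> grind

/-- The reduced cubic map is coercive. -/
theorem redMap_pos (hk : Odd k) {x : ℝ × ℝ} (hx : x ≠ 0) :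
    0 < x.1 * (redMap k x).1 + x.2 * (redMap k x).2 := by
  have hk' : (1 : ℝ) ≤ k := by exact_mod_cast hk.pos
  have hpi := Real.pi_gt_three
  obtain ⟨z, w⟩ := x
  rw [redMap_eq, coef_tri hk]
  have hs : 0 < z ^ 2 + w ^ 2 := by
    by_contra hcon
    have hz : z = 0 := by nlinarith [sq_nonneg w, sq_nonneg z]
    have hw : w = 0 := by nlinarith [sq_nonneg w, sq_nonneg z]
    exact hx (by rw [hz, hw]; rfl)
  have hg : 1 / (8 * (k : ℝ)) ≤ 1 / 8 := by
    apply one_div_le_one_div_of_le <;> linarith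
  have hg0 : 0 < 1 / (8 * (k : ℝ)) := by positivity
  generalize 1 / (8 * (k : ℝ)) = g at hg hg0
  have key : 0 < 3 * (Real.pi / 32) * (z ^ 2 + w ^ 2) + 4 * g * (z * w) := by
    have h1 : -(z ^ 2 + w ^ 2) ≤ 2 * (z * w) := by nlinarith [sq_nonneg (z + w)]
    nlinarith
  have hfin : 0 < 4 / Real.pi ^ 2 * ((z ^ 2 + w ^ 2) *
      (3 * (Real.pi / 32) * (z ^ 2 + w ^ 2) + 4 * g * (z * w))) := by positivity
  refine hfin.trans_eq ?_
  dsimp only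
  ring

end Roots

section Branch

variable {k : ℕ}

/-- The system obtained from `𝔉(σ_k - μ, √μ v) = 0` after division by the powers of `√μ`,
for `v = x₁ φ_k + x₂ ϕ_k + y`. -/
def scaledEq (hk : 0 < k) (q : ℝ × (Yk k × (ℝ × ℝ))) : Yk k × (ℝ × ℝ) :=
  (q.2.1 + q.1 • S hk (cubic (LL k q.2.2 + (q.2.1 : H2)) - DL 0 (q.2.1 : H2)),
    q.2.2 - coef k (cubic (LL k q.2.2 + (q.2.1 : H2))))

theorem contDiff_scaledEq (hk : 0 < k) : ContDiff ℝ ω (scaledEq hk) := by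
  have h1 : ContDiff ℝ ω fun q : ℝ × (Yk k × (ℝ × ℝ)) => (q.2.1 : H2) :=
    (contDiff_coe _).comp (contDiff_fst.comp contDiff_snd)
  have h2 : ContDiff ℝ ω fun q : ℝ × (Yk k × (ℝ × ℝ)) => LL k q.2.2 :=
    (LL k).contDiff.comp (contDiff_snd.comp contDiff_snd)
  have h3 := contDiff_cubic.comp (h2.add h1)
  exact ((contDiff_fst.comp contDiff_snd).add (contDiff_fst.smul ((S hk).contDiff.comp
    (h3.sub ((DL 0).contDiff.comp h1))))).prodMk
    ((contDiff_snd.comp contDiff_snd).sub ((coef k).contDiff.comp h3))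

theorem F_scaled (hk : 0 < k) {μ : ℝ} (hμ : 0 ≤ μ) (q : Yk k × (ℝ × ℝ)) :
    S hk (F (sigma k - μ, √μ • (LL k q.2 + (q.1 : H2)))) = √μ • (scaledEq hk (μ, q)).1 ∧
      coef k (F (sigma k - μ, √μ • (LL k q.2 + (q.1 : H2)))) =
        -(√μ * μ) • (scaledEq hk (μ, q)).2 := by
  have e : √μ • (LL k q.2 + (q.1 : H2)) = LL k (√μ • q.2) + ((√μ • q.1 : Yk k) : H2) := by
    rw [smul_add, map_smul]; rfl
  have h3 : √μ ^ 3 = √μ * μ := by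
    rw [pow_succ', sq, Real.mul_self_sqrt hμ]
  have e2 : cubic (LL k (√μ • q.2) + ((√μ • q.1 : Yk k) : H2)) =
      (√μ * μ) • cubic (LL k q.2 + (q.1 : H2)) := by
    rw [← e, cubic_smul, h3]
  have e3 : D 0 ((√μ • q.1 : Yk k) : H2) = √μ • DL 0 (q.1 : H2) := rfl
  constructor
  · rw [e, S_F hk, e2, e3, scaledEq]
    simp only [map_add, map_sub, map_smul]
    module
  · rw [e, coef_F hk, e2, scaledEq]
    simp only [map_smul]
    module

theorem F_scaled_eq_zero_iff (hk : 0 < k) {μ : ℝ} (hμ : 0 < μ) (q : Yk k × (ℝ × ℝ)) :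
    F (sigma k - μ, √μ • (LL k q.2 + (q.1 : H2))) = 0 ↔ scaledEq hk (μ, q) = 0 := by
  obtain ⟨h1, h2⟩ := F_scaled hk hμ.le q
  have hs : √μ ≠ 0 := (Real.sqrt_pos.2 hμ).ne'
  rw [eq_zero_iff hk, h1, h2, smul_eq_zero_iff_right hs,
    smul_eq_zero_iff_right (neg_ne_zero.2 (mul_ne_zero hs hμ.ne'))]
  exact ⟨fun h => Prod.ext h.1 h.2, fun h => by rw [h]; exact ⟨rfl, rfl⟩⟩

/-- The derivative of the scaled system in `(y, x)` at `μ = 0`. -/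
def dscaled (k : ℕ) (i : Fin 4) : Yk k × (ℝ × ℝ) →L[ℝ] Yk k × (ℝ × ℝ) :=
  (ContinuousLinearMap.fst ℝ (Yk k) (ℝ × ℝ)).prod
    (ContinuousLinearMap.snd ℝ (Yk k) (ℝ × ℝ) - (coef k).comp ((dcubic (LL k (root k i))).comp
      ((LL k).comp (ContinuousLinearMap.snd ℝ (Yk k) (ℝ × ℝ)) +
        ((nullS k)ᗮ).subtypeL.comp (ContinuousLinearMap.fst ℝ (Yk k) (ℝ × ℝ)))))

theorem dscaled_apply (i : Fin 4) (q : Yk k × (ℝ × ℝ)) : dscaled k i q =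
    (q.1, q.2 - coef k (dcubic (LL k (root k i)) (LL k q.2 + (q.1 : H2)))) := rfl

theorem dscaled_ker (hk : Odd k) (i : Fin 4) : (dscaled k i).ker = ⊥ := by
  rw [LinearMap.ker_eq_bot']
  intro q hq
  have hq' : dscaled k i q = 0 := hq
  rw [dscaled_apply, Prod.mk_eq_zero] at hq'
  obtain ⟨h1, h2⟩ := hq'
  rw [h1, Submodule.coe_zero, add_zero, sub_eq_zero] at h2
  exact Prod.ext h1 (root_nondegenerate hk i h2)

theorem dscaled_range (hk : Odd k) (i : Fin 4) : (dscaled k i).range = ⊤ := by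
  rw [LinearMap.range_eq_top]
  let M : ℝ × ℝ →ₗ[ℝ] ℝ × ℝ :=
    ((ContinuousLinearMap.id ℝ (ℝ × ℝ) - (coef k).comp ((dcubic (LL k (root k i))).comp (LL k)) :
      ℝ × ℝ →L[ℝ] ℝ × ℝ) : ℝ × ℝ →ₗ[ℝ] ℝ × ℝ)
  have hM : ∀ y, M y = y - coef k (dcubic (LL k (root k i)) (LL k y)) := fun y => rfl
  have hinj : Function.Injective M := by
    rw [injective_iff_map_eq_zero]
    intro y hy
    rw [hM, sub_eq_zero] at hy
    exact root_nondegenerate hk i hy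
  intro q
  obtain ⟨x, hx⟩ := LinearMap.injective_iff_surjective.1 hinj
    (q.2 + coef k (dcubic (LL k (root k i)) (q.1 : H2)))
  rw [hM] at hx
  refine ⟨(q.1, x), ?_⟩
  change dscaled k i (q.1, x) = q
  rw [dscaled_apply]
  refine Prod.ext rfl ?_
  dsimp only
  rw [map_add, map_add, ← sub_sub, hx, add_sub_cancel_right]

/-- The derivative of the scaled system as an isomorphism. -/
def dscaledE (hk : Odd k) (i : Fin 4) : (Yk k × (ℝ × ℝ)) ≃L[ℝ] (Yk k × (ℝ × ℝ)) :=
  ContinuousLinearEquiv.ofBijective (dscaled k i) (dscaled_ker hk i) (dscaled_range hk i)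

theorem hasFDerivAt_scaledEq (hk : Odd k) (i : Fin 4) :
    HasFDerivAt (fun q => scaledEq hk.pos (0, q))
      (dscaledE hk i : Yk k × (ℝ × ℝ) →L[ℝ] Yk k × (ℝ × ℝ)) (0, root k i) := by
  have e : (fun q => scaledEq hk.pos (0, q)) =
      fun q : Yk k × (ℝ × ℝ) => (q.1, q.2 - coef k (cubic (LL k q.2 + (q.1 : H2)))) := by
    ext1 q
    rw [scaledEq]
    simp only [zero_smul, add_zero]
  let B : Yk k × (ℝ × ℝ) →L[ℝ] H2 := (LL k).comp (ContinuousLinearMap.snd ℝ (Yk k) (ℝ × ℝ)) +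
        ((nullS k)ᗮ).subtypeL.comp (ContinuousLinearMap.fst ℝ (Yk k) (ℝ × ℝ))
  have hB : B (0, root k i) = LL k (root k i) := by
    change LL k (root k i) + ((0 : Yk k) : H2) = _
    rw [Submodule.coe_zero, add_zero]
  have h1 : HasFDerivAt (fun q => cubic (B q)) ((dcubic (LL k (root k i))).comp B) (0, root k i) := by
    have hc : HasFDerivAt cubic (dcubic (LL k (root k i))) (B (0, root k i)) := by
      rw [hB]; exact hasFDerivAt_cubic _
    exact hc.comp (0, root k i) B.hasFDerivAt
  rw [e]
  exact (hasFDerivAt_fst (𝕜 := ℝ) (E := Yk k) (F := ℝ × ℝ)).prodMk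
    ((hasFDerivAt_snd (𝕜 := ℝ) (E := Yk k) (F := ℝ × ℝ)).sub ((coef k).hasFDerivAt.comp _ h1))

theorem scaledEq_zero (hk : 0 < k) (x : ℝ × ℝ) :
    scaledEq hk (0, (0, x)) = (0, x - redMap k x) := by
  rw [scaledEq]
  simp only [zero_smul, add_zero, Submodule.coe_zero]
  rfl

theorem exists_branch (hk : Odd k) (i : Fin 4) :
    ∃ φ : ℝ → Yk k × (ℝ × ℝ), φ 0 = (0, root k i) ∧ (∀ᶠ p in 𝓝 0, ContDiffAt ℝ ω φ p) ∧
      (∀ᶠ p in 𝓝 0, scaledEq hk.pos (p, φ p) = 0) ∧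
      ∀ᶠ q in 𝓝 (0, (0, root k i)), scaledEq hk.pos q = 0 → q.2 = φ q.1 :=
  exists_implicit (contDiff_scaledEq hk.pos)
    (by rw [scaledEq_zero, redMap_root hk, sub_self]; rfl) _ (hasFDerivAt_scaledEq hk i)

end Branch

section Local

variable {k : ℕ}

theorem norm_cubic_le : ∃ K : ℝ, 0 ≤ K ∧ ∀ u : H2, ‖cubic u‖ ≤ K * ‖u‖ ^ 3 := by
  refine ⟨‖mulW‖ * (‖mulH‖ * ‖mulH‖), by positivity, fun u => ?_⟩
  rw [cubic_eq_tri, tri]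
  have h0 : ‖DL 0 u‖ ≤ ‖u‖ := norm_D_le 0 u
  calc ‖mulW (mulH u (mulH u (DL 0 u)))‖ ≤ ‖mulW‖ * (‖mulH‖ * ‖u‖ * (‖mulH‖ * ‖u‖ * ‖u‖)) := by
        refine (mulW.le_opNorm _).trans ?_
        gcongr
        refine (mulH.le_opNorm₂ _ _).trans ?_
        gcongr
        refine (mulH.le_opNorm₂ _ _).trans ?_
        gcongr
    _ = ‖mulW‖ * (‖mulH‖ * ‖mulH‖) * ‖u‖ ^ 3 := by ring

/-- Near the bifurcation point the component of a solution orthogonal to the nullspace is of third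
order. -/
theorem exists_cone (hk : 0 < k) : ∃ C : ℝ, 0 ≤ C ∧ ∀ᶠ q : ℝ × H2 in 𝓝 (sigma k, 0),
    ∀ (x : ℝ × ℝ) (y : Yk k), q.2 = LL k x + (y : H2) → F q = 0 → ‖y‖ ≤ C * ‖x‖ ^ 3 := by
  obtain ⟨K, hK, hcub⟩ := norm_cubic_le
  set s := ‖S hk‖ with hs
  have hs0 : 0 ≤ s := norm_nonneg _
  refine ⟨2 * s * K * (2 * ‖LL k‖) ^ 3, by positivity, ?_⟩
  have e1 : ∀ᶠ q : ℝ × H2 in 𝓝 (sigma k, 0), s * |q.1 - sigma k| < 1 / 2 := by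
    have : Continuous fun q : ℝ × H2 => s * |q.1 - sigma k| := by fun_prop
    have h := this.tendsto (sigma k, 0)
    simp only [sub_self, abs_zero, mul_zero] at h
    exact h.eventually (gt_mem_nhds (by norm_num))
  have e2 : ∀ᶠ q : ℝ × H2 in 𝓝 (sigma k, 0), 2 * s * K * ‖q.2‖ ^ 2 < 1 / 2 := by
    have : Continuous fun q : ℝ × H2 => 2 * s * K * ‖q.2‖ ^ 2 := by fun_prop
    have h := this.tendsto (sigma k, 0)
    simp only [norm_zero, ne_eq, OfNat.ofNat_ne_zero, not_false_eq_true, zero_pow, mul_zero] at h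
    exact h.eventually (gt_mem_nhds (by norm_num))
  filter_upwards [e1, e2] with q h1 h2 x y hq hF
  obtain ⟨lam, u⟩ := q
  dsimp only at h1 h2 hq
  have hS := S_F hk lam x y
  rw [← hq, hF, map_zero] at hS
  have hy : y = -S hk ((lam - sigma k) • D 0 (y : H2) + cubic u) :=
    eq_neg_of_add_eq_zero_left hS.symm
  have hyn : ‖y‖ ≤ s * (|lam - sigma k| * ‖y‖ + K * ‖u‖ ^ 3) := by
    calc ‖y‖ = ‖S hk ((lam - sigma k) • D 0 (y : H2) + cubic u)‖ := by
          conv_lhs => rw [hy]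
          exact norm_neg _
      _ ≤ s * ‖(lam - sigma k) • D 0 (y : H2) + cubic u‖ := (S hk).le_opNorm _
      _ ≤ _ := by
        gcongr
        refine (norm_add_le _ _).trans (add_le_add ?_ (hcub u))
        rw [norm_smul, Real.norm_eq_abs]
        gcongr
        exact norm_D_le 0 (y : H2)
  have hny := norm_nonneg y
  have hnu := norm_nonneg u
  have hy2 : ‖y‖ ≤ 2 * s * K * ‖u‖ ^ 3 := by nlinarith
  have hy3 : ‖y‖ ≤ ‖u‖ / 2 := by
    have : 2 * s * K * ‖u‖ ^ 3 = (2 * s * K * ‖u‖ ^ 2) * ‖u‖ := by ring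
    nlinarith
  have hu : ‖u‖ ≤ 2 * ‖LL k‖ * ‖x‖ := by
    have : ‖u‖ ≤ ‖LL k‖ * ‖x‖ + ‖y‖ := by
      rw [hq]
      refine (norm_add_le _ _).trans (add_le_add ((LL k).le_opNorm x) le_rfl)
    linarith
  calc ‖y‖ ≤ 2 * s * K * ‖u‖ ^ 3 := hy2
    _ ≤ 2 * s * K * (2 * ‖LL k‖ * ‖x‖) ^ 3 := by gcongr
    _ = _ := by ring

/-- The radial component of the reduced equation, normalized by the Euclidean norm. -/
def radial (k : ℕ) (x : ℝ × ℝ) (y : Yk k) : ℝ :=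
  (x.1 * (coef k (cubic (LL k x + (y : H2)))).1 + x.2 * (coef k (cubic (LL k x + (y : H2)))).2) /
    (x.1 ^ 2 + x.2 ^ 2)

theorem sq_add_sq_pos {x : ℝ × ℝ} (hx : x ≠ 0) : 0 < x.1 ^ 2 + x.2 ^ 2 := by
  by_contra hcon
  have hz : x.1 = 0 := by nlinarith [sq_nonneg x.1, sq_nonneg x.2]
  have hw : x.2 = 0 := by nlinarith [sq_nonneg x.1, sq_nonneg x.2]
  exact hx (Prod.ext hz hw)

theorem continuousAt_radial {x : ℝ × ℝ} (hx : x ≠ 0) (y : Yk k) :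
    ContinuousAt (fun p : (ℝ × ℝ) × Yk k => radial k p.1 p.2) (x, y) := by
  have h1 : Continuous fun p : (ℝ × ℝ) × Yk k => coef k (cubic (LL k p.1 + (p.2 : H2))) :=
    (coef k).continuous.comp (contDiff_cubic.continuous.comp
      (((LL k).continuous.comp continuous_fst).add (continuous_subtype_val.comp continuous_snd)))
  have h2 : Continuous fun p : (ℝ × ℝ) × Yk k => p.1.1 * (coef k (cubic (LL k p.1 + (p.2 : H2)))).1 +
      p.1.2 * (coef k (cubic (LL k p.1 + (p.2 : H2)))).2 := by fun_prop
  have h3 : Continuous fun p : (ℝ × ℝ) × Yk k => p.1.1 ^ 2 + p.1.2 ^ 2 := by fun_prop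
  exact h2.continuousAt.div h3.continuousAt (sq_add_sq_pos hx).ne'

theorem radial_pos (hk : Odd k) {x : ℝ × ℝ} (hx : x ≠ 0) : 0 < radial k x 0 := by
  refine div_pos ?_ (sq_add_sq_pos hx)
  rw [Submodule.coe_zero, add_zero]
  exact redMap_pos hk hx

variable {φ : Fin 4 → ℝ → Yk k × (ℝ × ℝ)}

theorem eventually_scaledEq (hk : Odd k)
    (hφ : ∀ i, ∀ᶠ q in 𝓝 (0, (0, root k i)), scaledEq hk.pos q = 0 → q.2 = φ i q.1)
    {x : ℝ × ℝ} (hx : x ≠ 0) :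
    ∀ᶠ q in 𝓝 ((0 : ℝ), ((0 : Yk k), x)), scaledEq hk.pos q = 0 → ∃ i, q.2 = φ i q.1 := by
  by_cases h : redMap k x = x
  · obtain ⟨i, rfl⟩ := eq_root_of_redMap hk hx h
    filter_upwards [hφ i] with q hq h0
    exact ⟨i, hq h0⟩
  · have hne : scaledEq hk.pos (0, (0, x)) ≠ 0 := by
      rw [scaledEq_zero]
      intro h0
      exact h (sub_eq_zero.1 (Prod.ext_iff.1 h0).2).symm
    filter_upwards [(contDiff_scaledEq hk.pos).continuous.continuousAt.eventually_ne hne] with q hq h0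
    exact absurd h0 hq

theorem eventually_sphere (hk : Odd k)
    (hφ : ∀ i, ∀ᶠ q in 𝓝 (0, (0, root k i)), scaledEq hk.pos q = 0 → q.2 = φ i q.1) :
    ∀ᶠ p in 𝓝 ((0 : ℝ), (0 : Yk k)), ∀ e ∈ Metric.sphere (0 : ℝ × ℝ) 1, 0 < radial k e p.2 ∧
      (scaledEq hk.pos (p.1, ((√(radial k e p.2))⁻¹ • p.2, (√(radial k e p.2))⁻¹ • e)) = 0 →
        ∃ i, ((√(radial k e p.2))⁻¹ • p.2, (√(radial k e p.2))⁻¹ • e) = φ i p.1) := by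
  refine (isCompact_sphere (0 : ℝ × ℝ) 1).eventually_forall_of_forall_eventually fun e he => ?_
  have he0 : e ≠ 0 := by
    rintro rfl
    simp at he
  have hr : ContinuousAt (fun z : (ℝ × Yk k) × (ℝ × ℝ) => radial k z.2 z.1.2) ((0, 0), e) :=
    ContinuousAt.comp (g := fun p : (ℝ × ℝ) × Yk k => radial k p.1 p.2)
      (f := fun z : (ℝ × Yk k) × (ℝ × ℝ) => (z.2, z.1.2)) (x := ((0, 0), e))
      (continuousAt_radial he0 0) (by fun_prop)
  have hpos := radial_pos hk he0
  have hsq : ContinuousAt (fun z : (ℝ × Yk k) × (ℝ × ℝ) => (√(radial k z.2 z.1.2))⁻¹)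
      ((0, 0), e) := (Real.continuous_sqrt.continuousAt.comp hr).inv₀ (Real.sqrt_pos.2 hpos).ne'
  have hm : ContinuousAt (fun z : (ℝ × Yk k) × (ℝ × ℝ) => (z.1.1,
      ((√(radial k z.2 z.1.2))⁻¹ • z.1.2, (√(radial k z.2 z.1.2))⁻¹ • z.2))) ((0, 0), e) := by
    have c1 : ContinuousAt (fun z : (ℝ × Yk k) × (ℝ × ℝ) => z.1.1) ((0, 0), e) := by fun_prop
    have c2 : ContinuousAt (fun z : (ℝ × Yk k) × (ℝ × ℝ) => z.1.2) ((0, 0), e) := by fun_prop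
    have c3 : ContinuousAt (fun z : (ℝ × Yk k) × (ℝ × ℝ) => z.2) ((0, 0), e) := by fun_prop
    exact c1.prodMk ((hsq.smul c2).prodMk (hsq.smul c3))
  have hx : (√(radial k e 0))⁻¹ • e ≠ 0 :=
    smul_ne_zero (inv_ne_zero (Real.sqrt_pos.2 hpos).ne') he0
  have hev := eventually_scaledEq hk hφ hx
  have ht := hm.tendsto
  dsimp only at ht
  rw [smul_zero] at ht
  exact (hr.eventually (lt_mem_nhds hpos)).and (ht.eventually hev)

/-- All nontrivial solutions near the bifurcation point lie on the four branches. -/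
theorem eventually_on_branch (hk : Odd k)
    (hφ : ∀ i, ∀ᶠ q in 𝓝 (0, (0, root k i)), scaledEq hk.pos q = 0 → q.2 = φ i q.1) :
    ∀ᶠ q : ℝ × H2 in 𝓝 (sigma k, 0), F q = 0 → q.2 ≠ 0 → q.1 < sigma k ∧
      ∃ i, q.2 = √(sigma k - q.1) •
        (LL k (φ i (sigma k - q.1)).2 + ((φ i (sigma k - q.1)).1 : H2)) := by
  obtain ⟨C, hC, hcone⟩ := exists_cone hk.pos
  obtain ⟨δ, hδ, hsph⟩ := Metric.eventually_nhds_iff.1 (eventually_sphere hk hφ)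
  have e1 : ∀ᶠ q : ℝ × H2 in 𝓝 (sigma k, 0), |sigma k - q.1| < δ := by
    have : Continuous fun q : ℝ × H2 => |sigma k - q.1| := by fun_prop
    have h := this.tendsto (sigma k, 0)
    simp only [sub_self, abs_zero] at h
    exact h.eventually (gt_mem_nhds hδ)
  have e2 : ∀ᶠ q : ℝ × H2 in 𝓝 (sigma k, 0), C * ‖coef k (DL 0 q.2)‖ ^ 2 < δ := by
    have : Continuous fun q : ℝ × H2 => C * ‖coef k (DL 0 q.2)‖ ^ 2 := by fun_prop
    have h := this.tendsto (sigma k, 0)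
    simp only [map_zero, norm_zero, ne_eq, OfNat.ofNat_ne_zero, not_false_eq_true, zero_pow,
      mul_zero] at h
    exact h.eventually (gt_mem_nhds hδ)
  filter_upwards [hcone, e1, e2] with q hc h1 h2 hF hu
  obtain ⟨lam, u⟩ := q
  obtain ⟨y, hy⟩ := decomp hk.pos u
  set x := coef k (D 0 u) with hxdef
  have hyx := hc x y hy hF
  dsimp only at h1 h2 hF hu ⊢
  rw [DL_apply, ← hxdef] at h2
  have hx : x ≠ 0 := by
    intro hx0
    rw [hx0, norm_zero, zero_pow (by norm_num), mul_zero] at hyx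
    have : y = 0 := norm_le_zero_iff.1 hyx
    rw [hx0, this, map_zero, Submodule.coe_zero, add_zero] at hy
    exact hu hy
  have hρ : 0 < ‖x‖ := norm_pos_iff.2 hx
  set ρ := ‖x‖ with hρdef
  let e : ℝ × ℝ := ρ⁻¹ • x
  let Y : Yk k := ρ⁻¹ • y
  have hxe : x = ρ • e := (smul_inv_smul₀ hρ.ne' x).symm
  have hyY : y = ρ • Y := (smul_inv_smul₀ hρ.ne' y).symm
  have he : e ∈ Metric.sphere (0 : ℝ × ℝ) 1 := by
    rw [mem_sphere_zero_iff_norm, norm_smul, norm_inv, Real.norm_eq_abs, abs_of_pos hρ]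
    exact inv_mul_cancel₀ hρ.ne'
  have he0 : e ≠ 0 := smul_ne_zero (inv_ne_zero hρ.ne') hx
  have hY : ‖Y‖ < δ := by
    have : ‖Y‖ = ρ⁻¹ * ‖y‖ := by rw [norm_smul, norm_inv, Real.norm_eq_abs, abs_of_pos hρ]
    rw [this]
    calc ρ⁻¹ * ‖y‖ ≤ ρ⁻¹ * (C * ρ ^ 3) := by gcongr
      _ = C * ρ ^ 2 := by field_simp
      _ < δ := h2
  have hdist : dist (sigma k - lam, Y) ((0 : ℝ), (0 : Yk k)) < δ := by
    rw [Prod.dist_eq, dist_zero_right, dist_zero_right]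
    exact max_lt h1 hY
  clear_value e Y
  obtain ⟨hm, hbr⟩ := hsph hdist e he
  set m := radial k e Y with hmdef
  have hcF : (lam - sigma k) • x + coef k (cubic u) = 0 := by
    have := coef_F hk.pos lam x y
    rw [← hy, hF, map_zero] at this
    exact this.symm
  have hue : u = ρ • (LL k e + (Y : H2)) := by
    rw [hy, hxe, hyY, smul_add, map_smul]; rfl
  have hc1 : (sigma k - lam) • e = ρ ^ 2 • coef k (cubic (LL k e + (Y : H2))) := by
    rw [hue, cubic_smul, hxe, map_smul] at hcF
    have h3 : ρ • ((sigma k - lam) • e - ρ ^ 2 • coef k (cubic (LL k e + (Y : H2)))) = 0 := by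
      rw [← neg_eq_zero, ← hcF]
      module
    exact sub_eq_zero.1 ((smul_eq_zero_iff_right hρ.ne').1 h3)
  have hμ : sigma k - lam = ρ ^ 2 * m := by
    obtain ⟨a1, a2⟩ := Prod.ext_iff.1 hc1
    have hpos := sq_add_sq_pos he0
    rw [hmdef, radial, ← mul_div_assoc, eq_div_iff hpos.ne']
    simp only [Prod.smul_fst, Prod.smul_snd, smul_eq_mul] at a1 a2
    linear_combination e.1 * a1 + e.2 * a2
  have hμpos : 0 < sigma k - lam := by rw [hμ]; positivity
  have hsqrt : √(sigma k - lam) = ρ * √m := by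
    rw [hμ, Real.sqrt_mul (by positivity), Real.sqrt_sq hρ.le]
  have hsm : √m ≠ 0 := (Real.sqrt_pos.2 hm).ne'
  have hu2 : u = √(sigma k - lam) •
      (LL k ((√m)⁻¹ • e) + (((√m)⁻¹ • Y : Yk k) : H2)) := by
    rw [hue, hsqrt, map_smul, Submodule.coe_smul, ← smul_add, smul_smul]
    congr 1
    field_simp
  refine ⟨sub_pos.1 hμpos, ?_⟩
  have hz := F_scaled_eq_zero_iff hk.pos hμpos ((√m)⁻¹ • Y, (√m)⁻¹ • e)
  rw [sub_sub_cancel] at hz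
  dsimp only at hz
  rw [← hu2] at hz
  obtain ⟨i, hi⟩ := hbr (hz.1 hF)
  dsimp only at hi
  refine ⟨i, ?_⟩
  rw [← hi]
  exact hu2

end Local

section Zeros

theorem half_lt_sin_quarter : (1 : ℝ) / 2 < Real.sin (Real.pi / 4) := by
  rw [Real.sin_pi_div_four]
  have : (1 : ℝ) < √2 := by rw [Real.lt_sqrt] <;> norm_num
  linarith

theorem half_lt_cos_of_abs_le {d : ℝ} (h : |d| ≤ Real.pi / 4) : (1 : ℝ) / 2 < Real.cos d := by
  have hpi := Real.pi_pos
  have h1 : Real.cos (Real.pi / 4) ≤ Real.cos |d| :=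
    Real.cos_le_cos_of_nonneg_of_le_pi (abs_nonneg _) (by linarith) h
  rw [Real.cos_abs] at h1
  have h2 := half_lt_sin_quarter
  rw [Real.sin_pi_div_four] at h2
  rw [Real.cos_pi_div_four] at h1
  linarith

theorem abs_lt_of_abs_sin_le {d : ℝ} (hd : |d| ≤ Real.pi / 2) (h : |Real.sin d| ≤ 1 / 2) :
    |d| < Real.pi / 4 := by
  have hpi := Real.pi_pos
  by_contra hcon
  rw [not_lt] at hcon
  have h1 : Real.sin (Real.pi / 4) ≤ Real.sin |d| :=
    Real.sin_le_sin_of_le_of_le_pi_div_two (by linarith) hd hcon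
  have h2 : Real.sin |d| = |Real.sin d| := by
    rcases le_total 0 d with h0 | h0
    · rw [abs_of_nonneg h0] at hd ⊢
      rw [abs_of_nonneg (Real.sin_nonneg_of_nonneg_of_le_pi h0 (by linarith))]
    · rw [abs_of_nonpos h0] at hd ⊢
      have := Real.sin_nonneg_of_nonneg_of_le_pi (x := -d) (by linarith) (by linarith)
      rw [Real.sin_neg] at this ⊢
      rw [abs_of_nonpos (by linarith)]
  have := half_lt_sin_quarter
  linarith

/-- A function that is `C¹`-close to `sin (2 k t - α)` has exactly `2 k` zeros. -/
theorem encard_zeros {k : ℕ} (hk : 0 < k) {α : ℝ} (hα1 : Real.pi / 4 ≤ α)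
    (hα2 : α ≤ 3 * Real.pi / 4) {f g : ℝ → ℝ} (hf : ContinuousOn f (Icc 0 Real.pi))
    (hd : ∀ t ∈ Ioo 0 Real.pi, HasDerivAt f (g t) t)
    (h0 : ∀ t ∈ Icc 0 Real.pi, |f t - Real.sin (2 * k * t - α)| ≤ 1 / 2)
    (h1 : ∀ t ∈ Icc 0 Real.pi, |g t - 2 * k * Real.cos (2 * k * t - α)| ≤ 1 / 2) :
    {t | t ∈ Ico 0 Real.pi ∧ f t = 0}.encard = (2 * k : ℕ) := by
  have hpi := Real.pi_pos
  have hk1 : (1 : ℝ) ≤ k := by exact_mod_cast hk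
  have hk0 : (0 : ℝ) < 2 * k := by linarith
  let a : ℕ → ℝ := fun j => (α + j * Real.pi - Real.pi / 4) / (2 * k)
  let b : ℕ → ℝ := fun j => (α + j * Real.pi + Real.pi / 4) / (2 * k)
  have ha : ∀ j, 2 * k * a j - α = -(Real.pi / 4) + j * Real.pi := fun j => by
    simp only [a]; field_simp; ring
  have hb : ∀ j, 2 * k * b j - α = Real.pi / 4 + j * Real.pi := fun j => by
    simp only [b]; field_simp; ring
  have hab : ∀ j, a j < b j := fun j => by
    simp only [a, b]; gcongr; linarith
  have ha0 : ∀ j, 0 ≤ a j := fun j => by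
    have : (0 : ℝ) ≤ j * Real.pi := by positivity
    exact div_nonneg (by linarith) hk0.le
  have hbpi : ∀ j < 2 * k, b j ≤ Real.pi := fun j hj => by
    have : (j : ℝ) + 1 ≤ 2 * k := by exact_mod_cast hj
    simp only [b]
    rw [div_le_iff₀ hk0]
    nlinarith
  have hsub : ∀ j < 2 * k, Icc (a j) (b j) ⊆ Icc 0 Real.pi := fun j hj =>
    Icc_subset_Icc (ha0 j) (hbpi j hj)
  have sgn : ∀ j : ℕ, |(-1 : ℝ) ^ j| = 1 := fun j => by simp
  have sgn2 : ∀ j : ℕ, (-1 : ℝ) ^ j * (-1) ^ j = 1 := fun j => by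
    rw [← mul_pow]; norm_num
  have close : ∀ (j : ℕ) {p q : ℝ}, |p - (-1) ^ j * q| ≤ 1 / 2 → |(-1) ^ j * p - q| ≤ 1 / 2 := by
    intro j p q h
    have : (-1 : ℝ) ^ j * p - q = (-1) ^ j * (p - (-1) ^ j * q) := by
      linear_combination q * sgn2 j
    rw [this, abs_mul, sgn, one_mul]; exact h
  have hmono : ∀ j < 2 * k, StrictMonoOn (fun t => (-1) ^ j * f t) (Icc (a j) (b j)) := by
    intro j hj
    refine strictMonoOn_of_deriv_pos (convex_Icc _ _)
      (continuousOn_const.mul (hf.mono (hsub j hj))) fun t ht => ?_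
    rw [interior_Icc] at ht
    have ht' : t ∈ Ioo 0 Real.pi := Ioo_subset_Ioo (ha0 j) (hbpi j hj) ht
    rw [((hd t ht').const_mul ((-1) ^ j)).deriv]
    have e : 2 * k * t - α = (2 * k * t - α - j * Real.pi) + j * Real.pi := by ring
    have h3 := h1 t (Ioo_subset_Icc_self ht')
    rw [e, Real.cos_add_nat_mul_pi, mul_left_comm] at h3
    have h4 := (abs_le.1 (close j h3)).1
    have h5 : |2 * k * t - α - j * Real.pi| ≤ Real.pi / 4 := by
      have e1 := ha j
      have e2 := hb j
      have e3 := mul_lt_mul_of_pos_left ht.1 hk0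
      have e4 := mul_lt_mul_of_pos_left ht.2 hk0
      rw [abs_le]; constructor <;> linarith
    have h6 := half_lt_cos_of_abs_le h5
    nlinarith
  have hend : ∀ j < 2 * k, (-1) ^ j * f (a j) < 0 ∧ 0 < (-1) ^ j * f (b j) := by
    intro j hj
    have h3 := h0 (a j) (hsub j hj (left_mem_Icc.2 (hab j).le))
    have h4 := h0 (b j) (hsub j hj (right_mem_Icc.2 (hab j).le))
    rw [ha, Real.sin_add_nat_mul_pi, Real.sin_neg] at h3
    rw [hb, Real.sin_add_nat_mul_pi] at h4
    have h5 := (abs_le.1 (close j h3)).2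
    have h6 := (abs_le.1 (close j h4)).1
    have := half_lt_sin_quarter
    constructor <;> linarith
  have hex : ∀ j : Fin (2 * k), ∃ t ∈ Ioo (a j) (b j), f t = 0 := by
    intro j
    obtain ⟨e1, e2⟩ := hend j j.2
    obtain ⟨t, ht, ht0⟩ := intermediate_value_Ioo (hab j).le
      (continuousOn_const.mul (hf.mono (hsub j j.2)) :
        ContinuousOn (fun t => (-1) ^ (j : ℕ) * f t) _) ⟨e1, e2⟩
    have ht0' : (-1 : ℝ) ^ (j : ℕ) * f t = 0 := ht0
    refine ⟨t, ht, (mul_eq_zero.1 ht0').resolve_left ?_⟩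
    intro h
    have := sgn j
    rw [h, abs_zero] at this
    exact zero_ne_one this
  choose τ hτ hτ0 using hex
  have hτmono : StrictMono τ := by
    intro i j hij
    have hij' : (i : ℝ) + 1 ≤ j := by exact_mod_cast hij
    have : b i ≤ a j := by
      simp only [a, b]
      gcongr
      nlinarith
    exact (hτ i).2.trans_le (this.trans (hτ j).1.le)
  have hset : {t | t ∈ Ico 0 Real.pi ∧ f t = 0} = τ '' univ := by
    ext t
    constructor
    · rintro ⟨ht, hft⟩
      have htI := Ico_subset_Icc_self ht
      have hs := h0 t htI
      rw [hft, zero_sub, abs_neg] at hs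
      set θ := 2 * k * t - α with hθ
      set n : ℤ := round (θ / Real.pi) with hn
      have hr := abs_sub_round (θ / Real.pi)
      rw [← hn] at hr
      have hδ : |θ - n * Real.pi| ≤ Real.pi / 2 := by
        have : θ - n * Real.pi = (θ / Real.pi - n) * Real.pi := by field_simp
        rw [this, abs_mul, abs_of_pos hpi]
        nlinarith
      have hsin : |Real.sin (θ - n * Real.pi)| ≤ 1 / 2 := by
        rw [Real.sin_sub_int_mul_pi, abs_mul]
        simpa using hs
      have hδ2 := abs_lt.1 (abs_lt_of_abs_sin_le hδ hsin)
      have ht1 : 0 ≤ 2 * k * t := mul_nonneg hk0.le ht.1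
      have ht2 : 2 * k * t < 2 * k * Real.pi := mul_lt_mul_of_pos_left ht.2 hk0
      have hn0 : 0 ≤ n := by
        have : (-1 : ℝ) < n := by
          by_contra hcon
          rw [not_lt] at hcon
          nlinarith
        have : (-1 : ℤ) < n := by exact_mod_cast this
        omega
      have hn1 : n < 2 * k := by
        have : (n : ℝ) < 2 * k := by
          by_contra hcon
          rw [not_lt] at hcon
          nlinarith
        exact_mod_cast this
      obtain ⟨j, hjn⟩ := Int.eq_ofNat_of_zero_le hn0
      rw [hjn] at hδ2 hn1
      have hj : j < 2 * k := by exact_mod_cast hn1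
      rw [Int.cast_natCast] at hδ2
      refine ⟨⟨j, hj⟩, mem_univ _, ?_⟩
      have htj : t ∈ Icc (a j) (b j) := by
        have e1 := ha j
        have e2 := hb j
        constructor
        · refine (mul_le_mul_iff_right₀ hk0).1 ?_; linarith
        · refine (mul_le_mul_iff_right₀ hk0).1 ?_; linarith
      refine (hmono j hj).injOn (Ioo_subset_Icc_self (hτ ⟨j, hj⟩)) htj ?_
      rw [hτ0, hft]
    · rintro ⟨j, -, rfl⟩
      exact ⟨⟨(ha0 j).trans (hτ j).1.le, (hτ j).2.trans_le (hbpi j j.2)⟩, hτ0 j⟩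
  rw [hset, hτmono.injective.injOn.encard_image, encard_univ]
  simp

theorem exists_C1_rep (u : H2) : ∃ f g : ℝ → ℝ, IsContRep (D 0 u) f ∧ IsContRep (D 1 u) g ∧
    ∀ t ∈ Ioo 0 Real.pi, HasDerivAt f (g t) t := by
  obtain ⟨c, hc⟩ := (D_weak0 u).exists_rep
  obtain ⟨c', hg⟩ := (D_weak1 u).exists_rep
  set g : ℝ → ℝ := fun t => c' + prim (D 2 u) t with hgdef
  have hpr : ∀ t ∈ Icc 0 Real.pi, prim (D 1 u) t = prim g t := by
    intro t ht
    refine intervalIntegral.integral_congr_ae ?_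
    have := (ae_restrict_iff' measurableSet_Icc).1 hg.2
    filter_upwards [this] with s hs hs'
    rw [uIoc_of_le ht.1] at hs'
    exact hs ⟨hs'.1.le, hs'.2.trans ht.2⟩
  refine ⟨_, g, hc, hg, fun t ht => ?_⟩
  have hnh : Icc 0 Real.pi ∈ 𝓝 t := Icc_mem_nhds ht.1 ht.2
  have hgi : IntervalIntegrable g volume 0 t :=
    (hg.1.mono (by
      rw [uIcc_of_le ht.1.le]; exact Icc_subset_Icc_right ht.2.le)).intervalIntegrable
  have hder : HasDerivAt (prim g) (g t) t :=
    intervalIntegral.integral_hasDerivAt_right hgi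
      (hg.1.stronglyMeasurableAtFilter_nhdsWithin measurableSet_Icc t |>.filter_mono (by
        rw [nhdsWithin_eq_nhds.2 hnh]))
      (hg.1.continuousAt hnh)
  refine (hder.const_add c).congr_of_eventuallyEq ?_
  filter_upwards [hnh] with s hs
  rw [hpr s hs]

theorem IsContRep.sub {u v : L2} {f g : ℝ → ℝ} (hu : IsContRep u f) (hv : IsContRep v g) :
    IsContRep (u - v) (fun t => f t - g t) := by
  refine ⟨hu.1.sub hv.1, ?_⟩
  filter_upwards [Lp.coeFn_sub u v, hu.2, hv.2] with t h1 h2 h3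
  rw [h1, Pi.sub_apply, h2, h3]

theorem IsContRep.smul {u : L2} {f : ℝ → ℝ} (c : ℝ) (hu : IsContRep u f) :
    IsContRep (c • u) (fun t => c * f t) := by
  refine ⟨continuousOn_const.mul hu.1, ?_⟩
  filter_upwards [Lp.coeFn_smul c u, hu.2] with t h1 h2
  rw [h1, Pi.smul_apply, h2, smul_eq_mul]

variable {k : ℕ}

theorem isContRep_D0_LL (x : ℝ × ℝ) : IsContRep (D 0 (LL k x))
    (fun t => nrm * (x.1 * Real.cos (2 * k * t) + x.2 * Real.sin (2 * k * t))) :=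
  ⟨Continuous.continuousOn (by fun_prop), D0_LL_coe x⟩

theorem isContRep_D1_LL (x : ℝ × ℝ) : IsContRep (D 1 (LL k x))
    (fun t => nrm * (2 * k) * (-x.1 * Real.sin (2 * k * t) + x.2 * Real.cos (2 * k * t))) := by
  refine ⟨Continuous.continuousOn (by fun_prop), ?_⟩
  have c1 : Continuous fun t : ℝ => -(nrm * (2 * k)) * Real.sin (2 * k * t) := by fun_prop
  have c2 : Continuous fun t : ℝ => (nrm * (2 * k)) * Real.cos (2 * k * t) := by fun_prop
  have e1 : D 1 (cosMode k) =ᵐ[mu] _ := toL2_coe c1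
  have e2 : D 1 (sinMode k) =ᵐ[mu] _ := toL2_coe c2
  have e0 : D 1 (LL k x) = x.1 • D 1 (cosMode k) + x.2 • D 1 (sinMode k) := rfl
  rw [e0]
  filter_upwards [e1, e2, Lp.coeFn_add (x.1 • D 1 (cosMode k)) (x.2 • D 1 (sinMode k)),
    Lp.coeFn_smul x.1 (D 1 (cosMode k)), Lp.coeFn_smul x.2 (D 1 (sinMode k))] with t h3 h4 h5 h6 h7
  rw [h5, Pi.add_apply, h6, h7, Pi.smul_apply, Pi.smul_apply, h3, h4, smul_eq_mul, smul_eq_mul]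
  ring

theorem nrm_pos : 0 < nrm := Real.sqrt_pos.2 (div_pos two_pos Real.pi_pos)

theorem eventually_zeros_of_phase (hk : 0 < k) {α r : ℝ} (hα1 : Real.pi / 4 ≤ α)
    (hα2 : α ≤ 3 * Real.pi / 4) (hr : r ≠ 0) :
    ∀ᶠ v in 𝓝 (LL k (-(r * Real.sin α), r * Real.cos α)), ∀ c : ℝ, c ≠ 0 →
      HasExactlyZeros (c • v) (2 * k) := by
  obtain ⟨K, hK, hKb⟩ := exists_sup_bound
  set x : ℝ × ℝ := (-(r * Real.sin α), r * Real.cos α) with hx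
  have hR : nrm * r ≠ 0 := mul_ne_zero nrm_pos.ne' hr
  have hR' : 0 < |nrm * r| := abs_pos.2 hR
  filter_upwards [Metric.ball_mem_nhds (LL k x) (ε := |nrm * r| / (4 * K)) (by positivity)]
    with v hv c hc
  rw [mem_ball_iff_norm] at hv
  obtain ⟨f, g, hf, hg, hfg⟩ := exists_C1_rep v
  have hsmall : ∀ i j : Fin 3, K * (‖D i (v - LL k x)‖ + ‖D j (v - LL k x)‖) ≤ |nrm * r| / 2 := by
    intro i j
    have h1 := norm_D_le i (v - LL k x)
    have h2 := norm_D_le j (v - LL k x)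
    have h3 : |nrm * r| / (4 * K) * (4 * K) = |nrm * r| := div_mul_cancel₀ _ (by positivity)
    nlinarith
  have hb0 : ∀ t ∈ Icc 0 Real.pi,
      |f t - nrm * (x.1 * Real.cos (2 * k * t) + x.2 * Real.sin (2 * k * t))| ≤ |nrm * r| / 2 :=
    fun t ht => (hKb _ _ (D_weak0 (v - LL k x)) _ (hf.sub (isContRep_D0_LL x)) t ht).trans
      (hsmall 0 1)
  have hb1 : ∀ t ∈ Icc 0 Real.pi,
      |g t - nrm * (2 * k) * (-x.1 * Real.sin (2 * k * t) + x.2 * Real.cos (2 * k * t))| ≤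
        |nrm * r| / 2 :=
    fun t ht => (hKb _ _ (D_weak1 (v - LL k x)) _ (hg.sub (isContRep_D1_LL x)) t ht).trans
      (hsmall 1 2)
  have scale : ∀ p q : ℝ, |p - (nrm * r) * q| ≤ |nrm * r| / 2 → |(nrm * r)⁻¹ * p - q| ≤ 1 / 2 := by
    intro p q h
    have : (nrm * r)⁻¹ * p - q = (nrm * r)⁻¹ * (p - (nrm * r) * q) := by
      rw [mul_sub, inv_mul_cancel_left₀ hR]
    rw [this, abs_mul, abs_inv]
    calc |nrm * r|⁻¹ * |p - nrm * r * q| ≤ |nrm * r|⁻¹ * (|nrm * r| / 2) := by gcongr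
      _ = 1 / 2 := by field_simp
  have hcard := encard_zeros hk hα1 hα2 (f := fun t => (nrm * r)⁻¹ * f t)
    (g := fun t => (nrm * r)⁻¹ * g t) (continuousOn_const.mul hf.1)
    (fun t ht => (hfg t ht).const_mul _)
    (fun t ht => scale _ _ (by
      convert hb0 t ht using 3
      rw [Real.sin_sub, hx]; ring))
    (fun t ht => scale _ _ (by
      convert hb1 t ht using 3
      rw [Real.cos_sub, hx]; ring))
  refine ⟨fun t => c * f t, hf.smul c, ?_⟩
  rw [← hcard]
  congr 1
  ext t
  simp [hc, nrm_pos.ne', hr]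

theorem eventually_zeros (hk : 0 < k) (i : Fin 4) :
    ∀ᶠ v in 𝓝 (LL k (root k i)), ∀ c : ℝ, c ≠ 0 → HasExactlyZeros (c • v) (2 * k) := by
  have hpi := Real.pi_pos
  have a1 := (ampPos_pos hk).ne'
  have a2 := (ampNeg_pos hk).ne'
  have s2 : √(2 : ℝ) * √2 = 2 := Real.mul_self_sqrt (by norm_num)
  have hs0 : √(2 : ℝ) ≠ 0 := by positivity
  have c3 : Real.cos (3 * Real.pi / 4) = -(√2 / 2) := by
    rw [show 3 * Real.pi / 4 = Real.pi - Real.pi / 4 by ring, Real.cos_pi_sub, Real.cos_pi_div_four]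
  have s3 : Real.sin (3 * Real.pi / 4) = √2 / 2 := by
    rw [show 3 * Real.pi / 4 = Real.pi - Real.pi / 4 by ring, Real.sin_pi_sub, Real.sin_pi_div_four]
  have diag : ∀ r : ℝ, r ≠ 0 → ∀ᶠ v in 𝓝 (LL k (r, r)), ∀ c : ℝ, c ≠ 0 →
      HasExactlyZeros (c • v) (2 * k) := by
    intro r hr
    have := eventually_zeros_of_phase hk (α := 3 * Real.pi / 4) (r := -(√2 * r)) (by linarith) le_rfl
      (neg_ne_zero.2 (mul_ne_zero hs0 hr))
    rw [s3, c3] at this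
    convert this using 4
    · linear_combination (-r / 2) * s2
    · linear_combination (-r / 2) * s2
  have anti : ∀ r : ℝ, r ≠ 0 → ∀ᶠ v in 𝓝 (LL k (r, -r)), ∀ c : ℝ, c ≠ 0 →
      HasExactlyZeros (c • v) (2 * k) := by
    intro r hr
    have := eventually_zeros_of_phase hk (α := Real.pi / 4) (r := -(√2 * r)) le_rfl (by linarith)
      (neg_ne_zero.2 (mul_ne_zero hs0 hr))
    rw [Real.sin_pi_div_four, Real.cos_pi_div_four] at this
    convert this using 4
    · linear_combination (-r / 2) * s2
    · linear_combination (r / 2) * s2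
  fin_cases i
  · exact diag _ a1
  · exact diag _ (neg_ne_zero.2 a1)
  · exact anti _ a2
  · have := anti _ (neg_ne_zero.2 a2)
    rwa [neg_neg] at this

end Zeros

section Final

variable {k : ℕ}

/-- The element of `H²(𝕋)` with the given components. -/
def assemble (k : ℕ) : Yk k × (ℝ × ℝ) →L[ℝ] H2 :=
  (LL k).comp (ContinuousLinearMap.snd ℝ (Yk k) (ℝ × ℝ)) +
    ((nullS k)ᗮ).subtypeL.comp (ContinuousLinearMap.fst ℝ (Yk k) (ℝ × ℝ))

theorem assemble_apply (q : Yk k × (ℝ × ℝ)) : assemble k q = LL k q.2 + (q.1 : H2) := rfl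

theorem coef_assemble (hk : 0 < k) (q : Yk k × (ℝ × ℝ)) : coef k (D 0 (assemble k q)) = q.2 := by
  rw [assemble_apply, D_add, map_add, coef_LL hk, coef_Y hk, add_zero]

/-- The properties of a branch of the scaled system at a given value of the parameter. -/
theorem Reduction.branch_point (hk : 0 < k) (R : Reduction k) {μ : ℝ} (hμ : 0 ≤ μ)
    {q : Yk k × (ℝ × ℝ)} (hq : scaledEq hk (μ, q) = 0)
    (hO : (sigma k - μ, √μ • assemble k q) ∈ R.O) :
    (sigma k - μ, √μ • q.2) ∈ R.zeroH ∧
      R.Psi (sigma k - μ, √μ • q.2) = (sigma k - μ, √μ • assemble k q) ∧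
      F (sigma k - μ, √μ • assemble k q) = 0 := by
  have e : √μ • assemble k q = LL k (√μ • q.2) + ((√μ • q.1 : Yk k) : H2) := by
    rw [assemble_apply, smul_add, map_smul]; rfl
  obtain ⟨h1, h2⟩ := F_scaled hk hμ q
  rw [← assemble_apply, hq] at h1 h2
  rw [Prod.fst_zero, smul_zero] at h1
  rw [Prod.snd_zero, smul_zero] at h2
  have hF := (eq_zero_iff hk _).2 ⟨h1, h2⟩
  rw [e] at hO h1
  obtain ⟨hI, hN, hP⟩ := R.eq_Psi hk hO h1
  rw [← e] at hP
  refine ⟨⟨hI, hN, ?_⟩, hP, hF⟩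
  rw [R.H_eq hk, hP, hF, map_zero]

theorem eventually_branch (hk : Odd k) (R : Reduction k) {φ : Fin 4 → ℝ → Yk k × (ℝ × ℝ)}
    (h0 : ∀ i, φ i 0 = (0, root k i)) (hs : ∀ i, ∀ᶠ p in 𝓝 0, ContDiffAt ℝ ω (φ i) p) :
    ∀ᶠ μ in 𝓝 (0 : ℝ), ∀ i, (sigma k - μ, √μ • assemble k (φ i μ)) ∈ R.O ∧
      (∀ c : ℝ, c ≠ 0 → HasExactlyZeros (c • assemble k (φ i μ)) (2 * k)) ∧
      assemble k (φ i μ) ≠ 0 ∧ ∀ j, i ≠ j → (φ i μ).2 ≠ (φ j μ).2 := by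
  have hc : ∀ i, ContinuousAt (φ i) 0 := fun i => (hs i).self_of_nhds.continuousAt
  have hca : ∀ i, ContinuousAt (fun μ => assemble k (φ i μ)) 0 := fun i =>
    (assemble k).continuous.continuousAt.comp (hc i)
  have hr : ∀ i, assemble k (φ i 0) = LL k (root k i) := fun i => by
    rw [h0, assemble_apply, Submodule.coe_zero, add_zero]
  refine eventually_all.2 fun i => ?_
  have e1 : ∀ᶠ μ in 𝓝 (0 : ℝ), (sigma k - μ, √μ • assemble k (φ i μ)) ∈ R.O := by
    have : ContinuousAt (fun μ => (sigma k - μ, √μ • assemble k (φ i μ))) 0 :=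
      (continuousAt_const.sub continuousAt_id).prodMk
        (Real.continuous_sqrt.continuousAt.smul (hca i))
    refine this.eventually (R.isOpen_O.mem_nhds ?_)
    dsimp only
    rw [sub_zero, Real.sqrt_zero, zero_smul]
    exact R.base_mem
  have e2 := eventually_zeros hk.pos i
  rw [← hr] at e2
  have hne : assemble k (φ i 0) ≠ 0 := by
    intro h
    have := coef_assemble hk.pos (φ i 0)
    rw [h, ← DL_apply, map_zero, map_zero, h0] at this
    exact root_ne_zero hk.pos i this.symm
  have e4 : ∀ᶠ μ in 𝓝 (0 : ℝ), ∀ j, i ≠ j → (φ i μ).2 ≠ (φ j μ).2 := by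
    refine eventually_all.2 fun j => ?_
    by_cases hij : i = j
    · exact Eventually.of_forall fun _ h => absurd hij h
    · have h1 : (φ i 0).2 ≠ (φ j 0).2 := by
        rw [h0, h0]; exact fun h => hij (root_injective hk.pos h)
      have h2 : ContinuousAt (fun μ => ((φ i μ).2, (φ j μ).2)) 0 := (hc i).snd.prodMk (hc j).snd
      have h3 : ∀ᶠ p : (ℝ × ℝ) × (ℝ × ℝ) in 𝓝 ((φ i 0).2, (φ j 0).2), p.1 ≠ p.2 :=
        (isOpen_ne_fun continuous_fst continuous_snd).mem_nhds h1
      filter_upwards [h2.eventually h3] with μ hμ _ using hμ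
  exact e1.and (((hca i).eventually e2).and (((hca i).eventually_ne hne).and e4))

end Final

end PeriodicBif

end

theorem theorem3p18 (k : ℕ) (hk : Odd k) :
    -- the Lyapunov–Schmidt reduction at `(4k², 0)` exists
    Nonempty (PeriodicBif.Reduction k) ∧
    -- and, for every choice of its data,
    ∀ R : PeriodicBif.Reduction k,
      -- `Ψ_k` is a homeomorphism of the zero sets, with inverse `(λ, u) ↦ (λ, L⁻¹ P_k u)`
      (∃ e : R.zeroH ≃ₜ R.zeroF, (∀ p : R.zeroH, (e p : ℝ × PeriodicBif.H2) = R.Psi p) ∧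
        ∀ q : R.zeroF, ((e.symm q : ℝ × ℝ × ℝ).1 = (q : ℝ × PeriodicBif.H2).1) ∧
          (PeriodicBif.Lmap k (e.symm q : ℝ × ℝ × ℝ).2 : PeriodicBif.H2) =
            PeriodicBif.P k (q : ℝ × PeriodicBif.H2).2) ∧
      ∃ ε : ℝ, 0 < ε ∧ ∃ z w : Fin 4 → ℝ → ℝ,
        (∀ i, ContDiffOn ℝ 1 (z i) (Set.Ioc (4 * (k : ℝ) ^ 2 - ε) (4 * (k : ℝ) ^ 2)) ∧
          ContDiffOn ℝ 1 (w i) (Set.Ioc (4 * (k : ℝ) ^ 2 - ε) (4 * (k : ℝ) ^ 2))) ∧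
        -- the values at `λ = 4k²`
        (z 0 (4 * (k : ℝ) ^ 2) = 2 * √(k : ℝ) * Real.pi / √(3 * k * Real.pi + 8) ∧
          w 0 (4 * (k : ℝ) ^ 2) = 2 * √(k : ℝ) * Real.pi / √(3 * k * Real.pi + 8)) ∧
        (z 1 (4 * (k : ℝ) ^ 2) = -(2 * √(k : ℝ) * Real.pi) / √(3 * k * Real.pi + 8) ∧
          w 1 (4 * (k : ℝ) ^ 2) = -(2 * √(k : ℝ) * Real.pi) / √(3 * k * Real.pi + 8)) ∧
        (z 2 (4 * (k : ℝ) ^ 2) = 2 * √(k : ℝ) * Real.pi / √(3 * k * Real.pi - 8) ∧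
          w 2 (4 * (k : ℝ) ^ 2) = -(2 * √(k : ℝ) * Real.pi) / √(3 * k * Real.pi - 8)) ∧
        (z 3 (4 * (k : ℝ) ^ 2) = -(2 * √(k : ℝ) * Real.pi) / √(3 * k * Real.pi - 8) ∧
          w 3 (4 * (k : ℝ) ^ 2) = 2 * √(k : ℝ) * Real.pi / √(3 * k * Real.pi - 8)) ∧
        -- each branch lies in the domain of `Ψ_k`, is a continuous curve and emanates from
        -- `(4k², 0)`
        (∀ i, (∀ lam ∈ Set.Ioc (4 * (k : ℝ) ^ 2 - ε) (4 * (k : ℝ) ^ 2),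
            PeriodicBif.scaled k (z i) (w i) lam ∈ R.zeroH) ∧
          ContinuousOn (fun lam => R.Psi (PeriodicBif.scaled k (z i) (w i) lam))
            (Set.Ioc (4 * (k : ℝ) ^ 2 - ε) (4 * (k : ℝ) ^ 2)) ∧
          R.Psi (PeriodicBif.scaled k (z i) (w i) (4 * (k : ℝ) ^ 2)) = (4 * (k : ℝ) ^ 2, 0)) ∧
        -- for `λ < 4k²` it consists of nontrivial solutions with exactly `2k` zeros in `[0, π)`
        (∀ i, ∀ lam ∈ Set.Ioo (4 * (k : ℝ) ^ 2 - ε) (4 * (k : ℝ) ^ 2),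
          PeriodicBif.F (R.Psi (PeriodicBif.scaled k (z i) (w i) lam)) = 0 ∧
          (R.Psi (PeriodicBif.scaled k (z i) (w i) lam)).2 ≠ 0 ∧
          PeriodicBif.HasExactlyZeros
            (R.Psi (PeriodicBif.scaled k (z i) (w i) lam)).2 (2 * k)) ∧
        -- the four branches are pairwise disjoint for `λ < 4k²`
        (∀ i j, i ≠ j → ∀ lam ∈ Set.Ioo (4 * (k : ℝ) ^ 2 - ε) (4 * (k : ℝ) ^ 2),
          R.Psi (PeriodicBif.scaled k (z i) (w i) lam) ≠
            R.Psi (PeriodicBif.scaled k (z j) (w j) lam)) ∧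
        -- near `(4k², 0)` there are no other nontrivial solutions, and none at all for `λ ≥ 4k²`
        ∃ V : Set (ℝ × PeriodicBif.H2), IsOpen V ∧ (4 * (k : ℝ) ^ 2, 0) ∈ V ∧
          ∀ lam : ℝ, ∀ u : PeriodicBif.H2, (lam, u) ∈ V → PeriodicBif.F (lam, u) = 0 →
            (4 * (k : ℝ) ^ 2 ≤ lam → u = 0) ∧
            (lam < 4 * (k : ℝ) ^ 2 → u ≠ 0 →
              4 * (k : ℝ) ^ 2 - ε < lam ∧
                ∃ i, (lam, u) = R.Psi (PeriodicBif.scaled k (z i) (w i) lam)) := by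
  open PeriodicBif Filter Topology in
  refine ⟨exists_reduction hk.pos, fun R => ⟨R.exists_homeomorph hk.pos, ?_⟩⟩
  choose φ h0 hs hz hu using exists_branch hk
  have hgood := (eventually_branch hk R h0 hs).and ((eventually_all.2 hs).and (eventually_all.2 hz))
  obtain ⟨ε, hε, hball⟩ := Metric.eventually_nhds_iff.1 hgood
  have hσ : 4 * (k : ℝ) ^ 2 = sigma k := rfl
  have hrange : ∀ lam ∈ Set.Ioc (sigma k - ε) (sigma k),
      0 ≤ sigma k - lam ∧ dist (sigma k - lam) 0 < ε := by
    rintro lam ⟨h1, h2⟩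
    refine ⟨by linarith, ?_⟩
    rw [Real.dist_eq, sub_zero, abs_of_nonneg (by linarith)]
    linarith
  let z : Fin 4 → ℝ → ℝ := fun i lam => (φ i (sigma k - lam)).2.1
  let w : Fin 4 → ℝ → ℝ := fun i lam => (φ i (sigma k - lam)).2.2
  have hscaled : ∀ i lam, scaled k (z i) (w i) lam =
      (sigma k - (sigma k - lam), √(sigma k - lam) • (φ i (sigma k - lam)).2) := fun i lam => by
    rw [sub_sub_cancel]; rfl
  have hpt : ∀ i, ∀ lam ∈ Set.Ioc (sigma k - ε) (sigma k),
      scaled k (z i) (w i) lam ∈ R.zeroH ∧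
      R.Psi (scaled k (z i) (w i) lam) =
        (lam, √(sigma k - lam) • assemble k (φ i (sigma k - lam))) ∧
      F (R.Psi (scaled k (z i) (w i) lam)) = 0 := by
    intro i lam hlam
    obtain ⟨h1, h2⟩ := hrange lam hlam
    obtain ⟨hb, -, hzero⟩ := hball h2
    have := R.branch_point hk.pos h1 (hzero i) (hb i).1
    rw [hscaled]
    refine ⟨this.1, ?_, ?_⟩
    · rw [this.2.1, sub_sub_cancel]
    · rw [this.2.1]; exact this.2.2
  have hCD : ∀ i, ∀ lam ∈ Set.Ioc (sigma k - ε) (sigma k),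
      ContDiffAt ℝ 1 (fun l => φ i (sigma k - l)) lam := by
    intro i lam hlam
    have h1 := ((hball (hrange lam hlam).2).2.1 i).of_le (m := 1) (by simp)
    exact h1.comp lam (f := fun l => sigma k - l) (contDiffAt_const.sub contDiffAt_id)
  have hval : ∀ i, (z i (sigma k), w i (sigma k)) = root k i := fun i => by
    simp only [z, w, sub_self, h0]
  rw [hσ]
  refine ⟨ε, hε, z, w, fun i => ⟨fun lam hlam => ?_, fun lam hlam => ?_⟩, ?_, ?_, ?_, ?_,
    fun i => ⟨fun lam hlam => (hpt i lam hlam).1, ?_, ?_⟩, fun i lam hlam => ?_,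
    fun i j hij lam hlam => ?_, ?_⟩
  · exact ((hCD i lam hlam).snd.fst).contDiffWithinAt
  · exact ((hCD i lam hlam).snd.snd).contDiffWithinAt
  · exact Prod.ext_iff.1 (hval 0)
  · rw [neg_div]; exact Prod.ext_iff.1 (hval 1)
  · rw [neg_div]; exact Prod.ext_iff.1 (hval 2)
  · rw [neg_div]; exact Prod.ext_iff.1 (hval 3)
  · refine ContinuousOn.congr (f := fun lam =>
      (lam, √(sigma k - lam) • assemble k (φ i (sigma k - lam)))) (fun lam hlam => ?_)
      fun lam hlam => (hpt i lam hlam).2.1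
    have h1 : ContinuousAt (fun l : ℝ => √(sigma k - l)) lam := by fun_prop
    exact (continuousAt_id.prodMk (h1.smul ((assemble k).continuous.continuousAt.comp
      (hCD i lam hlam).continuousAt))).continuousWithinAt
  · rw [(hpt i _ ⟨by linarith, le_rfl⟩).2.1, sub_self, Real.sqrt_zero, zero_smul]
  · have hlam' := Set.Ioo_subset_Ioc_self hlam
    obtain ⟨-, h2, h3⟩ := hpt i lam hlam'
    obtain ⟨-, hzer, hne, -⟩ := (hball (hrange lam hlam').2).1 i
    have hs0 : √(sigma k - lam) ≠ 0 := (Real.sqrt_pos.2 (sub_pos.2 hlam.2)).ne'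
    refine ⟨h3, ?_, ?_⟩
    · rw [h2]; exact smul_ne_zero hs0 hne
    · rw [h2]; exact hzer _ hs0
  · have hlam' := Set.Ioo_subset_Ioc_self hlam
    obtain ⟨-, -, -, hne⟩ := (hball (hrange lam hlam').2).1 i
    have hs0 : √(sigma k - lam) ≠ 0 := (Real.sqrt_pos.2 (sub_pos.2 hlam.2)).ne'
    rw [(hpt i lam hlam').2.1, (hpt j lam hlam').2.1]
    intro h
    have h1 := smul_right_injective H2 hs0 (Prod.ext_iff.1 h).2
    refine hne j hij ?_
    rw [← coef_assemble hk.pos (φ i _), ← coef_assemble hk.pos (φ j _)]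
    exact congrArg (fun u => coef k (D 0 u)) h1
  · have hε' : ∀ᶠ q : ℝ × H2 in 𝓝 (sigma k, 0), sigma k - ε < q.1 :=
      continuousAt_fst.eventually (lt_mem_nhds (by simpa using hε))
    obtain ⟨V, hV, hVo, hVm⟩ := mem_nhds_iff.1 ((eventually_on_branch hk hu).and hε')
    refine ⟨V, hVo, hVm, fun lam u hq hF => ⟨fun hle => ?_, fun hlt hu0 => ?_⟩⟩
    · by_contra hne
      exact absurd ((hV hq).1 hF hne).1 (not_lt.2 hle)
    · obtain ⟨hbr, hlow⟩ := hV hq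
      obtain ⟨-, i, hi⟩ := hbr hF hu0
      refine ⟨hlow, i, ?_⟩
      rw [(hpt i lam ⟨hlow, hlt.le⟩).2.1]
      exact Prod.ext rfl hi
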